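/- Graphs are finite and simple. Let $H$ be a graph. A \emph{movement on $H$ of length $m\ge 1$} consists of vertex sets $X_0,\dots,X_m\subseteq V(H)$ and paths $M_1,\dots,M_m$ in $H$, each with at least one edge, such that for $i=1,\dots,m$ the symmetric difference $X_{i-1}\bigtriangleup X_i$ consists precisely of the two end vertices of $M_i$, and $M_i$ contains no vertex of $X_{i-1}\cap X_i$. An \emph{$(X,Y)$-pairing} is a $1$-regular graph on $(X\times\{0\})\cup(Y\times\{\infty\})$. For $1\le i\le m$ let $R_i$ be the graph on $(X_{i-1}\times\{i-1\})\cup(X_i\times\{i\})$ with the edges $(x,i-1)(x,i)$ for $x\in X_{i-1}\cap X_i$ and one further edge joining the two vertices whose first coordinates are the ends of $M_i$. The \emph{induced pairing} of the movement is the $(X_0,X_m)$-pairing in which two distinct vertices are adjacent if and only if they lie in the same component of $R_1\cup\dots\cup R_m$, where $(y,\infty)$ is identified with $(y,m)$. An \emph{$L$-movement} is a movement with induced pairing $L$. A vertex $x$ is \emph{singular} for the movement if it is not an inner vertex of any $M_i$ and $\{i : x\in X_i\}$ is a (possibly empty) set of consecutive integers; a set of vertices is singular if all its elements are. A set $A\subseteq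 V(H)$ is \emph{marginal} if $H-A$ is connected (and non-empty) and every vertex of $A$ has a neighbour in $H-A$. A \emph{block} of a graph is a maximal connected subgraph without a cutvertex. For a subgraph $D$ of $H$, $|D|$ is its number of vertices and $N(D)$ is the set of vertices of $H$ outside $D$ that have a neighbour (in $H$) in $D$. \textbf{Lemma.} Let $n\in\mathbb N$ and define $f:\mathbb N_0\to\mathbb N_0$ by $f(0)=0$ and $f(k)=2k+2\cdot n!+4+f(k-1)$ for $k>0$. Let $k$ be a positive integer and let $H$ be a connected graph on at most $n$ vertices with a marginal set $A$. Let $X,Y\subseteq V(H)$ with $|X|+|Y|=2k$ and $X\cap Y\cap A=\emptyset$ such that neither $X$ nor $Y$ contains all vertices of $H-A$. Suppose that there is a block $D$ of $H-A$ such that $D$ contains a triangle and $2|D|+|N(D)|\ge 2k+3$. Then for every $(X,Y)$-pairing $L$ there is an $L$-movement of length at most $f(k)$ on $H$ for which $A$ is singular. -/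

import Mathlib

namespace TokenGame

/-- The bound `f(k)` for graphs on at most `n` vertices:
`f(0) = 0` and `f(k) = 2k + 2 * n! + 4 + f(k-1)` for `k > 0`. -/
def lengthBound (n : ℕ) : ℕ → ℕ
  | 0 => 0
  | k + 1 => 2 * (k + 1) + 2 * n.factorial + 4 + lengthBound n k

section Graphs

variable {V : Type*}

/-- The graph `H - A`, as a subgraph of `H`. -/
def minus (H : SimpleGraph V) (A : Finset V) : H.Subgraph :=
  (⊤ : H.Subgraph).deleteVerts (A : Set V)

/-- `A` is marginal in `H`: `H - A` is connected (in particular non-empty) and every vertex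
of `A` has a neighbour in `H - A`. -/
def IsMarginal (H : SimpleGraph V) (A : Finset V) : Prop :=
  (minus H A).Connected ∧ ∀ a ∈ A, ∃ b, b ∉ A ∧ H.Adj a b

/-- `D` is connected and has no cutvertex, that is, deleting any one vertex does not
disconnect it. (A single vertex and a single edge qualify.) -/
def ConnectedNoCutvertex {H : SimpleGraph V} (D : H.Subgraph) : Prop :=
  D.Connected ∧ ∀ v ∈ D.verts, (D.deleteVerts {v}).Preconnected

/-- `D` is a block of the subgraph `K` of `H`: a maximal connected subgraph of `K` without
a cutvertex. -/
def IsBlock {H : SimpleGraph V} (K D : H.Subgraph) : Prop :=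
  Maximal (fun D' : H.Subgraph => D' ≤ K ∧ ConnectedNoCutvertex D') D

/-- `D` contains a triangle. -/
def ContainsTriangle {H : SimpleGraph V} (D : H.Subgraph) : Prop :=
  ∃ a b c, D.Adj a b ∧ D.Adj b c ∧ D.Adj c a

/-- The neighbourhood `N(D)` of `D` in `H`: the vertices of `H` outside `D` that have
a neighbour in `D`. -/
def nbhd {H : SimpleGraph V} (D : H.Subgraph) : Set V :=
  {w | w ∉ D.verts ∧ ∃ u ∈ D.verts, H.Adj u w}

end Graphs

section Pairings

variable {V : Type*}

/-- `L` is an `(X, Y)`-pairing: a `1`-regular graph on `(X × {0}) ∪ (Y × {∞})`.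
The vertex `(x, 0)` is represented by `Sum.inl x` and `(y, ∞)` by `Sum.inr y`, so that
the vertex set is `X.disjSum Y`; no edge of `L` leaves it. -/
def IsPairing (X Y : Finset V) (L : SimpleGraph (V ⊕ V)) : Prop :=
  (∀ p q, L.Adj p q → p ∈ X.disjSum Y) ∧ ∀ p ∈ X.disjSum Y, ∃! q, L.Adj p q

end Pairings

/-- A non-trivial path of `H`, with its two end vertices named. -/
structure Move {V : Type*} (H : SimpleGraph V) where
  src : V
  tgt : V
  walk : H.Walk src tgt
  isPath : walk.IsPath
  ne : src ≠ tgt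

/-- A movement on `H` of length `n = length ≥ 1`: configurations `X_0, …, X_n` and non-trivial
paths `M_1, …, M_n`. Here `config i` is `X_i` for `i ≤ length`, and `move i` is the path
`M_{i+1}` that leads from `X_i` to `X_{i+1}`, for `i < length`; the values at all other
indices play no role anywhere. -/
structure Movement {V : Type*} [DecidableEq V] (H : SimpleGraph V) where
  length : ℕ
  length_pos : 0 < length
  config : ℕ → Finset V
  move : ℕ → Move H
  /-- The two configurations differ precisely in the two end vertices of the path. -/
  ends : ∀ i < length,
    symmDiff (config i) (config (i + 1)) = {(move i).src, (move i).tgt}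
  /-- The path avoids all vertices that are occupied both before and after. -/
  avoids : ∀ i < length, ∀ x ∈ (move i).walk.support, x ∉ config i ∩ config (i + 1)

namespace Movement

variable {V : Type*} [DecidableEq V] {H : SimpleGraph V} (𝓜 : Movement H)

/-- Membership in `(X_i × {i}) ∪ (X_{i+1} × {i+1})`. -/
def InLayer (i : ℕ) (p : V × ℕ) : Prop :=
  (p.2 = i ∧ p.1 ∈ 𝓜.config i) ∨ (p.2 = i + 1 ∧ p.1 ∈ 𝓜.config (i + 1))

/-- The edges contributed by the `i`-th step: `(x, i)(x, i+1)` for each `x` in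
`X_i ∩ X_{i+1}`, and one edge joining the two vertices of
`(X_i × {i}) ∪ (X_{i+1} × {i+1})` that lie over the end vertices of the path. -/
def StepEdge (i : ℕ) (p q : V × ℕ) : Prop :=
  (∃ x ∈ 𝓜.config i ∩ 𝓜.config (i + 1), p = (x, i) ∧ q = (x, i + 1)) ∨
  (p.1 = (𝓜.move i).src ∧ q.1 = (𝓜.move i).tgt ∧ 𝓜.InLayer i p ∧ 𝓜.InLayer i q)

/-- The graph tracing the tokens: the union of the edges of all steps. Only its components
matter, so multiplicities of edges are dropped, and pairs `(x, i)` that are not vertices of the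
trace are harmless isolated vertices. -/
def trace : SimpleGraph (V × ℕ) :=
  SimpleGraph.fromRel fun p q => ∃ i < 𝓜.length, 𝓜.StepEdge i p q

/-- `(x, 0)` stands for itself and `(y, ∞)` for `(y, n)`, where `n` is the length. -/
def endVertex : V ⊕ V → V × ℕ
  | Sum.inl x => (x, 0)
  | Sum.inr y => (y, 𝓜.length)

/-- The induced pairing: two different vertices of `(X_0 × {0}) ∪ (X_n × {∞})` are joined if
and only if they lie in the same component of the trace. -/
def inducedPairing : SimpleGraph (V ⊕ V) where
  Adj p q := p ≠ q ∧
    p ∈ (𝓜.config 0).disjSum (𝓜.config 𝓜.length) ∧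
    q ∈ (𝓜.config 0).disjSum (𝓜.config 𝓜.length) ∧
    𝓜.trace.Reachable (𝓜.endVertex p) (𝓜.endVertex q)
  symm := ⟨fun _ _ h => ⟨h.1.symm, h.2.2.1, h.2.1, h.2.2.2.symm⟩⟩
  loopless := ⟨fun _ h => h.1 rfl⟩

/-- `x` is singular: it is not an inner vertex of any move, and the indices `i` in `0, …, n`
with `x ∈ X_i` are consecutive (possibly there are none). -/
def IsSingular (x : V) : Prop :=
  (∀ i < 𝓜.length, x ∈ (𝓜.move i).walk.support →
    x = (𝓜.move i).src ∨ x = (𝓜.move i).tgt) ∧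
  ∀ i j l, i ≤ j → j ≤ l → l ≤ 𝓜.length →
    x ∈ 𝓜.config i → x ∈ 𝓜.config l → x ∈ 𝓜.config j

end Movement

end TokenGame

/-! Label every vertex of $X$ and $Y$ by its edge of $L$, so that each label occurs exactly twice
among the ends of the movement. Labels are constant along the trace. Hence a movement of labelled
tokens in which every end is linked to some other end has induced pairing $L$
(`RealizableIn.exists_movement`). It remains to connect two labelled configurations `α` and `β`.
Reversing time exchanges them, so moves may be spent at either end: slide a token, let two tokens
with equal labels meet, or bring a token to its final position. Singularity of $A$ is controlled by
a set `U` of vertices that the rest of the movement may use: a vertex outside `G`, the complement of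
$A$, that has been left must not belong to `U`.

Two tools carry the proof. On the block $D$, tokens can be permuted arbitrarily as soon as one
vertex is free (`shufflable_of_connectedNoCutvertex`): this is a sliding puzzle, solved first on a
triangle, which permits transpositions, and then ear by ear. A simple path in the graph of puzzle
states has fewer than $|V|!$ steps (`Realizable.shuffle`), which gives the factorials in the bound.
Away from $D$ labels are ignored: tokens can be brought to any admissible vertex set of the right
size with one move per token (`exists_transit`).

The main induction is on $k$. If both configurations fit on $D\cup N(D)$, they are moved there, and
the pairs are resolved one at a time on $D$ (`IsTask.of_fits`, `settledRealizable`). Otherwise one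
side overflows. It is made to fill $D$ up to one vertex, together with every neighbour of $D$
available to it; then $2|D|+|N(D)|\ge 2k+3$ and the pigeonhole principle give a token on $D$ whose
partner is on $D$ or next to it. This pair is resolved and induction applies (`IsTask.of_overflow`).
-/

set_option linter.unusedSectionVars false

namespace TokenGame

/-! ### Labelled movements: reversal, prepending a move, adding a resting token. -/

section Realizable

variable {V : Type*} {ι : Type*} {H : SimpleGraph V}

/-- A single move between two labelled configurations: the labels change only at the ends of the
path, each end is occupied exactly once, and both occurrences carry the same label. -/
structure LabelledStep (M : Move H) (a b : V → Option ι) : Prop where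
  same : ∀ v, v ≠ M.src → v ≠ M.tgt → a v = b v
  free : ∀ v ∈ M.walk.support, v ≠ M.src → v ≠ M.tgt → a v = none
  label : ∃ i, (a M.src = some i ∧ b M.src = none ∨ a M.src = none ∧ b M.src = some i) ∧
    (a M.tgt = some i ∧ b M.tgt = none ∨ a M.tgt = none ∧ b M.tgt = some i)

theorem LabelledStep.symm {M : Move H} {a b : V → Option ι} (h : LabelledStep M a b) :
    LabelledStep M b a := by
  refine ⟨fun v h1 h2 => (h.same v h1 h2).symm, fun v hv h1 h2 => ?_, ?_⟩
  · rw [← h.same v h1 h2]; exact h.free v hv h1 h2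
  · obtain ⟨i, h1, h2⟩ := h.label
    exact ⟨i, by tauto, by tauto⟩

/-- The edges of the trace contributed by the `i`-th step. -/
def Link (c : ℕ → V → Option ι) (M : ℕ → Move H) (i : ℕ) (p q : V × ℕ) : Prop :=
  (∃ x, c i x ≠ none ∧ c (i + 1) x ≠ none ∧ p = (x, i) ∧ q = (x, i + 1)) ∨
  (p.1 = (M i).src ∧ q.1 = (M i).tgt ∧ (p.2 = i ∨ p.2 = i + 1) ∧ (q.2 = i ∨ q.2 = i + 1) ∧
    c p.2 p.1 ≠ none ∧ c q.2 q.1 ≠ none)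

/-- Two vertices lie in the same component of the trace. -/
def Linked (c : ℕ → V → Option ι) (M : ℕ → Move H) (m : ℕ) : V × ℕ → V × ℕ → Prop :=
  Relation.EqvGen fun p q => ∃ i < m, Link c M i p q

theorem Linked.refl {c : ℕ → V → Option ι} {M : ℕ → Move H} {m : ℕ} (p : V × ℕ) :
    Linked c M m p p := Relation.EqvGen.refl p

theorem Linked.symm {c : ℕ → V → Option ι} {M : ℕ → Move H} {m : ℕ} {p q : V × ℕ}
    (h : Linked c M m p q) : Linked c M m q p := Relation.EqvGen.symm _ _ h

theorem Linked.trans {c : ℕ → V → Option ι} {M : ℕ → Move H} {m : ℕ} {p q r : V × ℕ}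
    (h : Linked c M m p q) (h' : Linked c M m q r) : Linked c M m p r :=
  Relation.EqvGen.trans _ _ _ h h'

theorem Linked.map {c c' : ℕ → V → Option ι} {M M' : ℕ → Move H} {m m' : ℕ}
    (f : V × ℕ → V × ℕ)
    (hf : ∀ i < m, ∀ p q, Link c M i p q → Linked c' M' m' (f p) (f q)) {p q : V × ℕ}
    (h : Linked c M m p q) : Linked c' M' m' (f p) (f q) := by
  induction h with
  | rel p q h => obtain ⟨i, hi, h⟩ := h; exact hf i hi p q h
  | refl p => exact Linked.refl _
  | symm p q _ ih => exact ih.symm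
  | trans p q r _ _ ih1 ih2 => exact ih1.trans ih2

theorem Linked.of_link {c : ℕ → V → Option ι} {M : ℕ → Move H} {m i : ℕ} (hi : i < m)
    {p q : V × ℕ} (h : Link c M i p q) : Linked c M m p q :=
  Relation.EqvGen.rel _ _ ⟨i, hi, h⟩

/-- The position in the trace of an end of the movement. -/
def endPoint (m : ℕ) : V ⊕ V → V × ℕ :=
  Sum.elim (fun x => (x, 0)) (fun y => (y, m))

/-- A movement of length `m` with labelled tokens, with all inner vertices of its paths in `G` and
all tokens in `U`, for which every vertex outside `G` is singular. -/
structure IsRun (G U : Finset V) (m : ℕ) (c : ℕ → V → Option ι) (M : ℕ → Move H) : Prop where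
  step : ∀ i < m, LabelledStep (M i) (c i) (c (i + 1))
  inner : ∀ i < m, ∀ v ∈ (M i).walk.support, v ≠ (M i).src → v ≠ (M i).tgt → v ∈ G
  mem : ∀ i ≤ m, ∀ v, c i v ≠ none → v ∈ U
  interval : ∀ v ∉ G, ∀ i j l, i ≤ j → j ≤ l → l ≤ m → c i v ≠ none → c l v ≠ none → c j v ≠ none
  -- A link to some other end is enough: labels are preserved along links, so when each label occurs
  -- twice the other end must be the partner.
  ends : ∀ p : V ⊕ V, Sum.elim (c 0) (c m) p ≠ none →
    ∃ q, q ≠ p ∧ Sum.elim (c 0) (c m) q ≠ none ∧ Linked c M m (endPoint m p) (endPoint m q)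

/-- There is a labelled movement of length exactly `m` from `α` to `β`. -/
def RealizableIn (H : SimpleGraph V) (G U : Finset V) (α β : V → Option ι) (m : ℕ) : Prop :=
  ∃ (c : ℕ → V → Option ι) (M : ℕ → Move H), c 0 = α ∧ c m = β ∧ IsRun G U m c M

/-- The path `M` is only a default value for the sequence of moves; none of its terms is used. -/
theorem RealizableIn.refl {G U : Finset V} {α : V → Option ι} (M : Move H)
    (hU : ∀ v, α v ≠ none → v ∈ U) : RealizableIn H G U α α 0 := by
  refine ⟨fun _ => α, fun _ => M, rfl, rfl, ⟨by simp, by simp, fun i _ => hU, ?_, ?_⟩⟩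
  · intro v _ i j l _ _ _ h _
    exact h
  · rintro (x | x) hx
    · exact ⟨Sum.inr x, by simp, hx, Linked.refl _⟩
    · exact ⟨Sum.inl x, by simp, hx, Linked.refl _⟩

theorem RealizableIn.mono {G G' U U' : Finset V} {α β : V → Option ι} {m : ℕ}
    (h : RealizableIn H G U α β m) (hG : G ⊆ G') (hU : U ⊆ U') :
    RealizableIn H G' U' α β m := by
  obtain ⟨c, M, h0, hm, h⟩ := h
  exact ⟨c, M, h0, hm, h.step, fun i hi v hv h1 h2 => hG (h.inner i hi v hv h1 h2),
    fun i hi v hv => hU (h.mem i hi v hv), fun v hv => h.interval v (fun h' => hv (hG h')), h.ends⟩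

/-- Time is reflected: configuration `i` becomes configuration `m - i`, and move `i`, which lies
between `i` and `i + 1`, becomes move `m - 1 - i`. -/
theorem RealizableIn.symm {G U : Finset V} {α β : V → Option ι} {m : ℕ}
    (h : RealizableIn H G U α β m) : RealizableIn H G U β α m := by
  obtain ⟨c, M, h0, hm, h⟩ := h
  have hmap : ∀ {p q : V × ℕ}, Linked c M m p q →
      Linked (fun i => c (m - i)) (fun i => M (m - 1 - i)) m (p.1, m - p.2) (q.1, m - q.2) := by
    intro p q hpq
    refine Linked.map (fun p => (p.1, m - p.2)) ?_ hpq
    intro i hi p q hl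
    have e1 : m - (m - 1 - i) = i + 1 := by omega
    have e2 : m - (m - 1 - i + 1) = i := by omega
    have e3 : m - i = m - 1 - i + 1 := by omega
    have e4 : m - (i + 1) = m - 1 - i := by omega
    have e5 : m - 1 - (m - 1 - i) = i := by omega
    rcases hl with ⟨x, h1, h2, rfl, rfl⟩ | ⟨h1, h2, h3, h4, h5, h6⟩
    · refine (Linked.of_link (i := m - 1 - i) (by omega) (Or.inl ⟨x, ?_, ?_, ?_, ?_⟩)).symm
      · simpa only [e1] using h2
      · simpa only [e2] using h1
      · simp only [e4]
      · simp only [e3]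
    · refine Linked.of_link (i := m - 1 - i) (by omega)
        (Or.inr ⟨by simpa only [e5] using h1, by simpa only [e5] using h2, ?_, ?_, ?_, ?_⟩)
      · simp only; omega
      · simp only; omega
      · have : m - (m - p.2) = p.2 := by omega
        simpa only [this] using h5
      · have : m - (m - q.2) = q.2 := by omega
        simpa only [this] using h6
  refine ⟨fun i => c (m - i), fun i => M (m - 1 - i), by simpa using hm, by simpa using h0,
    ⟨fun i hi => ?_, fun i hi => h.inner _ (by omega), fun i hi => h.mem _ (by omega), ?_, ?_⟩⟩
  · have e1 : m - i = m - 1 - i + 1 := by omega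
    have e2 : m - (i + 1) = m - 1 - i := by omega
    simp only [e1, e2]
    exact (h.step (m - 1 - i) (by omega)).symm
  · intro v hv i j l hij hjl hl h1 h2
    exact h.interval v hv (m - l) (m - j) (m - i) (by omega) (by omega) (by omega) h2 h1
  · have key : ∀ p : V ⊕ V, ((endPoint m p.swap).1, m - (endPoint m p.swap).2) = endPoint m p := by
      rintro (x | x) <;> simp [endPoint]
    have key' : ∀ p : V ⊕ V, Sum.elim (c (m - 0)) (c (m - m)) p = Sum.elim (c 0) (c m) p.swap := by
      rintro (x | x) <;> simp
    intro p hp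
    rw [key'] at hp
    obtain ⟨q, hq, hq', hl⟩ := h.ends p.swap hp
    refine ⟨q.swap, ?_, ?_, ?_⟩
    · rintro rfl; simp at hq
    · rw [key']; simpa using hq'
    · have := hmap hl
      rw [key] at this
      have h3 := key q.swap
      rw [Sum.swap_swap] at h3
      rwa [h3] at this

/-- Prepending a move that does not create tokens. -/
theorem RealizableIn.prepend [DecidableEq V] {G U : Finset V} {α α' β : V → Option ι} {m : ℕ}
    (h : RealizableIn H G U α' β m) (M₀ : Move H) (hs : LabelledStep M₀ α α')
    (hne : α M₀.src ≠ none)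
    (hin : ∀ v ∈ M₀.walk.support, v ≠ M₀.src → v ≠ M₀.tgt → v ∈ G)
    (hU : ∀ v, α v ≠ none → α' v = none → v ∉ G → v ∉ U) {U' : Finset V} (hUU : U ⊆ U')
    (hU' : ∀ v, α v ≠ none → v ∈ U') :
    RealizableIn H G U' α β (m + 1) := by
  obtain ⟨c, M, h0, hm, h⟩ := h
  set c' : ℕ → V → Option ι := fun i => Nat.casesOn i α c with hc'
  set M' : ℕ → Move H := fun i => Nat.casesOn i M₀ M with hM'
  have hmap : ∀ {p q : V × ℕ}, Linked c M m p q →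
      Linked c' M' (m + 1) (p.1, p.2 + 1) (q.1, q.2 + 1) := by
    intro p q hpq
    refine Linked.map (fun p => (p.1, p.2 + 1)) ?_ hpq
    intro i hi p q hl
    refine Linked.of_link (i := i + 1) (by omega) ?_
    rcases hl with ⟨x, h1, h2, rfl, rfl⟩ | ⟨h1, h2, h3, h4, h5, h6⟩
    · exact Or.inl ⟨x, h1, h2, rfl, rfl⟩
    · exact Or.inr ⟨h1, h2, by simp only; omega, by simp only; omega, h5, h6⟩
  have hst := M₀.ne
  -- `τ` carries occupied ends of the shorter movement to the corresponding ends of the longer one: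
  -- after a slide, the token at the target came from the source. If instead two tokens met, both
  -- vertices are empty in `α'` and the exchange is immaterial.
  set τ : V ⊕ V → V ⊕ V := Sum.map (Equiv.swap M₀.src M₀.tgt) id with hτ
  have hτinj : Function.Injective τ :=
    Sum.map_injective.2 ⟨(Equiv.swap M₀.src M₀.tgt).injective, Function.injective_id⟩
  -- an edge between the two ends of the new path
  have hedge : ∀ a b : ℕ, (a = 0 ∨ a = 1) → (b = 0 ∨ b = 1) → c' a M₀.src ≠ none →
      c' b M₀.tgt ≠ none → Linked c' M' (m + 1) (M₀.src, a) (M₀.tgt, b) := fun a b ha hb h1 h2 =>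
    Linked.of_link (i := 0) (by omega) (Or.inr ⟨rfl, rfl, by simpa using ha, by simpa using hb, h1, h2⟩)
  have hτl : ∀ q : V ⊕ V, Sum.elim α' β q ≠ none → Sum.elim α β (τ q) ≠ none ∧
      Linked c' M' (m + 1) (endPoint (m + 1) (τ q))
        ((endPoint m q).1, (endPoint m q).2 + 1) := by
    rintro (w | w) hw
    · simp only [Sum.elim_inl] at hw
      simp only [hτ, Sum.map_inl, Sum.elim_inl, endPoint]
      obtain ⟨i, hl1, hl2⟩ := hs.label
      by_cases h1 : w = M₀.src
      · exfalso; subst h1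
        rcases hl1 with hl1 | hl1
        · exact hw hl1.2
        · exact hne hl1.1
      by_cases h2 : w = M₀.tgt
      · subst h2
        rw [Equiv.swap_apply_right]
        refine ⟨hne, hedge 0 1 (by simp) (by simp) hne ?_⟩
        simpa [hc', h0] using hw
      · rw [Equiv.swap_apply_of_ne_of_ne h1 h2]
        have := hs.same w h1 h2
        refine ⟨by rwa [this], Linked.of_link (i := 0) (by omega) (Or.inl ⟨w, ?_, ?_, rfl, rfl⟩)⟩
        · simpa [hc', this] using hw
        · simpa [hc', h0] using hw
    · exact ⟨hw, Linked.refl _⟩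
  have hends : ∀ q, Sum.elim α' β q ≠ none → ∃ q', q' ≠ τ q ∧ Sum.elim α β q' ≠ none ∧
      Linked c' M' (m + 1) (endPoint (m + 1) (τ q)) (endPoint (m + 1) q') := by
    intro q hq
    obtain ⟨r, hr, hr', hl⟩ := h.ends q (by rwa [h0, hm])
    rw [h0, hm] at hr'
    exact ⟨τ r, fun e => hr (hτinj e), (hτl r hr').1,
      ((hτl q hq).2.trans (hmap hl)).trans (hτl r hr').2.symm⟩
  refine ⟨c', M', rfl, hm, ⟨?_, ?_, ?_, ?_, ?_⟩⟩
  · rintro (_ | i) hi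
    · simpa [hc', hM', h0] using hs
    · exact h.step i (by omega)
  · rintro (_ | i) hi
    · exact hin
    · exact h.inner i (by omega)
  · rintro (_ | i) hi
    · exact hU'
    · exact fun v hv => hUU (h.mem i (by omega) v hv)
  · intro v hv i j l hij hjl hlm h1 h2
    rcases l with _ | l
    · obtain rfl : j = 0 := by omega
      exact h2
    rcases j with _ | j
    · obtain rfl : i = 0 := by omega
      exact h1
    rcases i with _ | i
    -- A vertex outside `G` vacated by the first move is not in `U` and so stays empty. Otherwise it
    -- is still occupied in `α'`, and its interval merely grows by one.
    · by_cases h3 : α' v = none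
      · exact absurd (h.mem l (by omega) v h2) (hU v h1 h3 hv)
      · exact h.interval v hv 0 j l (by omega) (by omega) (by omega) (by rwa [h0]) h2
    · exact h.interval v hv i j l (by omega) (by omega) (by omega) h1 h2
  · have hend : Sum.elim (c' 0) (c' (m + 1)) = Sum.elim α β := by
      change Sum.elim α (c m) = _
      rw [hm]
    rw [hend]
    rintro (x | x) hx
    · simp only [Sum.elim_inl] at hx
      obtain ⟨i, hl1, hl2⟩ := hs.label
      by_cases h1 : x = M₀.src
      · subst h1
        rcases hl2 with hl2 | hl2
        · exact ⟨Sum.inl M₀.tgt, by simpa using hst.symm, by simp [hl2.1],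
            hedge 0 0 (by simp) (by simp) hx (by simp [hc', hl2.1])⟩
        · have := hends (Sum.inl M₀.tgt) (by simp [hl2.2])
          simpa [hτ] using this
      by_cases h2 : x = M₀.tgt
      · subst h2
        exact ⟨Sum.inl M₀.src, by simpa using hst, by simpa using hne,
          (hedge 0 0 (by simp) (by simp) hne hx).symm⟩
      · have := hends (Sum.inl x) (by simpa [← hs.same x h1 h2] using hx)
        simpa [hτ, Equiv.swap_apply_of_ne_of_ne h1 h2] using this
    · exact hends (Sum.inr x) hx

/-- This lets a token rest at its final position while the others move. Since `y` lies in neither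
`G` nor `U`, no path has it as an inner vertex and no other token stands on it. -/
theorem RealizableIn.add_static [DecidableEq V] {G U : Finset V} {α β : V → Option ι} {m : ℕ}
    (h : RealizableIn H G U α β m) {y : V} (hyG : y ∉ G) (hyU : y ∉ U) (i₀ : ι) :
    RealizableIn H G (insert y U) (Function.update α y (some i₀))
      (Function.update β y (some i₀)) m := by
  obtain ⟨c, M, h0, hm, h⟩ := h
  set c' : ℕ → V → Option ι := fun i => Function.update (c i) y (some i₀) with hc'
  have hcy : ∀ i ≤ m, c i y = none := fun i hi => by
    by_contra hne; exact hyU (h.mem i hi y hne)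
  have hval : ∀ i v, v ≠ y → c' i v = c i v := fun i v hv => by simp [hc', hv]
  have hy : ∀ i, c' i y = some i₀ := fun i => by simp [hc']
  have hle : ∀ i v, c i v ≠ none → c' i v ≠ none := fun i v hv => by
    by_cases hvy : v = y
    · subst hvy; simp [hy]
    · rwa [hval i v hvy]
  have hmap : ∀ {p q : V × ℕ}, Linked c M m p q → Linked c' M m p q := by
    intro p q hpq
    refine Linked.map id ?_ hpq
    intro i hi p q hl
    refine Linked.of_link hi ?_
    rcases hl with ⟨x, h1, h2, rfl, rfl⟩ | ⟨h1, h2, h3, h4, h5, h6⟩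
    · exact Or.inl ⟨x, hle _ _ h1, hle _ _ h2, rfl, rfl⟩
    · exact Or.inr ⟨h1, h2, h3, h4, hle _ _ h5, hle _ _ h6⟩
  have hline : ∀ j ≤ m, Linked c' M m (y, 0) (y, j) := by
    intro j
    induction j with
    | zero => intro _; exact Linked.refl _
    | succ j ih =>
      intro hj
      exact (ih (by omega)).trans
        (Linked.of_link (i := j) (by omega) (Or.inl ⟨y, by simp [hy], by simp [hy], rfl, rfl⟩))
  refine ⟨c', M, by simp [hc', h0], by simp [hc', hm], ⟨?_, h.inner, ?_, ?_, ?_⟩⟩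
  · intro i hi
    have hs := h.step i hi
    obtain ⟨l, hl1, hl2⟩ := hs.label
    have h1 := hcy i (by omega)
    have h2 := hcy (i + 1) (by omega)
    have hsrc : (M i).src ≠ y := by
      rintro rfl; simp [h1, h2] at hl1
    have htgt : (M i).tgt ≠ y := by
      rintro rfl; simp [h1, h2] at hl2
    refine ⟨?_, ?_, ⟨l, ?_, ?_⟩⟩
    · intro v hv1 hv2
      by_cases hvy : v = y
      · subst hvy; simp [hy]
      · rw [hval _ _ hvy, hval _ _ hvy]; exact hs.same v hv1 hv2
    · intro v hv hv1 hv2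
      have hvy : v ≠ y := by rintro rfl; exact hyG (h.inner i hi v hv hv1 hv2)
      rw [hval _ _ hvy]; exact hs.free v hv hv1 hv2
    · rwa [hval _ _ hsrc, hval _ _ hsrc]
    · rwa [hval _ _ htgt, hval _ _ htgt]
  · intro i hi v hv
    by_cases hvy : v = y
    · simp [hvy]
    · rw [hval _ _ hvy] at hv
      exact Finset.mem_insert_of_mem (h.mem i hi v hv)
  · intro v hv i j l hij hjl hl h1 h2
    by_cases hvy : v = y
    · simp [hvy, hy]
    · rw [hval _ _ hvy] at h1 h2 ⊢
      exact h.interval v hv i j l hij hjl hl h1 h2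
  · have hmain : ∀ p : V ⊕ V, Sum.elim (c 0) (c m) p ≠ none → ∃ q, q ≠ p ∧
        Sum.elim (c' 0) (c' m) q ≠ none ∧ Linked c' M m (endPoint m p) (endPoint m q) := by
      intro p hp
      obtain ⟨q, hq, hq', hl⟩ := h.ends p hp
      refine ⟨q, hq, ?_, hmap hl⟩
      rcases q with q | q
      · exact hle _ _ hq'
      · exact hle _ _ hq'
    rintro (x | x) hx
    · by_cases hxy : x = y
      · subst hxy
        exact ⟨Sum.inr x, by simp, by simp [hy], hline m le_rfl⟩
      · exact hmain _ (by simpa [hval _ _ hxy] using hx)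
    · by_cases hxy : x = y
      · subst hxy
        exact ⟨Sum.inl x, by simp, by simp [hy], (hline m le_rfl).symm⟩
      · exact hmain _ (by simpa [hval _ _ hxy] using hx)

end Realizable

/-! ### The elementary moves: sliding, meeting, and bringing a token home. -/

section Moves

variable {V : Type*} [DecidableEq V] {ι : Type*} {H : SimpleGraph V}

/-- There is a path from `x` to `y` all of whose inner vertices are in `G` and unoccupied. -/
def FreePath (H : SimpleGraph V) (G : Finset V) (α : V → Option ι) (x y : V) : Prop :=
  ∃ p : H.Walk x y, p.IsPath ∧ ∀ v ∈ p.support, v ≠ x → v ≠ y → v ∈ G ∧ α v = none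

theorem FreePath.symm {G : Finset V} {α : V → Option ι} {x y : V} (h : FreePath H G α x y) :
    FreePath H G α y x := by
  obtain ⟨p, hp, h⟩ := h
  refine ⟨p.reverse, hp.reverse, fun v hv h1 h2 => h v ?_ h2 h1⟩
  simpa using hv

theorem FreePath.of_adj {G : Finset V} {α : V → Option ι} {x y : V} (h : H.Adj x y) :
    FreePath H G α x y := by
  refine ⟨h.toWalk, by simp [h.ne], fun v hv h1 h2 => ?_⟩
  simp at hv
  tauto

theorem RealizableIn.mem_left {G U : Finset V} {α β : V → Option ι} {m : ℕ}
    (h : RealizableIn H G U α β m) {v : V} (hv : α v ≠ none) : v ∈ U := by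
  obtain ⟨c, M, rfl, -, h⟩ := h
  exact h.mem 0 (by omega) v hv

theorem RealizableIn.slide {G U : Finset V} {α β : V → Option ι} {m : ℕ} {x y : V}
    (h : RealizableIn H G U (α ∘ Equiv.swap x y) β m) (hx : α x ≠ none) (hy : α y = none)
    (hp : FreePath H G α x y) (hU : x ∉ G → x ∉ U) :
    RealizableIn H G (insert x U) α β (m + 1) := by
  obtain ⟨p, hp, hin⟩ := hp
  have hxy : x ≠ y := by rintro rfl; exact hx hy
  obtain ⟨i, hi⟩ := Option.ne_none_iff_exists'.1 hx
  refine h.prepend ⟨x, y, p, hp, hxy⟩ ⟨?_, ?_, ⟨i, ?_, ?_⟩⟩ hx ?_ ?_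
    (Finset.subset_insert _ _) ?_
  · intro v h1 h2
    simp only at h1 h2
    simp [Equiv.swap_apply_of_ne_of_ne h1 h2]
  · exact fun v hv h1 h2 => (hin v hv h1 h2).2
  · left; simp [hi, hy]
  · right; simp [hi, hy]
  · exact fun v hv h1 h2 => (hin v hv h1 h2).1
  · intro v h1 h2 h3
    by_cases hvx : v = x
    · subst hvx; exact hU h3
    · by_cases hvy : v = y
      · subst hvy; exact absurd hy h1
      · simp only [Function.comp_apply, Equiv.swap_apply_of_ne_of_ne hvx hvy] at h2
        exact absurd h2 h1
  · intro v hv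
    by_cases hvx : v = x
    · simp [hvx]
    · have hvy : v ≠ y := by rintro rfl; exact hv hy
      refine Finset.mem_insert_of_mem (h.mem_left (v := v) ?_)
      simpa [Equiv.swap_apply_of_ne_of_ne hvx hvy] using hv

/-- Remove the tokens at `x` and `y`. -/
def erase₂ (α : V → Option ι) (x y : V) : V → Option ι := fun v => if v = x ∨ v = y then none else α v

theorem RealizableIn.kill {G U : Finset V} {α β : V → Option ι} {m : ℕ} {x y : V}
    (h : RealizableIn H G U (erase₂ α x y) β m) (hxy : x ≠ y) (hx : α x ≠ none) (hy : α x = α y)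
    (hp : FreePath H G α x y) (hUx : x ∉ G → x ∉ U) (hUy : y ∉ G → y ∉ U) :
    RealizableIn H G (insert x (insert y U)) α β (m + 1) := by
  obtain ⟨p, hp, hin⟩ := hp
  obtain ⟨i, hi⟩ := Option.ne_none_iff_exists'.1 hx
  refine h.prepend ⟨x, y, p, hp, hxy⟩ ⟨?_, ?_, ⟨i, ?_, ?_⟩⟩ hx ?_ ?_ ?_ ?_
  · intro v h1 h2
    simp only at h1 h2
    simp [erase₂, h1, h2]
  · exact fun v hv h1 h2 => (hin v hv h1 h2).2
  · left; simp [hi, erase₂]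
  · left; simp [← hy, hi, erase₂]
  · exact fun v hv h1 h2 => (hin v hv h1 h2).1
  · intro v h1 h2 h3
    by_cases hvx : v = x
    · subst hvx; exact hUx h3
    · by_cases hvy : v = y
      · subst hvy; exact hUy h3
      · simp [erase₂, hvx, hvy, h1] at h2
  · intro v hv; simp [hv]
  · intro v hv
    by_cases hvx : v = x
    · simp [hvx]
    · by_cases hvy : v = y
      · simp [hvy]
      · have := h.mem_left (v := v) (by simpa [erase₂, hvx, hvy] using hv)
        simp [this]

/-- There is a labelled movement of length at most `m` from `α` to `β`. -/
def Realizable (H : SimpleGraph V) (G U : Finset V) (α β : V → Option ι) (m : ℕ) : Prop :=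
  ∃ m' ≤ m, RealizableIn H G U α β m'

theorem Realizable.mono {G G' U U' : Finset V} {α β : V → Option ι} {m m' : ℕ}
    (h : Realizable H G U α β m) (hG : G ⊆ G') (hU : U ⊆ U') (hm : m ≤ m') :
    Realizable H G' U' α β m' := by
  obtain ⟨l, hl, h⟩ := h
  exact ⟨l, hl.trans hm, h.mono hG hU⟩

theorem Realizable.symm {G U : Finset V} {α β : V → Option ι} {m : ℕ}
    (h : Realizable H G U α β m) : Realizable H G U β α m := by
  obtain ⟨l, hl, h⟩ := h
  exact ⟨l, hl, h.symm⟩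

theorem Realizable.mem_left {G U : Finset V} {α β : V → Option ι} {m : ℕ}
    (h : Realizable H G U α β m) {v : V} (hv : α v ≠ none) : v ∈ U := by
  obtain ⟨l, hl, h⟩ := h
  exact h.mem_left hv

theorem Realizable.slide {G U : Finset V} {α β : V → Option ι} {m : ℕ} {x y : V}
    (h : Realizable H G U (α ∘ Equiv.swap x y) β m) (hx : α x ≠ none) (hy : α y = none)
    (hp : FreePath H G α x y) (hU : x ∉ G → x ∉ U) :
    Realizable H G (insert x U) α β (m + 1) := by
  obtain ⟨l, hl, h⟩ := h
  exact ⟨l + 1, by omega, h.slide hx hy hp hU⟩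

theorem Realizable.kill {G U : Finset V} {α β : V → Option ι} {m : ℕ} {x y : V}
    (h : Realizable H G U (erase₂ α x y) β m) (hxy : x ≠ y) (hx : α x ≠ none) (hy : α x = α y)
    (hp : FreePath H G α x y) (hUx : x ∉ G → x ∉ U) (hUy : y ∉ G → y ∉ U) :
    Realizable H G (insert x (insert y U)) α β (m + 1) := by
  obtain ⟨l, hl, h⟩ := h
  exact ⟨l + 1, by omega, h.kill hxy hx hy hp hUx hUy⟩

/-- Bring the token at `x` to its final position `y` outside `G`. -/
theorem Realizable.transport {G U : Finset V} {α β : V → Option ι} {m : ℕ} {x y : V}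
    (h : Realizable H G U (Function.update α x none) (Function.update β y none) m)
    (hx : α x ≠ none) (hxy : α x = β y) (hy : α y = none)
    (hp : FreePath H G α x y) (hUx : x ∉ G → x ∉ U) (hyG : y ∉ G) (hyU : y ∉ U) :
    Realizable H G (insert x (insert y U)) α β (m + 1) := by
  obtain ⟨l, hl, h⟩ := h
  obtain ⟨i, hi⟩ := Option.ne_none_iff_exists'.1 hx
  have hne : x ≠ y := by rintro rfl; exact hx hy
  have h1 := h.add_static hyG hyU i
  refine ⟨l + 1, by omega, RealizableIn.slide (y := y) ?_ hx hy hp ?_⟩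
  · convert h1 using 1
    · funext v
      by_cases hvy : v = y
      · subst hvy; simp [hi]
      · by_cases hvx : v = x
        · subst hvx; simp [hy, hne]
        · simp [Equiv.swap_apply_of_ne_of_ne hvx hvy, hvx, hvy]
    · funext v
      by_cases hvy : v = y
      · subst hvy; simp [← hxy, hi]
      · simp [hvy]
  · intro h; simp [hne, hUx h]

end Moves

/-! ### From labelled movements to movements with a prescribed induced pairing. -/

section Trace

variable {V : Type*} [DecidableEq V] [Fintype V] {ι : Type*} {H : SimpleGraph V}

/-- Reachability in the trace forces equal labels, which gives one inclusion of edge sets.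
Conversely each end is linked to some other end, which has the same label and therefore is the
unique `L`-neighbour. -/
theorem RealizableIn.exists_movement {G U : Finset V} {α β : V → Option ι} {m : ℕ}
    (h : RealizableIn H G U α β m) (hm : 0 < m) {X Y : Finset V}
    (hX : ∀ v, v ∈ X ↔ α v ≠ none) (hY : ∀ v, v ∈ Y ↔ β v ≠ none)
    {L : SimpleGraph (V ⊕ V)}
    (hL : ∀ p q, L.Adj p q ↔ p ≠ q ∧ Sum.elim α β p ≠ none ∧ Sum.elim α β p = Sum.elim α β q)
    (huniq : ∀ p q r, L.Adj p q → L.Adj p r → q = r) :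
    ∃ 𝓜 : Movement H, 𝓜.config 0 = X ∧ 𝓜.config 𝓜.length = Y ∧ 𝓜.inducedPairing = L ∧
      𝓜.length = m ∧ ∀ a, a ∉ G → 𝓜.IsSingular a := by
  classical
  obtain ⟨c, M, h0, hcm, h⟩ := h
  set s : ℕ → Finset V := fun i => Finset.univ.filter fun v => c i v ≠ none with hs
  have hmem : ∀ i v, v ∈ s i ↔ c i v ≠ none := fun i v => by simp [hs]
  let 𝓜 : Movement H :=
    { length := m
      length_pos := hm
      config := s
      move := M
      ends := by
        intro i hi
        have hst := h.step i hi
        obtain ⟨l, h1, h2⟩ := hst.label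
        ext v
        simp only [Finset.mem_symmDiff, hmem, Finset.mem_insert, Finset.mem_singleton]
        constructor
        · intro hv
          by_contra hne
          push Not at hne
          rw [hst.same v hne.1 hne.2] at hv
          tauto
        · rintro (rfl | rfl)
          · rcases h1 with h1 | h1 <;> simp [h1]
          · rcases h2 with h1 | h1 <;> simp [h1]
      avoids := by
        intro i hi v hv hv'
        have hst := h.step i hi
        obtain ⟨l, h1, h2⟩ := hst.label
        simp only [Finset.mem_inter, hmem] at hv'
        by_cases hv1 : v = (M i).src
        · subst hv1; rcases h1 with h1 | h1 <;> simp [h1] at hv'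
        by_cases hv2 : v = (M i).tgt
        · subst hv2; rcases h2 with h1 | h1 <;> simp [h1] at hv'
        exact hv'.1 (hst.free v hv hv1 hv2) }
  have hlab : ∀ i < m, ∀ p q, 𝓜.StepEdge i p q → c p.2 p.1 = c q.2 q.1 := by
    intro i hi p q hpq
    have hst := h.step i hi
    obtain ⟨l, h1, h2⟩ := hst.label
    rcases hpq with ⟨x, hx, rfl, rfl⟩ | ⟨e1, e2, h3, h4⟩
    · simp only [𝓜, Finset.mem_inter, hmem] at hx
      refine hst.same x ?_ ?_
      · rintro rfl; rcases h1 with h1 | h1 <;> simp [h1] at hx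
      · rintro rfl; rcases h2 with h1 | h1 <;> simp [h1] at hx
    · have h3' : c p.2 p.1 = some l := by
        simp only [𝓜, Movement.InLayer, hmem] at h3
        simp only [𝓜] at e1
        rcases h3 with ⟨e, h3⟩ | ⟨e, h3⟩ <;> rw [e] <;> rw [e1] at h3 ⊢ <;>
          rcases h1 with h1 | h1 <;> simp [h1] at h3 ⊢
      have h4' : c q.2 q.1 = some l := by
        simp only [𝓜, Movement.InLayer, hmem] at h4
        simp only [𝓜] at e2
        rcases h4 with ⟨e, h3⟩ | ⟨e, h3⟩ <;> rw [e] <;> rw [e2] at h3 ⊢ <;>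
          rcases h2 with h1 | h1 <;> simp [h1] at h3 ⊢
      rw [h3', h4']
  have hreach : ∀ p q, 𝓜.trace.Reachable p q → c p.2 p.1 = c q.2 q.1 := by
    intro p q hpq
    rw [SimpleGraph.reachable_iff_reflTransGen] at hpq
    induction hpq with
    | refl => rfl
    | tail _ hadj ih =>
      rw [ih]
      obtain ⟨-, ⟨i, hi, h'⟩ | ⟨i, hi, h'⟩⟩ := (SimpleGraph.fromRel_adj _ _ _).1 hadj
      · exact hlab i hi _ _ h'
      · exact (hlab i hi _ _ h').symm
  have hlinked : ∀ p q, Linked c M m p q → 𝓜.trace.Reachable p q := by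
    intro p q hpq
    induction hpq with
    | rel p q hr =>
      obtain ⟨i, hi, hr⟩ := hr
      by_cases hne : p = q
      · rw [hne]
      refine SimpleGraph.Adj.reachable ((SimpleGraph.fromRel_adj _ _ _).2
        ⟨hne, Or.inl ⟨i, hi, ?_⟩⟩)
      rcases hr with ⟨x, h1, h2, rfl, rfl⟩ | ⟨h1, h2, h3, h4, h5, h6⟩
      · exact Or.inl ⟨x, by simp [𝓜, hmem, h1, h2], rfl, rfl⟩
      · refine Or.inr ⟨h1, h2, ?_, ?_⟩
        · rcases h3 with e | e
          · exact Or.inl ⟨e, by rw [e] at h5; simpa [𝓜, hmem] using h5⟩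
          · exact Or.inr ⟨e, by rw [e] at h5; simpa [𝓜, hmem] using h5⟩
        · rcases h4 with e | e
          · exact Or.inl ⟨e, by rw [e] at h6; simpa [𝓜, hmem] using h6⟩
          · exact Or.inr ⟨e, by rw [e] at h6; simpa [𝓜, hmem] using h6⟩
    | refl p => exact SimpleGraph.Reachable.refl _
    | symm p q _ ih => exact ih.symm
    | trans p q r _ _ ih1 ih2 => exact ih1.trans ih2
  have hend : ∀ p, 𝓜.endVertex p = endPoint m p := by rintro (p | p) <;> rfl
  have hγ : ∀ p, c (endPoint m p).2 (endPoint m p).1 = Sum.elim α β p := by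
    rintro (p | p)
    · simp [endPoint, h0]
    · simp [endPoint, hcm]
  have hdom : ∀ p, p ∈ (𝓜.config 0).disjSum (𝓜.config 𝓜.length) ↔ Sum.elim α β p ≠ none := by
    rintro (p | p) <;> simp [𝓜, hmem, h0, hcm]
  refine ⟨𝓜, ?_, ?_, ?_, rfl, ?_⟩
  · ext v; rw [hX]; simp only [𝓜, hmem, h0]
  · ext v; rw [hY]; simp only [𝓜, hmem, hcm]
  · ext p q
    simp only [Movement.inducedPairing, hdom, hend]
    constructor
    · rintro ⟨h1, h2, -, h3⟩
      have := hreach _ _ h3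
      rw [hγ, hγ] at this
      exact (hL p q).2 ⟨h1, h2, this⟩
    · intro hadj
      obtain ⟨h1, h2, h3⟩ := (hL p q).1 hadj
      obtain ⟨r, hr, hr', hl⟩ := h.ends p (by rwa [h0, hcm])
      have h4 := hreach _ _ (hlinked _ _ hl)
      rw [hγ, hγ] at h4
      have : q = r := huniq p q r hadj ((hL p r).2 ⟨hr.symm, h2, h4⟩)
      subst this
      exact ⟨h1, h2, by rwa [← h3], hlinked _ _ hl⟩
  · intro a ha
    refine ⟨fun i hi ha' => ?_, fun i j l hij hjl hl h1 h2 => ?_⟩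
    · by_contra hne
      push Not at hne
      exact ha (h.inner i hi a ha' hne.1 hne.2)
    · simp only [𝓜, hmem] at h1 h2 ⊢
      exact h.interval a ha i j l hij hjl hl h1 h2

end Trace

/-! ### The sliding puzzle on a block that contains a triangle. -/

section Puzzle

variable {V : Type*} [DecidableEq V] {H : SimpleGraph V}

/-- The states of the sliding puzzle on `S` with blank token `b`: a permutation `σ` puts the token
`σ x` on the vertex `x`, and a step interchanges the blank token with a neighbouring token. -/
def puzzle (H : SimpleGraph V) (S : Finset V) (b : V) : SimpleGraph (Equiv.Perm V) where
  Adj σ τ := ∃ x ∈ S, ∃ y ∈ S, H.Adj x y ∧ (σ x = b ∨ σ y = b) ∧ τ = σ * Equiv.swap x y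
  symm := ⟨by
    rintro σ τ ⟨x, hx, y, hy, hxy, h, rfl⟩
    exact ⟨x, hx, y, hy, hxy, by simpa using h.symm, by simp [mul_assoc]⟩⟩
  loopless := ⟨by
    rintro σ ⟨x, hx, y, hy, hxy, h, he⟩
    have : Equiv.swap x y = 1 := by simpa using he.symm
    exact hxy.ne (Equiv.swap_eq_one_iff.1 this)⟩

/-- Every permutation of the tokens on `S` can be reached in the sliding puzzle. -/
def Shufflable (H : SimpleGraph V) (S : Finset V) : Prop :=
  ∀ (b : V) (σ π : Equiv.Perm V), σ.symm b ∈ S → (∀ x ∉ S, π x = x) →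
    (puzzle H S b).Reachable σ (σ * π)

theorem puzzle_reachable_swap {S : Finset V} {b x y : V} {σ : Equiv.Perm V} (hx : x ∈ S)
    (hy : y ∈ S) (hxy : H.Adj x y) (h : σ x = b ∨ σ y = b) :
    (puzzle H S b).Reachable σ (σ * Equiv.swap x y) :=
  SimpleGraph.Adj.reachable ⟨x, hx, y, hy, hxy, h, rfl⟩

theorem puzzle_reachable_mono {S T : Finset V} (hST : S ⊆ T) {b : V} {σ τ : Equiv.Perm V}
    (h : (puzzle H S b).Reachable σ τ) : (puzzle H T b).Reachable σ τ := by
  refine h.mono ?_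
  rintro σ τ ⟨x, hx, y, hy, h⟩
  exact ⟨x, hST hx, y, hST hy, h⟩

theorem puzzle_reachable_mul_left {S : Finset V} {b : V} {σ τ : Equiv.Perm V} (π : Equiv.Perm V)
    (hπ : π b = b) (h : (puzzle H S b).Reachable σ τ) :
    (puzzle H S b).Reachable (π * σ) (π * τ) := by
  let f : puzzle H S b →g puzzle H S b :=
    { toFun := fun σ => π * σ
      map_rel' := by
        rintro σ τ ⟨x, hx, y, hy, hxy, h, rfl⟩
        refine ⟨x, hx, y, hy, hxy, ?_, by simp [mul_assoc]⟩
        simp only [Equiv.Perm.mul_apply]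
        exact h.imp (fun h => by rw [h, hπ]) (fun h => by rw [h, hπ]) }
  exact h.map f

theorem puzzle_reachable_apply_eq {S : Finset V} {b : V} {σ τ : Equiv.Perm V}
    (h : (puzzle H S b).Reachable σ τ) {x : V} (hx : x ∉ S) : τ x = σ x := by
  rw [SimpleGraph.reachable_iff_reflTransGen] at h
  induction h with
  | refl => rfl
  | tail _ h ih =>
    obtain ⟨y, hy, z, hz, -, -, rfl⟩ := h
    rw [← ih, Equiv.Perm.mul_apply, Equiv.swap_apply_of_ne_of_ne]
    · rintro rfl; exact hx hy
    · rintro rfl; exact hx hz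

/-- First the blank is sent to its final position. What remains is a permutation fixing the position
of the blank, which is a product of transpositions of non-blank tokens; the induction is on the size
of its support. -/
theorem shufflable_of_swaps [Fintype V] {S : Finset V}
    (hblank : ∀ (b : V) (σ : Equiv.Perm V), σ.symm b ∈ S → ∀ v ∈ S,
      ∃ ρ, (puzzle H S b).Reachable σ ρ ∧ ρ v = b)
    (hswap : ∀ (b : V) (σ : Equiv.Perm V), σ.symm b ∈ S → ∀ x ∈ S, ∀ y ∈ S, σ x ≠ b → σ y ≠ b →
      x ≠ y → (puzzle H S b).Reachable σ (σ * Equiv.swap x y)) :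
    Shufflable H S := by
  have key : ∀ (n : ℕ) (b : V) (σ π : Equiv.Perm V), π.support.card = n → σ.symm b ∈ S →
      (∀ x ∉ S, π x = x) → π (σ.symm b) = σ.symm b →
      (puzzle H S b).Reachable σ (σ * π) := by
    intro n
    induction n using Nat.strong_induction_on with
    | _ n ih =>
      intro b σ π hn hσ hπ hfix
      by_cases h1 : π = 1
      · subst h1; simp
      obtain ⟨x, hx⟩ : ∃ x, π x ≠ x := by
        by_contra hne
        push Not at hne
        exact h1 (Equiv.ext hne)
      have hxS : x ∈ S := by by_contra h; exact hx (hπ x h)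
      have hπS : ∀ v ∈ S, π v ∈ S := by
        intro v hv
        by_contra h
        have h2 := hπ _ h
        exact h ((π.injective h2).symm ▸ hv)
      have hxb : σ x ≠ b := by
        rintro rfl; simp at hfix; exact hx hfix
      have hyb : σ (π x) ≠ b := by
        rintro rfl; simp at hfix; exact hx hfix
      have hr := hswap b σ hσ x hxS (π x) (hπS x hxS) hxb hyb hx.symm
      have hsb : (σ * Equiv.swap x (π x)).symm b = σ.symm b := by
        rw [Equiv.symm_apply_eq, Equiv.Perm.mul_apply, Equiv.swap_apply_of_ne_of_ne]
        · simp
        · rintro rfl; simp at hxb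
        · intro h; rw [← h] at hyb; simp at hyb
      have h2 := ih _ (hn ▸ Equiv.Perm.card_support_swap_mul hx) b (σ * Equiv.swap x (π x))
        (Equiv.swap x (π x) * π) rfl (by rwa [hsb]) ?_ ?_
      · refine hr.trans ?_
        convert h2 using 1
        ext v; simp
      · intro v hv
        rw [Equiv.Perm.mul_apply, hπ v hv, Equiv.swap_apply_of_ne_of_ne]
        · rintro rfl; exact hv hxS
        · rintro rfl; exact hv (hπS x hxS)
      · rw [hsb, Equiv.Perm.mul_apply, hfix, Equiv.swap_apply_of_ne_of_ne]
        · rintro rfl; simp at hxb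
        · intro h; rw [← h] at hyb; simp at hyb
  intro b σ π hσ hπ
  have hσπ : (σ * π).symm b ∈ S := by
    by_contra h
    have h1 := hπ _ h
    have h2 : σ (π ((σ * π).symm b)) = b := (σ * π).apply_symm_apply b
    rw [h1] at h2
    exact h ((Equiv.symm_apply_eq σ).2 h2.symm ▸ hσ)
  obtain ⟨ρ, hρ, hρb⟩ := hblank b σ hσ _ hσπ
  have hρs : ρ.symm b = (σ * π).symm b := by rw [Equiv.symm_apply_eq, hρb]
  have h3 := key _ b ρ (ρ⁻¹ * (σ * π)) rfl (hρs ▸ hσπ) ?_ ?_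
  · rw [mul_inv_cancel_left] at h3
    exact hρ.trans h3
  · intro x hx
    rw [Equiv.Perm.mul_apply, Equiv.Perm.inv_eq_iff_eq, puzzle_reachable_apply_eq hρ hx,
      Equiv.Perm.mul_apply, hπ x hx]
  · rw [Equiv.Perm.mul_apply, Equiv.Perm.inv_eq_iff_eq, hρs, hρb]
    exact (σ * π).apply_symm_apply b

/-- One turn of the blank around the triangle brings it back and exchanges the two other tokens. The
odd cycle is what makes odd permutations reachable. -/
theorem shufflable_triangle [Fintype V] {x y z : V} (hxy : H.Adj x y) (hyz : H.Adj y z)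
    (hzx : H.Adj z x) : Shufflable H {x, y, z} := by
  have hne1 := hxy.ne
  have hne2 := hyz.ne
  have hne3 := hzx.ne
  have hadj : ∀ u ∈ ({x, y, z} : Finset V), ∀ v ∈ ({x, y, z} : Finset V), u ≠ v → H.Adj u v := by
    simp only [Finset.mem_insert, Finset.mem_singleton]
    rintro u (rfl | rfl | rfl) v (rfl | rfl | rfl) h <;>
      first | exact absurd rfl h | assumption | (apply SimpleGraph.Adj.symm; assumption)
  refine shufflable_of_swaps ?_ ?_
  · intro b σ hσ v hv
    by_cases h : σ.symm b = v
    · exact ⟨σ, SimpleGraph.Reachable.refl _, by simp [← h]⟩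
    · exact ⟨_, puzzle_reachable_swap hσ hv (hadj _ hσ _ hv h) (Or.inl (by simp)), by simp⟩
  · intro b σ hσ u hu v hv hub hvb huv
    set w := σ.symm b with hw
    have hσw : σ w = b := by simp [hw]
    have hwu : w ≠ u := by rintro h; rw [h] at hσw; exact hub hσw
    have hwv : w ≠ v := by rintro h; rw [h] at hσw; exact hvb hσw
    have h1 := puzzle_reachable_swap (b := b) (σ := σ) hσ hu (hadj _ hσ _ hu hwu) (Or.inl hσw)
    have h2 := puzzle_reachable_swap (b := b) (σ := σ * Equiv.swap w u) hu hv (hadj _ hu _ hv huv)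
      (Or.inl (by simp [hσw]))
    have h3 := puzzle_reachable_swap (b := b) (σ := σ * Equiv.swap w u * Equiv.swap u v) hv hσ
      (hadj _ hv _ hσ hwv.symm) (Or.inl (by simp [hσw]))
    convert (h1.trans h2).trans h3 using 1
    ext t
    simp only [Equiv.Perm.mul_apply]
    congr 1
    by_cases t1 : t = u
    · subst t1
      rw [Equiv.swap_apply_left, Equiv.swap_apply_of_ne_of_ne huv hwu.symm, Equiv.swap_apply_left,
        Equiv.swap_apply_of_ne_of_ne hwv.symm huv.symm]
    by_cases t2 : t = v
    · subst t2
      rw [Equiv.swap_apply_right, Equiv.swap_apply_left, Equiv.swap_apply_of_ne_of_ne hwu hwv,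
        Equiv.swap_apply_left]
    by_cases t3 : t = w
    · subst t3
      rw [Equiv.swap_apply_of_ne_of_ne hwu hwv, Equiv.swap_apply_right, Equiv.swap_apply_right,
        Equiv.swap_apply_right]
    · rw [Equiv.swap_apply_of_ne_of_ne t2 t3, Equiv.swap_apply_of_ne_of_ne t1 t2,
        Equiv.swap_apply_of_ne_of_ne t3 t1]

/-- `P 0, …, P (m + 1)` is a path whose ends lie in `S` and are distinct and whose inner vertices,
of which there is at least one, lie outside `S`. -/
structure IsEar (H : SimpleGraph V) (S : Finset V) (m : ℕ) (P : ℕ → V) : Prop where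
  pos : 0 < m
  fst_mem : P 0 ∈ S
  lst_mem : P (m + 1) ∈ S
  ne : P 0 ≠ P (m + 1)
  notMem : ∀ i, 1 ≤ i → i ≤ m → P i ∉ S
  inj : ∀ i j, 1 ≤ i → i ≤ m → 1 ≤ j → j ≤ m → P i = P j → i = j
  adj : ∀ i ≤ m, H.Adj (P i) (P (i + 1))

theorem IsEar.injective {S : Finset V} {m : ℕ} {P : ℕ → V} (h : IsEar H S m P) {i j : ℕ}
    (hi : i ≤ m + 1) (hj : j ≤ m + 1) (hij : P i = P j) : i = j := by
  wlog hle : i ≤ j generalizing i j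
  · exact (this hj hi hij.symm (by omega)).symm
  by_contra hne
  rcases Nat.eq_zero_or_pos i with rfl | hi0
  · rcases Nat.lt_or_ge j (m + 1) with hj' | hj'
    · exact h.notMem j (by omega) (by omega) (hij ▸ h.fst_mem)
    · obtain rfl : j = m + 1 := by omega
      exact h.ne hij
  · rcases Nat.lt_or_ge j (m + 1) with hj' | hj'
    · exact hne (h.inj i j hi0 (by omega) (by omega) (by omega) hij)
    · obtain rfl : j = m + 1 := by omega
      exact h.notMem i hi0 (by omega) (hij ▸ h.lst_mem)

variable {S : Finset V} {m : ℕ} {P : ℕ → V}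

/-- The vertices of `S` and of the ear. -/
def withEar (S : Finset V) (m : ℕ) (P : ℕ → V) : Finset V :=
  S ∪ (Finset.Icc 1 m).image P

theorem IsEar.mem_withEar (h : IsEar H S m P) {i : ℕ} (hi : i ≤ m + 1) : P i ∈ withEar S m P := by
  rw [withEar, Finset.mem_union]
  by_cases h1 : 1 ≤ i ∧ i ≤ m
  · exact Or.inr (Finset.mem_image.2 ⟨i, Finset.mem_Icc.2 h1, rfl⟩)
  · rcases Nat.eq_zero_or_pos i with rfl | h0
    · exact Or.inl h.fst_mem
    · obtain rfl : i = m + 1 := by omega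
      exact Or.inl h.lst_mem

/-- Each token that the blank passes is shifted by one place towards `P 0`. -/
theorem IsEar.moveBlank (h : IsEar H S m P) {b : V} {σ : Equiv.Perm V} (hσ : σ (P 0) = b) :
    ∀ j ≤ m + 1, ∃ ρ, (puzzle H (withEar S m P) b).Reachable σ ρ ∧ ρ (P j) = b ∧
      (∀ i < j, ρ (P i) = σ (P (i + 1))) ∧ ∀ v, (∀ i ≤ j, v ≠ P i) → ρ v = σ v := by
  intro j
  induction j with
  | zero => exact fun _ => ⟨σ, SimpleGraph.Reachable.refl _, hσ, by simp, fun _ _ => rfl⟩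
  | succ j ih =>
    intro hj
    obtain ⟨ρ, h1, h2, h3, h4⟩ := ih (by omega)
    refine ⟨ρ * Equiv.swap (P j) (P (j + 1)), h1.trans (puzzle_reachable_swap
      (h.mem_withEar (by omega)) (h.mem_withEar (by omega)) (h.adj j (by omega)) (Or.inl h2)),
      by simp [h2], ?_, ?_⟩
    · intro i hi
      rcases Nat.lt_or_ge i j with hij | hij
      · rw [Equiv.Perm.mul_apply, Equiv.swap_apply_of_ne_of_ne, h3 i hij]
        · intro e; have := h.injective (by omega) (by omega) e; omega
        · intro e; have := h.injective (by omega) (by omega) e; omega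
      · obtain rfl : i = j := by omega
        rw [Equiv.Perm.mul_apply, Equiv.swap_apply_left, h4]
        intro l hl e
        have := h.injective (by omega) (by omega) e
        omega
    · intro v hv
      rw [Equiv.Perm.mul_apply, Equiv.swap_apply_of_ne_of_ne (hv j (by omega)) (hv _ le_rfl)]
      exact h4 v fun i hi => hv i (by omega)

theorem IsEar.blank_to_fst (h : IsEar H S m P) (hS : Shufflable H S) {b : V} {σ : Equiv.Perm V}
    (hσ : σ.symm b ∈ withEar S m P) :
    ∃ ρ, (puzzle H (withEar S m P) b).Reachable σ ρ ∧ ρ (P 0) = b := by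
  have back : ∀ j ≤ m + 1, ∀ σ : Equiv.Perm V, σ (P j) = b →
      ∃ ρ, (puzzle H (withEar S m P) b).Reachable σ ρ ∧ ρ (P 0) = b := by
    intro j
    induction j with
    | zero => exact fun _ σ hσ => ⟨σ, SimpleGraph.Reachable.refl _, hσ⟩
    | succ j ih =>
      intro hj σ hσ
      obtain ⟨ρ, h1, h2⟩ := ih (by omega) (σ * Equiv.swap (P j) (P (j + 1))) (by simp [hσ])
      exact ⟨ρ, (puzzle_reachable_swap (h.mem_withEar (by omega)) (h.mem_withEar (by omega))
        (h.adj j (by omega)) (Or.inr hσ)).trans h1, h2⟩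
  rw [withEar, Finset.mem_union, Finset.mem_image] at hσ
  rcases hσ with hσ | ⟨j, hj, hj'⟩
  · refine ⟨σ * Equiv.swap (P 0) (σ.symm b), puzzle_reachable_mono Finset.subset_union_left
      (hS b σ _ hσ ?_), by simp⟩
    intro x hx
    rw [Equiv.swap_apply_of_ne_of_ne]
    · rintro rfl; exact hx h.fst_mem
    · rintro rfl; exact hx hσ
  · rw [Finset.mem_Icc] at hj
    exact back j (by omega) σ (by simp [hj'])

/-- The token `p` lies in `S` (if `j = 0`) or on the `j`-th vertex of the ear. -/
def EarPos (S : Finset V) (m : ℕ) (P : ℕ → V) (σ : Equiv.Perm V) (p : V) (j : ℕ) : Prop :=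
  (j = 0 ∧ σ.symm p ∈ S) ∨ (1 ≤ j ∧ j ≤ m ∧ σ (P j) = p)

theorem IsEar.earPos_swap (h : IsEar H S m P) {σ : Equiv.Perm V} {p : V} {j : ℕ} {x y : V}
    (hx : x ∈ S) (hy : y ∈ S) (hp : EarPos S m P σ p j) :
    EarPos S m P (σ * Equiv.swap x y) p j := by
  rcases hp with ⟨h1, h2⟩ | ⟨h1, h2, h3⟩
  · refine Or.inl ⟨h1, ?_⟩
    change (Equiv.swap x y) (σ.symm p) ∈ S
    rw [Equiv.swap_apply_def]
    split_ifs <;> assumption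
  · refine Or.inr ⟨h1, h2, ?_⟩
    rw [Equiv.Perm.mul_apply, Equiv.swap_apply_of_ne_of_ne, h3]
    · rintro rfl; exact h.notMem j h1 h2 hx
    · rintro rfl; exact h.notMem j h1 h2 hy

/-- The blank runs along the whole ear and returns to `P 0` through `S`, so tokens on the ear come
one step closer to `S`. The token on `P (m + 1)` is excluded because it is pushed onto the ear. -/
theorem IsEar.rotate (h : IsEar H S m P) (hS : Shufflable H S) {b : V} {σ : Equiv.Perm V}
    (hσ : σ (P 0) = b) :
    ∃ ρ, (puzzle H (withEar S m P) b).Reachable σ ρ ∧ ρ (P 0) = b ∧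
      ∀ p j, p ≠ b → σ (P (m + 1)) ≠ p → EarPos S m P σ p j → EarPos S m P ρ p (j - 1) := by
  obtain ⟨ρ, h1, h2, h3, h4⟩ := h.moveBlank hσ (m + 1) le_rfl
  refine ⟨ρ * Equiv.swap (P 0) (P (m + 1)), h1.trans (puzzle_reachable_mono
    Finset.subset_union_left (hS b ρ _ ?_ ?_)), by simp [h2], ?_⟩
  · rw [← h2]; simpa using h.lst_mem
  · intro x hx
    rw [Equiv.swap_apply_of_ne_of_ne]
    · rintro rfl; exact hx h.fst_mem
    · rintro rfl; exact hx h.lst_mem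
  · intro p j hpb hpw hp
    refine h.earPos_swap h.fst_mem h.lst_mem ?_
    rcases hp with ⟨rfl, hp⟩ | ⟨hj1, hj2, hp⟩
    · refine Or.inl ⟨rfl, ?_⟩
      have : ρ (σ.symm p) = p := by
        rw [h4 _ ?_, Equiv.apply_symm_apply]
        intro i hi e
        rw [Equiv.symm_apply_eq] at e
        rcases Nat.eq_zero_or_pos i with rfl | hi0
        · exact hpb (e.trans hσ)
        · rcases Nat.lt_or_ge m i with him | him
          · obtain rfl : i = m + 1 := by omega
            exact hpw e.symm
          · refine h.notMem i hi0 him ?_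
            rw [e, Equiv.symm_apply_apply] at hp
            exact hp
      rwa [(Equiv.symm_apply_eq ρ).2 this.symm]
    · have h5 := h3 (j - 1) (by omega)
      rw [Nat.sub_add_cancel hj1, hp] at h5
      rcases Nat.eq_zero_or_pos (j - 1) with h0 | h0
      · refine Or.inl ⟨h0, ?_⟩
        rw [h0] at h5
        rw [← h5]; simpa using h.fst_mem
      · exact Or.inr ⟨h0, by omega, h5⟩

/-- Induction on the sum of the two ear positions, which every rotation decreases. A third vertex
`z` of `S` is needed to keep both tokens off `P (m + 1)` before rotating. -/
theorem IsEar.gather (h : IsEar H S m P) (hS : Shufflable H S) (hS3 : 3 ≤ S.card) {b p q : V}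
    (hpb : p ≠ b) (hqb : q ≠ b) :
    ∀ (N : ℕ) (σ : Equiv.Perm V) (i j : ℕ), i + j = N → σ (P 0) = b → EarPos S m P σ p i →
      EarPos S m P σ q j →
      ∃ ρ, (puzzle H (withEar S m P) b).Reachable σ ρ ∧ ρ (P 0) = b ∧ ρ.symm p ∈ S ∧
        ρ.symm q ∈ S := by
  obtain ⟨z, hz, hz0, hz1⟩ : ∃ z ∈ S, z ≠ P 0 ∧ z ≠ P (m + 1) := by
    have : 0 < ((S.erase (P 0)).erase (P (m + 1))).card := by
      have h1 := Finset.pred_card_le_card_erase (a := P 0) (s := S)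
      have h2 := Finset.pred_card_le_card_erase (a := P (m + 1)) (s := S.erase (P 0))
      omega
    obtain ⟨z, hz⟩ := Finset.card_pos.1 this
    simp only [Finset.mem_erase] at hz
    exact ⟨z, hz.2.2, hz.2.1, hz.1⟩
  intro N
  induction N using Nat.strong_induction_on with
  | _ N ih =>
    intro σ i j hN hσ hp hq
    by_cases h0 : i = 0 ∧ j = 0
    · obtain ⟨rfl, rfl⟩ := h0
      exact ⟨σ, SimpleGraph.Reachable.refl _, hσ, hp.resolve_right (by omega) |>.2,
        hq.resolve_right (by omega) |>.2⟩
    obtain ⟨τ, h1, h2, h3, h4, h5, h6⟩ : ∃ τ, (puzzle H (withEar S m P) b).Reachable σ τ ∧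
        τ (P 0) = b ∧ EarPos S m P τ p i ∧ EarPos S m P τ q j ∧ τ (P (m + 1)) ≠ p ∧
        τ (P (m + 1)) ≠ q := by
      by_cases hw : σ (P (m + 1)) ≠ p ∧ σ (P (m + 1)) ≠ q
      · exact ⟨σ, SimpleGraph.Reachable.refl _, hσ, hp, hq, hw.1, hw.2⟩
      -- One of the two tokens occupies `P (m + 1)`, and they are not both in `S`; hence neither is
      -- on `z`.
      have hzpq : (σ z ≠ p) ∧ (σ z ≠ q) := by
        have hpos : ∀ (t : V) (l : ℕ), EarPos S m P σ t l → ∀ x ∈ S, σ x = t → l = 0 := by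
          rintro t l (⟨hl, -⟩ | ⟨hl1, hl2, hl3⟩) x hx e
          · exact hl
          · rw [← e] at hl3
            exact absurd (σ.injective hl3 ▸ hx) (h.notMem l hl1 hl2)
        have hi := hpos p i hp
        have hj := hpos q j hq
        have hinj : σ (P (m + 1)) ≠ σ z := fun e => hz1 (σ.injective e).symm
        constructor
        · intro e
          have hi0 := hi z hz e
          by_cases hw' : σ (P (m + 1)) = q
          · exact h0 ⟨hi0, hj _ h.lst_mem hw'⟩
          · exact hw ⟨by rw [← e]; exact hinj, hw'⟩
        · intro e
          have hi0 := hj z hz e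
          by_cases hw' : σ (P (m + 1)) = p
          · exact h0 ⟨hi _ h.lst_mem hw', hi0⟩
          · exact hw ⟨hw', by rw [← e]; exact hinj⟩
      refine ⟨σ * Equiv.swap (P (m + 1)) z, puzzle_reachable_mono Finset.subset_union_left
        (hS b σ _ ?_ ?_), ?_, h.earPos_swap h.lst_mem hz hp, h.earPos_swap h.lst_mem hz hq,
        by simpa using hzpq.1, by simpa using hzpq.2⟩
      · rw [← hσ]; simpa using h.fst_mem
      · intro x hx
        rw [Equiv.swap_apply_of_ne_of_ne]
        · rintro rfl; exact hx h.lst_mem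
        · rintro rfl; exact hx hz
      · rw [Equiv.Perm.mul_apply, Equiv.swap_apply_of_ne_of_ne h.ne hz0.symm, hσ]
    obtain ⟨ρ, g1, g2, g3⟩ := h.rotate hS h2
    obtain ⟨ρ', k1, k2⟩ := ih (i - 1 + (j - 1)) (by omega) ρ (i - 1) (j - 1) rfl g2
      (g3 p i hpb h5 h3) (g3 q j hqb h6 h4)
    exact ⟨ρ', (h1.trans g1).trans k1, k2⟩

/-- A conjugation argument: to exchange two tokens, gather both in `S`, exchange them there, and
undo the gathering. -/
theorem IsEar.shufflable [Fintype V] (h : IsEar H S m P) (hS : Shufflable H S) (hS3 : 3 ≤ S.card) :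
    Shufflable H (withEar S m P) := by
  refine shufflable_of_swaps ?_ ?_
  · intro b σ hσ v hv
    obtain ⟨ρ, h1, h2⟩ := h.blank_to_fst hS hσ
    rw [withEar, Finset.mem_union, Finset.mem_image] at hv
    rcases hv with hv | ⟨j, hj, rfl⟩
    · refine ⟨ρ * Equiv.swap (P 0) v, h1.trans (puzzle_reachable_mono
        Finset.subset_union_left (hS b ρ _ ?_ ?_)), by simp [h2]⟩
      · rw [← h2]; simpa using h.fst_mem
      · intro x hx
        rw [Equiv.swap_apply_of_ne_of_ne]
        · rintro rfl; exact hx h.fst_mem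
        · rintro rfl; exact hx hv
    · rw [Finset.mem_Icc] at hj
      obtain ⟨τ, g1, g2, -⟩ := h.moveBlank h2 j (by omega)
      exact ⟨τ, h1.trans g1, g2⟩
  · intro b σ hσ x hx y hy hxb hyb hxy
    obtain ⟨ρ, h1, h2⟩ := h.blank_to_fst hS hσ
    have hpos : ∀ v ∈ withEar S m P, ∃ j, EarPos S m P ρ (σ v) j := by
      intro v hv
      have hmem : ρ.symm (σ v) ∈ withEar S m P := by
        by_contra hne
        have := puzzle_reachable_apply_eq h1 hne
        rw [Equiv.apply_symm_apply] at this
        exact hne (σ.injective this ▸ hv)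
      rw [withEar, Finset.mem_union, Finset.mem_image] at hmem
      rcases hmem with hmem | ⟨j, hj, hj'⟩
      · exact ⟨0, Or.inl ⟨rfl, hmem⟩⟩
      · rw [Finset.mem_Icc] at hj
        exact ⟨j, Or.inr ⟨hj.1, hj.2, by simp [hj']⟩⟩
    obtain ⟨i, hi⟩ := hpos x hx
    obtain ⟨j, hj⟩ := hpos y hy
    obtain ⟨τ, g1, g2, g3, g4⟩ := h.gather hS hS3 hxb hyb _ ρ i j rfl h2 hi hj
    have hr := h1.trans g1
    -- Renaming non-blank tokens is an automorphism of the puzzle, so the gathering moves remain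
    -- legal, and can be undone, after the exchange.
    have hr' := puzzle_reachable_mul_left (Equiv.swap (σ x) (σ y))
      (Equiv.swap_apply_of_ne_of_ne hxb.symm hyb.symm) hr
    have hmid : (puzzle H (withEar S m P) b).Reachable τ
        (τ * Equiv.swap (τ.symm (σ x)) (τ.symm (σ y))) := by
      refine puzzle_reachable_mono Finset.subset_union_left (hS b τ _ ?_ ?_)
      · rw [← g2]; simpa using h.fst_mem
      · intro v hv
        rw [Equiv.swap_apply_of_ne_of_ne]
        · rintro rfl; exact hv g3
        · rintro rfl; exact hv g4
    have e1 : τ * Equiv.swap (τ.symm (σ x)) (τ.symm (σ y)) = Equiv.swap (σ x) (σ y) * τ := by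
      have := Equiv.mul_swap_eq_swap_mul τ (τ.symm (σ x)) (τ.symm (σ y))
      simpa using this
    have e2 : σ * Equiv.swap x y = Equiv.swap (σ x) (σ y) * σ := Equiv.mul_swap_eq_swap_mul σ x y
    rw [e2]
    rw [e1] at hmid
    exact (hr.trans hmid).trans hr'.symm

/-- Connectedness gives an edge `u v` leaving `S`. Since `u` is not a cutvertex, some path in `D -
u` leads from `v` back to `S`; it is cut off at its first vertex in `S`. -/
theorem exists_ear {D : H.Subgraph} (hD : ConnectedNoCutvertex D) {S : Finset V}
    (hSD : ∀ v ∈ S, v ∈ D.verts) (hS : 2 ≤ S.card) (hne : ∃ v ∈ D.verts, v ∉ S) :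
    ∃ m P, IsEar H S m P ∧ ∀ i ≤ m, P i ∈ D.verts := by
  obtain ⟨v₀, hv₀, hv₀S⟩ := hne
  obtain ⟨u₀, hu₀⟩ := Finset.card_pos.1 (by omega : 0 < S.card)
  obtain ⟨u, v, huS, hvS, huv⟩ : ∃ u v, u ∈ S ∧ v ∉ S ∧ D.Adj u v := by
    obtain ⟨p⟩ := hD.1.coe.preconnected ⟨u₀, hSD _ hu₀⟩ ⟨v₀, hv₀⟩
    obtain ⟨d, -, h1, h2⟩ := p.exists_boundary_dart {x | x.1 ∈ S} hu₀ hv₀S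
    exact ⟨d.fst, d.snd, h1, h2, d.adj⟩
  obtain ⟨w₀, hw₀, hwu⟩ := Finset.exists_mem_ne (by omega : 1 < S.card) u
  have hv' : v ∈ (D.deleteVerts {u}).verts := by
    simp [huv.snd_mem, huv.ne.symm]
  have hw' : w₀ ∈ (D.deleteVerts {u}).verts := by
    simp [hSD _ hw₀, hwu]
  obtain ⟨p, hp⟩ := ((hD.2 u (hSD u huS)).coe ⟨v, hv'⟩ ⟨w₀, hw'⟩).exists_isPath
  have hex : ∃ i, (p.getVert i).1 ∈ S := ⟨p.length, by simpa using hw₀⟩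
  set n := Nat.find hex with hn
  have hnS : (p.getVert n).1 ∈ S := Nat.find_spec hex
  have hnmin : ∀ i < n, (p.getVert i).1 ∉ S := fun i hi => Nat.find_min hex hi
  have hnlen : n ≤ p.length := Nat.find_min' hex (by simpa using hw₀)
  have hn0 : 0 < n := by
    rcases Nat.eq_zero_or_pos n with h | h
    · rw [h] at hnS; simp at hnS; exact absurd hnS hvS
    · exact h
  have hmemD : ∀ i, (p.getVert i).1 ∈ D.verts ∧ (p.getVert i).1 ≠ u := by
    intro i
    have := (p.getVert i).2
    simpa using this
  refine ⟨n, fun i => Nat.casesOn i u fun i => (p.getVert i).1,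
    ⟨hn0, huS, hnS, (hmemD n).2.symm, ?_, ?_, ?_⟩, ?_⟩
  · rintro (_ | i) hi1 hi2
    · omega
    · exact hnmin i (by omega)
  · rintro (_ | i) (_ | j) hi1 hi2 hj1 hj2 e
    · omega
    · omega
    · omega
    · have := hp.getVert_injOn (by simp; omega) (by simp; omega) (Subtype.ext e)
      omega
  · rintro (_ | i) hi
    · simpa using huv.adj_sub
    · have := p.adj_getVert_succ (i := i) (by omega)
      exact (SimpleGraph.Subgraph.coe_adj _ _ _ ▸ this).adj_sub
  · rintro (_ | i) hi
    · exact hSD u huS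
    · exact (hmemD i).1

/-- Starting from the triangle, take a largest shufflable set inside `D` with at least three
vertices. If it were not all of `D`, an ear would enlarge it. -/
theorem shufflable_of_connectedNoCutvertex [Fintype V] {D : H.Subgraph}
    (hD : ConnectedNoCutvertex D) (hT : ContainsTriangle D) {S : Finset V}
    (hS : ∀ v, v ∈ S ↔ v ∈ D.verts) : Shufflable H S ∧ 3 ≤ S.card := by
  classical
  obtain ⟨x, y, z, hxy, hyz, hzx⟩ := hT
  let F : Finset (Finset V) := Finset.univ.filter fun T => T ⊆ S ∧ Shufflable H T ∧ 3 ≤ T.card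
  have hF : F.Nonempty := by
    refine ⟨{x, y, z}, ?_⟩
    simp only [F, Finset.mem_filter, Finset.mem_univ, true_and]
    refine ⟨?_, shufflable_triangle hxy.adj_sub hyz.adj_sub hzx.adj_sub, ?_⟩
    · intro v hv
      simp only [Finset.mem_insert, Finset.mem_singleton] at hv
      rw [hS]
      rcases hv with rfl | rfl | rfl
      · exact hxy.fst_mem
      · exact hyz.fst_mem
      · exact hzx.fst_mem
    · rw [Finset.card_eq_three.2 ⟨x, y, z, hxy.ne, hzx.ne.symm, hyz.ne, rfl⟩]
  obtain ⟨T, hT, hmax⟩ := F.exists_max_image Finset.card hF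
  simp only [F, Finset.mem_filter, Finset.mem_univ, true_and] at hT hmax
  obtain ⟨hTS, hTs, hT3⟩ := hT
  by_cases hne : ∃ v ∈ D.verts, v ∉ T
  · obtain ⟨m, P, hear, hPD⟩ := exists_ear hD (fun v hv => (hS v).1 (hTS hv)) (by omega) hne
    have hlt : T.card < (withEar T m P).card := by
      refine Finset.card_lt_card ((Finset.ssubset_iff_of_subset Finset.subset_union_left).2
        ⟨P 1, hear.mem_withEar (by omega), hear.notMem 1 le_rfl hear.pos⟩)
    have := hmax (withEar T m P) ⟨?_, hear.shufflable hTs hT3, by omega⟩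
    · omega
    · refine Finset.union_subset hTS ?_
      intro v hv
      obtain ⟨i, hi, rfl⟩ := Finset.mem_image.1 hv
      rw [Finset.mem_Icc] at hi
      exact (hS _).2 (hPD i hi.2)
  · push Not at hne
    have : T = S := Finset.Subset.antisymm hTS fun v hv => hne v ((hS v).1 hv)
    exact this ▸ ⟨hTs, hT3⟩

end Puzzle

/-! ### Unlabelled tokens: reaching a prescribed vertex set. -/

section Transit

variable {V : Type*} [DecidableEq V] [Fintype V] {ι : Type*} {H : SimpleGraph V}

/-- The set of occupied vertices. -/
def supp (α : V → Option ι) : Finset V := Finset.univ.filter fun v => (α v).isSome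

@[simp] theorem mem_supp {α : V → Option ι} {v : V} : v ∈ supp α ↔ α v ≠ none := by
  simp [supp, Option.isSome_iff_ne_none]

/-- Any two vertices of `W` are joined by a walk in `W` with all inner vertices in `G`. -/
def LinkedVia (H : SimpleGraph V) (G W : Finset V) : Prop :=
  ∀ v ∈ W, ∀ w ∈ W, ∃ p : H.Walk v w, ∀ u ∈ p.support, u ∈ W ∧ (u ≠ v → u ≠ w → u ∈ G)

/-- A vertex outside `G` is never an inner vertex of the given walks and can be dropped. If there is
none, `W` induces a connected graph, which has a vertex whose removal keeps it connected. -/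
theorem LinkedVia.exists_erase {G W : Finset V} (h : LinkedVia H G W) (hW : W.Nonempty) :
    ∃ l ∈ W, LinkedVia H G (W.erase l) := by
  by_cases hG : ∃ l ∈ W, l ∉ G
  · obtain ⟨l, hl, hlG⟩ := hG
    refine ⟨l, hl, fun v hv w hw => ?_⟩
    obtain ⟨p, hp⟩ := h v (Finset.mem_of_mem_erase hv) w (Finset.mem_of_mem_erase hw)
    refine ⟨p, fun u hu => ⟨Finset.mem_erase.2 ⟨?_, (hp u hu).1⟩, (hp u hu).2⟩⟩
    rintro rfl
    exact hlG ((hp u hu).2 (Finset.ne_of_mem_erase hv).symm (Finset.ne_of_mem_erase hw).symm)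
  · push Not at hG
    have hconn : (H.induce (W : Set V)).Connected := by
      rw [SimpleGraph.connected_iff]
      refine ⟨fun v w => ?_, ⟨⟨hW.choose, hW.choose_spec⟩⟩⟩
      obtain ⟨p, hp⟩ := h v.1 v.2 w.1 w.2
      exact ⟨p.induce _ fun u hu => (hp u hu).1⟩
    obtain ⟨l, hl⟩ := hconn.exists_preconnected_induce_compl_singleton_of_finite
    refine ⟨l.1, l.2, fun v hv w hw => ?_⟩
    rw [Finset.mem_erase] at hv hw
    obtain ⟨p⟩ := hl ⟨⟨v, hv.2⟩, by simpa [Subtype.ext_iff] using hv.1⟩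
      ⟨⟨w, hw.2⟩, by simpa [Subtype.ext_iff] using hw.1⟩
    let f := (SimpleGraph.Embedding.induce (G := H) (W : Set V)).toHom.comp
      (SimpleGraph.Embedding.induce (G := H.induce (W : Set V)) {l}ᶜ).toHom
    refine ⟨p.map f, fun u hu => ?_⟩
    have hu' : u ∈ p.support.map f := by rw [← SimpleGraph.Walk.support_map]; exact hu
    obtain ⟨x, -, rfl⟩ := List.mem_map.1 hu'
    have h1 : f x ∈ W := x.1.2
    have h2 : f x ≠ l.1 := fun e => x.2 (Subtype.ext e)
    exact ⟨Finset.mem_erase.2 ⟨h2, h1⟩, fun _ _ => hG _ h1⟩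

/-- A vertex with property `Q` that is nearest to `l`. -/
theorem LinkedVia.exists_nearest {G W : Finset V} (h : LinkedVia H G W) (Q : V → Prop) {l : V}
    (hl : l ∈ W) (hQ : ∃ x ∈ W, Q x) :
    ∃ x ∈ W, Q x ∧ ∃ p : H.Walk l x, p.IsPath ∧
      ∀ v ∈ p.support, v ≠ l → v ≠ x → v ∈ W ∧ v ∈ G ∧ ¬ Q v := by
  have key : ∀ (n : ℕ) (x : V) (p : H.Walk l x), p.length = n → p.IsPath → x ∈ W → Q x →
      (∀ u ∈ p.support, u ∈ W ∧ (u ≠ l → u ≠ x → u ∈ G)) →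
      ∃ x ∈ W, Q x ∧ ∃ p : H.Walk l x, p.IsPath ∧
        ∀ v ∈ p.support, v ≠ l → v ≠ x → v ∈ W ∧ v ∈ G ∧ ¬ Q v := by
    intro n
    induction n using Nat.strong_induction_on with
    | _ n ih =>
      intro x p hn hp hx hQx hin
      by_cases hall : ∀ v ∈ p.support, v ≠ l → v ≠ x → ¬ Q v
      · exact ⟨x, hx, hQx, p, hp, fun v hv h1 h2 =>
          ⟨(hin v hv).1, (hin v hv).2 h1 h2, hall v hv h1 h2⟩⟩
      · push Not at hall
        obtain ⟨v, hv, h1, h2, h3⟩ := hall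
        refine ih _ (hn ▸ SimpleGraph.Walk.length_takeUntil_lt_length hv h2) v (p.takeUntil v hv)
          rfl (hp.takeUntil hv) (hin v hv).1 h3 ?_
        intro u hu
        have hu' := SimpleGraph.Walk.support_takeUntil_subset_support p hv hu
        refine ⟨(hin u hu').1, fun h4 _ => (hin u hu').2 h4 ?_⟩
        rintro rfl
        exact SimpleGraph.Walk.endpoint_notMem_support_takeUntil hp hv h2.symm hu
  obtain ⟨x, hx, hQx⟩ := hQ
  obtain ⟨p, hp⟩ := h l hl x hx
  exact key _ x p.bypass rfl p.bypass_isPath hx hQx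
    fun u hu => hp u (p.support_bypass_subset_support hu)

/-- Tokens can be moved from `α` to `α'` in at most `m` steps, so that vertices outside `G` which
have been left are not needed for this again. -/
def Transits (H : SimpleGraph V) (G : Finset V) (α α' : V → Option ι) (m : ℕ) : Prop :=
  ∀ (U : Finset V) (β : V → Option ι) (m' : ℕ),
    (∀ v, v ∉ G → α v ≠ none → α' v = none → v ∉ U) → Realizable H G U α' β m' →
      Realizable H G (U ∪ supp α ∪ G) α β (m' + m)

theorem Transits.refl {G : Finset V} (α : V → Option ι) : Transits H G α α 0 :=
  fun _ _ _ _ h => h.mono subset_rfl (by grind) le_rfl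

theorem Transits.mono {G : Finset V} {α α' : V → Option ι} {m m' : ℕ} (h : Transits H G α α' m)
    (hm : m ≤ m') : Transits H G α α' m' :=
  fun U β l hU hr => (h U β l hU hr).mono subset_rfl subset_rfl (by omega)

theorem Transits.slide {G : Finset V} {α : V → Option ι} {x y : V} (hx : α x ≠ none)
    (hy : α y = none) (hp : FreePath H G α x y) :
    Transits H G α (α ∘ Equiv.swap x y) 1 := by
  intro U β m' hU hr
  refine (hr.slide hx hy hp fun hxG => hU x hxG hx (by simpa using hy)).mono subset_rfl ?_ le_rfl
  intro v hv
  rcases Finset.mem_insert.1 hv with rfl | hv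
  · simp [hx]
  · simp [hv]

/-- The two extra conditions keep the occupation times consecutive outside `G`: no vertex is
occupied at the intermediate stage only, and none is vacated and then filled again. -/
theorem Transits.trans {G : Finset V} {α α' α'' : V → Option ι} {m m' : ℕ}
    (h : Transits H G α α' m) (h' : Transits H G α' α'' m')
    (h1 : ∀ v, v ∉ G → α' v ≠ none → α v ≠ none ∨ α'' v ≠ none)
    (h2 : ∀ v, v ∉ G → α v ≠ none → α' v = none → α'' v = none) :
    Transits H G α α'' (m + m') := by
  intro U β l hU hr
  have hr' := h' U β l ?_ hr
  · refine (h _ β _ ?_ hr').mono subset_rfl ?_ (by omega)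
    · intro v hv g1 g2
      simp only [Finset.mem_union, mem_supp, not_or]
      exact ⟨⟨hU v hv g1 (h2 v hv g1 g2), by simpa using g2⟩, hv⟩
    · intro v hv
      simp only [Finset.mem_union, mem_supp] at hv ⊢
      by_cases hvG : v ∈ G
      · exact Or.inr hvG
      rcases hv with (((hv | hv) | hv) | hv) | hv
      · exact Or.inl (Or.inl hv)
      · rcases h1 v hvG hv with h3 | h3
        · exact Or.inl (Or.inr h3)
        · exact Or.inl (Or.inl (hr.mem_left h3))
      · exact absurd hv hvG
      · exact Or.inl (Or.inr hv)
      · exact absurd hv hvG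
  · intro v hv g1 g2
    rcases h1 v hv g1 with h3 | h3
    · exact hU v hv h3 g2
    · exact absurd g2 h3

/-- Unlabelled token movement: in a suitably connected set `W`, the tokens can be brought
to any set `T` of the right size, with one move per token. -/
theorem exists_transit {G : Finset V} : ∀ (n : ℕ) (W : Finset V), W.card = n → LinkedVia H G W →
    ∀ (α : V → Option ι) (T : Finset V), T ⊆ W → T.card = (supp α ∩ W).card →
      (∀ v ∈ W, v ∈ T → α v ≠ none → v ∈ G) →
      ∃ π : Equiv.Perm V, (∀ v ∉ W, π v = v) ∧ (∀ v ∈ W, α (π v) ≠ none ↔ v ∈ T) ∧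
        Transits H G α (α ∘ π) T.card := by
  intro n
  induction n with
  | zero =>
    intro W hW _ α T hT hcard _
    rw [Finset.card_eq_zero] at hW
    subst hW
    obtain rfl : T = ∅ := Finset.subset_empty.1 hT
    exact ⟨1, by simp, by simp, Transits.refl α⟩
  | succ n ih =>
    intro W hW hlink α T hT hcard hTG
    obtain ⟨l, hl, hlink'⟩ := hlink.exists_erase (Finset.card_pos.1 (by omega))
    have hW' : (W.erase l).card = n := by rw [Finset.card_erase_of_mem hl]; omega
    have hTe : ∀ t, T.erase t ⊆ W.erase t := fun t => Finset.erase_subset_erase _ hT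
    -- The state of `l` is already correct, so `l` can be ignored.
    by_cases hiff : α l ≠ none ↔ l ∈ T
    · have hI := ih _ hW' hlink' α (T.erase l) (hTe l) ?_ ?_
      · obtain ⟨π, h1, h2, h3⟩ := hI
        have hπl : π l = l := h1 l (Finset.notMem_erase l W)
        refine ⟨π, fun v hv => h1 v (fun h => hv (Finset.mem_of_mem_erase h)), fun v hv => ?_,
          h3.mono (Finset.card_le_card (Finset.erase_subset _ _))⟩
        by_cases hvl : v = l
        · subst hvl; rwa [hπl]
        · rw [h2 v (Finset.mem_erase.2 ⟨hvl, hv⟩)]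
          simp [hvl]
      · have e : supp α ∩ W.erase l = (supp α ∩ W).erase l := by ext; simp; tauto
        rw [e, Finset.card_erase_eq_ite, Finset.card_erase_eq_ite, hcard]
        have : l ∈ supp α ∩ W ↔ l ∈ T := by simp [hl, hiff]
        simp [this]
      · exact fun v hv ht h => hTG v (Finset.mem_of_mem_erase hv) (Finset.mem_of_mem_erase ht) h
    by_cases hlT : l ∈ T
    -- The empty target `l` is filled first, by the nearest token; the path from it is free by
    -- minimality. After this `l` is not needed again.
    · have hαl : α l = none := by
        by_contra h; exact hiff ⟨fun _ => hlT, fun _ => h⟩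
      have hpos : 0 < (supp α ∩ W).card := hcard ▸ Finset.card_pos.2 ⟨l, hlT⟩
      obtain ⟨x₀, hx₀⟩ := Finset.card_pos.1 hpos
      simp only [Finset.mem_inter, mem_supp] at hx₀
      obtain ⟨x, hxW, hx, p, hp, hin⟩ := hlink.exists_nearest (fun v => α v ≠ none) hl
        ⟨x₀, hx₀.2, hx₀.1⟩
      have hxl : x ≠ l := by rintro rfl; exact hx hαl
      have hfree : FreePath H G α x l := FreePath.symm
        ⟨p, hp, fun v hv g1 g2 => ⟨(hin v hv g1 g2).2.1, by simpa using (hin v hv g1 g2).2.2⟩⟩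
      have hs := Transits.slide hx hαl hfree
      have hval : ∀ v, v ≠ x → v ≠ l → (α ∘ Equiv.swap x l) v = α v := fun v g1 g2 => by
        simp [Equiv.swap_apply_of_ne_of_ne g1 g2]
      have hvx : (α ∘ Equiv.swap x l) x = none := by simpa using hαl
      have hvl : (α ∘ Equiv.swap x l) l ≠ none := by simpa using hx
      have hI := ih _ hW' hlink' (α ∘ Equiv.swap x l) (T.erase l) (hTe l) ?_ ?_
      · obtain ⟨π, h1, h2, h3⟩ := hI
        have hπl : π l = l := h1 l (Finset.notMem_erase l W)
        have hfin : ∀ v ∈ W, α ((Equiv.swap x l * π) v) ≠ none ↔ v ∈ T := by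
          intro v hv
          by_cases hvl' : v = l
          · subst hvl'; simpa [hπl, hlT] using hx
          · have := h2 v (Finset.mem_erase.2 ⟨hvl', hv⟩)
            rw [Function.comp_apply] at this
            rw [Equiv.Perm.mul_apply, this]
            simp [hvl']
        refine ⟨Equiv.swap x l * π, ?_, hfin, ?_⟩
        · intro v hv
          rw [Equiv.Perm.mul_apply, h1 v (fun h => hv (Finset.mem_of_mem_erase h)),
            Equiv.swap_apply_of_ne_of_ne]
          · rintro rfl; exact hv hxW
          · rintro rfl; exact hv hl
        · refine (hs.trans h3 ?_ ?_).mono ?_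
          · intro v hv g
            by_cases hvl' : v = l
            · subst hvl'
              exact Or.inr ((hfin v hl).2 hlT)
            · by_cases hvx' : v = x
              · subst hvx'; exact Or.inl hx
              · rw [hval v hvx' hvl'] at g; exact Or.inl g
          · intro v hv g1 g2
            by_cases hvl' : v = l
            · subst hvl'; exact absurd hαl g1
            · by_cases hvx' : v = x
              · subst hvx'
                by_contra g3
                exact hv (hTG v hxW ((hfin v hxW).1 g3) hx)
              · rw [hval v hvx' hvl'] at g2; exact absurd g2 g1
          · rw [Finset.card_erase_of_mem hlT]
            have := Finset.card_pos.2 ⟨l, hlT⟩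
            omega
      · have e : supp (α ∘ Equiv.swap x l) ∩ W.erase l = (supp α ∩ W).erase x := by
          ext v
          simp only [Finset.mem_inter, mem_supp, Finset.mem_erase]
          by_cases hvl' : v = l
          · subst hvl'; simp [hαl]
          · by_cases hvx' : v = x
            · subst hvx'; simp [hαl]
            · rw [hval v hvx' hvl']; simp [hvl', hvx']
        rw [e, Finset.card_erase_of_mem hlT, Finset.card_erase_of_mem (by simp [hx, hxW]), hcard]
      · intro v hv ht g
        rw [Finset.mem_erase] at hv ht
        by_cases hvx' : v = x
        · subst hvx'; exact absurd hvx g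
        · rw [hval v hvx' hv.1] at g
          exact hTG v hv.2 ht.2 g
    -- Here the order is reversed: the tokens off `l` are first brought to all targets except `t`,
    -- the target nearest to `l`. The path from `l` to `t` has no target among its inner vertices,
    -- so it is then free.
    · have hαl : α l ≠ none := by
        intro h; exact hiff ⟨fun h' => absurd h h', fun h' => absurd h' hlT⟩
      have hpos : 0 < T.card := hcard ▸ Finset.card_pos.2 ⟨l, by simp [hl, hαl]⟩
      obtain ⟨t₀, ht₀⟩ := Finset.card_pos.1 hpos
      obtain ⟨t, htW, ht, p, hp, hin⟩ := hlink.exists_nearest (fun v => v ∈ T) hl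
        ⟨t₀, hT ht₀, ht₀⟩
      have htl : t ≠ l := by rintro rfl; exact hlT ht
      have hI := ih _ hW' hlink' α (T.erase t) ?_ ?_ ?_
      · obtain ⟨π, h1, h2, h3⟩ := hI
        have hπl : π l = l := h1 l (Finset.notMem_erase l W)
        have hαt : (α ∘ π) t = none := by
          have := h2 t (Finset.mem_erase.2 ⟨htl, htW⟩)
          simpa using this
        have hfree : FreePath H G (α ∘ π) l t := by
          refine ⟨p, hp, fun v hv g1 g2 => ⟨(hin v hv g1 g2).2.1, ?_⟩⟩
          have := h2 v (Finset.mem_erase.2 ⟨g1, (hin v hv g1 g2).1⟩)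
          by_contra g3
          exact (hin v hv g1 g2).2.2 (Finset.mem_of_mem_erase (this.1 g3))
        have hs := Transits.slide (α := α ∘ π) (x := l) (by simpa [hπl] using hαl) hαt hfree
        have hval : ∀ v, v ≠ t → v ≠ l → ((α ∘ π) ∘ Equiv.swap l t) v = α (π v) :=
          fun v g1 g2 => by simp [Equiv.swap_apply_of_ne_of_ne g2 g1]
        have hvt : ((α ∘ π) ∘ Equiv.swap l t) t ≠ none := by simpa [hπl] using hαl
        have hvl : ((α ∘ π) ∘ Equiv.swap l t) l = none := by simpa using hαt
        have hfin : ∀ v ∈ W, ((α ∘ π) ∘ Equiv.swap l t) v ≠ none ↔ v ∈ T := by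
          intro v hv
          by_cases hvl' : v = l
          · subst hvl'; exact iff_of_false (by rw [hvl]; simp) hlT
          · by_cases hvt' : v = t
            · subst hvt'; exact iff_of_true hvt ht
            · rw [hval v hvt' hvl', h2 v (Finset.mem_erase.2 ⟨hvl', hv⟩)]
              simp [hvt']
        refine ⟨π * Equiv.swap l t, ?_, hfin, ?_⟩
        · intro v hv
          rw [Equiv.Perm.mul_apply, Equiv.swap_apply_of_ne_of_ne,
            h1 v (fun h => hv (Finset.mem_of_mem_erase h))]
          · rintro rfl; exact hv hl
          · rintro rfl; exact hv htW
        · refine (h3.trans hs ?_ ?_).mono ?_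
          · intro v hv g
            by_cases hvl' : v = l
            · subst hvl'; exact Or.inl hαl
            · by_cases hvt' : v = t
              · subst hvt'; exact absurd hαt g
              · rw [hval v hvt' hvl']; exact Or.inr g
          · intro v hv g1 g2
            by_cases hvl' : v = l
            · subst hvl'; exact hvl
            · by_cases hvt' : v = t
              · subst hvt'; exact absurd (hTG v htW ht g1) hv
              · rw [hval v hvt' hvl']; exact g2
          · rw [Finset.card_erase_of_mem ht]
            omega
      · intro v hv
        rw [Finset.mem_erase] at hv ⊢
        exact ⟨by rintro rfl; exact hlT hv.2, hT hv.2⟩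
      · have e : supp α ∩ W.erase l = (supp α ∩ W).erase l := by ext; simp; tauto
        rw [e, Finset.card_erase_of_mem ht, Finset.card_erase_of_mem (by simp [hl, hαl]), hcard]
      · exact fun v hv ht' h =>
          hTG v (Finset.mem_of_mem_erase hv) (Finset.mem_of_mem_erase ht') h

end Transit

/-! ### Labels in pairs, and the operations that use shuffling on `D`. -/

section Operations

variable {V : Type*} [DecidableEq V] [Fintype V] {ι : Type*} {H : SimpleGraph V}

/-- Every label that occurs does so exactly twice. -/
def LabelsTwice {W : Type*} (γ : W → Option ι) : Prop :=
  ∀ p, γ p ≠ none → ∃ q, q ≠ p ∧ γ q = γ p ∧ ∀ r, γ r = γ p → r = p ∨ r = q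

theorem LabelsTwice.comp_equiv {W W' : Type*} {γ : W → Option ι} (h : LabelsTwice γ)
    (e : W' ≃ W) : LabelsTwice (γ ∘ e) := by
  intro p hp
  obtain ⟨q, h1, h2, h3⟩ := h (e p) hp
  refine ⟨e.symm q, ?_, by simpa using h2, fun r hr => ?_⟩
  · rintro rfl; simp at h1
  · rcases h3 (e r) hr with h4 | h4
    · exact Or.inl (e.injective h4)
    · exact Or.inr (by rw [← h4]; simp)

theorem LabelsTwice.erase {W : Type*} {γ γ' : W → Option ι} (h : LabelsTwice γ) {p q : W}
    (hpq : p ≠ q) (hp : γ p ≠ none) (he : γ p = γ q) (hγ'p : γ' p = none) (hγ'q : γ' q = none)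
    (hγ' : ∀ r, r ≠ p → r ≠ q → γ' r = γ r) : LabelsTwice γ' := by
  have hval : ∀ r, γ' r ≠ none → r ≠ p ∧ r ≠ q ∧ γ' r = γ r := by
    intro r hr
    have h1 : r ≠ p := by rintro rfl; exact hr hγ'p
    have h2 : r ≠ q := by rintro rfl; exact hr hγ'q
    exact ⟨h1, h2, hγ' r h1 h2⟩
  have huniq : ∀ r, γ r = γ p → r = p ∨ r = q := by
    obtain ⟨s, h1, h2, h3⟩ := h p hp
    rcases h3 q he.symm with h4 | h4
    · exact absurd h4.symm hpq
    · rw [h4]; exact h3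
  intro r hr
  obtain ⟨h1, h2, h3⟩ := hval r hr
  rw [h3] at hr
  obtain ⟨s, h4, h5, h6⟩ := h r hr
  have hsp : s ≠ p := by
    rintro rfl
    rcases huniq r h5.symm with h | h
    · exact h1 h
    · exact h2 h
  have hsq : s ≠ q := by
    rintro rfl
    rcases huniq r (h5.symm.trans he.symm) with h | h
    · exact h1 h
    · exact h2 h
  refine ⟨s, h4, by rw [h3, hγ' s hsp hsq, h5], fun t ht => ?_⟩
  rw [h3] at ht
  obtain ⟨-, -, h7⟩ := hval t (by rwa [ht])
  rw [h7] at ht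
  exact h6 t ht

/-- Every label is used exactly twice in both configurations together. -/
def Paired (α β : V → Option ι) : Prop := LabelsTwice (Sum.elim α β)

theorem Paired.symm {α β : V → Option ι} (h : Paired α β) : Paired β α := by
  have := h.comp_equiv (Equiv.sumComm V V)
  change LabelsTwice (Sum.elim β α)
  convert this using 1
  funext p
  rcases p with p | p <;> rfl

theorem Paired.comp {α β : V → Option ι} (h : Paired α β) (π : Equiv.Perm V) :
    Paired (α ∘ π) β := by
  have := h.comp_equiv (Equiv.sumCongr π (Equiv.refl V))
  change LabelsTwice (Sum.elim (α ∘ π) β)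
  convert this using 1
  funext p
  rcases p with p | p <;> rfl

theorem Paired.erase₂ {α β : V → Option ι} (h : Paired α β) {x y : V} (hxy : x ≠ y)
    (hx : α x ≠ none) (he : α x = α y) : Paired (erase₂ α x y) β := by
  refine LabelsTwice.erase h (p := Sum.inl x) (q := Sum.inl y) (by simpa using hxy) hx he
    (by simp [TokenGame.erase₂]) (by simp [TokenGame.erase₂]) ?_
  rintro (r | r) h1 h2
  · have h1' : r ≠ x := fun e => h1 (by rw [e])
    have h2' : r ≠ y := fun e => h2 (by rw [e])
    simp [TokenGame.erase₂, h1', h2']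
  · rfl

theorem Paired.update {α β : V → Option ι} (h : Paired α β) {x y : V}
    (hx : α x ≠ none) (he : α x = β y) :
    Paired (Function.update α x none) (Function.update β y none) := by
  refine LabelsTwice.erase h (p := Sum.inl x) (q := Sum.inr y) (by simp) hx he
    (by simp) (by simp) ?_
  rintro (r | r) h1 h2
  · have h1' : r ≠ x := fun e => h1 (by rw [e])
    simp [h1']
  · have h2' : r ≠ y := fun e => h2 (by rw [e])
    simp [h2']

theorem card_supp_comp (α : V → Option ι) (π : Equiv.Perm V) :
    (supp (α ∘ π)).card = (supp α).card := by
  refine Finset.card_bij (fun v _ => π v) (by simp) (fun v _ w _ h => π.injective h) ?_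
  intro v hv
  exact ⟨π.symm v, by simpa using hv, by simp⟩

theorem card_supp_inter_comp (α : V → Option ι) (D : Finset V) (π : Equiv.Perm V)
    (hπ : ∀ v, π v ∈ D ↔ v ∈ D) : (supp (α ∘ π) ∩ D).card = (supp α ∩ D).card := by
  refine Finset.card_bij (fun v _ => π v) (by simp [hπ]) (fun v _ w _ h => π.injective h) ?_
  intro v hv
  refine ⟨π.symm v, ?_, by simp⟩
  have := hπ (π.symm v)
  simp at hv this
  simp [hv, ← this]

theorem swap_mem_iff {D : Finset V} {x y : V} (hx : x ∈ D) (hy : y ∈ D) (v : V) :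
    Equiv.swap x y v ∈ D ↔ v ∈ D := by
  by_cases h1 : v = x
  · subst h1; simp [hx, hy]
  by_cases h2 : v = y
  · subst h2; simp [hx, hy]
  rw [Equiv.swap_apply_of_ne_of_ne h1 h2]

theorem swap_apply_of_notMem {D : Finset V} {x y v : V} (hx : x ∈ D) (hy : y ∈ D) (hv : v ∉ D) :
    Equiv.swap x y v = v :=
  Equiv.swap_apply_of_ne_of_ne (fun h => hv (h ▸ hx)) (fun h => hv (h ▸ hy))

/-- The tokens on `D` can be permuted arbitrarily as long as some vertex of `D` is free. -/
theorem Realizable.shuffle {D G U : Finset V} (hD : Shufflable H D) (hDG : D ⊆ G)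
    {α β : V → Option ι} {b : V} (hb : b ∈ D) (hαb : α b = none) {π : Equiv.Perm V}
    (hπ : ∀ x ∉ D, π x = x) {m : ℕ} (h : Realizable H G U (α ∘ π) β m) :
    Realizable H G (U ∪ D) α β (m + (Fintype.card V).factorial) := by
  have key : ∀ (σ τ : Equiv.Perm V) (p : (puzzle H D b).Walk σ τ),
      Realizable H G U (α ∘ τ) β m → Realizable H G (U ∪ D) (α ∘ σ) β (m + p.length) := by
    intro σ τ p
    induction p with
    | nil => exact fun h => h.mono subset_rfl Finset.subset_union_left le_rfl
    | @cons σ ρ τ hadj p ih =>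
      intro h
      have h' := ih h
      obtain ⟨x, hx, y, hy, hxy, hb', hρ⟩ := id hadj
      have hcoe : α ∘ ρ = (α ∘ σ) ∘ Equiv.swap x y := by rw [hρ]; rfl
      rw [hcoe] at h'
      have hblank : α (σ x) = none ∨ α (σ y) = none :=
        hb'.imp (fun e => by rw [e, hαb]) (fun e => by rw [e, hαb])
      have aux : ∀ x y : V, x ∈ D → H.Adj x y → α (σ x) ≠ none → α (σ y) = none →
          Realizable H G (U ∪ D) ((α ∘ σ) ∘ Equiv.swap x y) β (m + p.length) →
          Realizable H G (U ∪ D) (α ∘ σ) β (m + p.length + 1) := by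
        intro x y hx hxy h1 h2 hr
        refine (hr.slide h1 h2 (FreePath.of_adj hxy) fun hxG => absurd (hDG hx) hxG).mono
          subset_rfl ?_ le_rfl
        exact Finset.insert_subset (Finset.mem_union_right _ hx) subset_rfl
      rw [SimpleGraph.Walk.length_cons, ← add_assoc]
      by_cases h1 : α (σ x) = none
      · by_cases h2 : α (σ y) = none
        · have : (α ∘ σ) ∘ Equiv.swap x y = α ∘ σ := by
            funext v
            by_cases hvx : v = x
            · subst hvx; simp [h1, h2]
            by_cases hvy : v = y
            · subst hvy; simp [h1, h2]
            simp [Equiv.swap_apply_of_ne_of_ne hvx hvy]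
          rw [this] at h'
          exact h'.mono subset_rfl subset_rfl (by omega)
        · rw [Equiv.swap_comm] at h'
          exact aux y x hy hxy.symm h2 h1 h'
      · exact aux x y hx hxy h1 (hblank.resolve_left h1) h'
  have hreach : (puzzle H D b).Reachable 1 π := by
    simpa only [one_mul] using hD b 1 π hb hπ
  -- A simple path of puzzle states repeats no permutation, hence has fewer than $|V|!$ steps.
  obtain ⟨p, hp⟩ := hreach.exists_isPath
  have hlen := hp.length_lt
  rw [Fintype.card_perm] at hlen
  exact (key _ _ p h).mono subset_rfl subset_rfl (by omega)

theorem card_supp_erase₂ {α : V → Option ι} {x y : V} (hxy : x ≠ y) (hx : α x ≠ none)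
    (hy : α y ≠ none) : (supp (erase₂ α x y)).card + 2 = (supp α).card := by
  have e : supp (erase₂ α x y) = ((supp α).erase x).erase y := by
    ext v; simp [erase₂]; tauto
  have h1 : y ∈ (supp α).erase x := by simp [hy, hxy.symm]
  have h2 := Finset.card_erase_add_one h1
  have h3 := Finset.card_erase_add_one (show x ∈ supp α by simpa using hx)
  rw [e]; omega

theorem card_supp_update {α : V → Option ι} {x : V} (hx : α x ≠ none) :
    (supp (Function.update α x none)).card + 1 = (supp α).card := by
  have e : supp (Function.update α x none) = (supp α).erase x := by
    ext v
    by_cases hv : v = x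
    · subst hv; simp
    · simp [hv]
  rw [e, Finset.card_erase_add_one (by simpa using hx)]

variable {D G : Finset V}

/-- Let two tokens with the same label meet, one of which is on `D` and the other on `D` or next
to it. -/
theorem exists_kill (hD : Shufflable H D) (hDG : D ⊆ G) {α β : V → Option ι}
    (hp : Paired α β) {b x y u : V} (hb : b ∈ D) (hαb : α b = none) (hx : x ∈ D)
    (hxy : x ≠ y) (hαx : α x ≠ none) (he : α x = α y) (hu : u ∈ D) (huy : H.Adj u y) :
    ∃ α' : V → Option ι, (∀ v ∉ D, α' v ≠ none → α v ≠ none ∧ v ≠ y) ∧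
      (supp α' ∩ D).card < (supp α ∩ D).card ∧ (supp α').card + 2 = (supp α).card ∧
      Paired α' β ∧ ∀ (U : Finset V) (m : ℕ), (y ∉ G → y ∉ U) → Realizable H G U α' β m →
        Realizable H G (insert y (U ∪ D)) α β (m + 1 + (Fintype.card V).factorial) := by
  -- Shuffling on `D` exchanges the contents of `x` and `u`. The vertex `y` is unaffected, being
  -- different from both, and the two partners now face each other across the edge `u y`.
  set α₁ := α ∘ Equiv.swap x u with hα₁
  have h1u : α₁ u = α x := by simp [hα₁]
  have h1y : α₁ y = α y := by
    simp [hα₁, Equiv.swap_apply_of_ne_of_ne hxy.symm huy.ne.symm]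
  have hun : α₁ u ≠ none := by rwa [h1u]
  have huy' : α₁ u = α₁ y := by rw [h1u, h1y, he]
  have hout : ∀ v ∉ D, α₁ v = α v := fun v hv => by
    simp [hα₁, swap_apply_of_notMem hx hu hv]
  refine ⟨erase₂ α₁ u y, ?_, ?_, ?_, (hp.comp _).erase₂ huy.ne hun huy', ?_⟩
  · intro v hv hne
    have hvy : v ≠ y := by rintro rfl; simp [erase₂] at hne
    have hvu : v ≠ u := by rintro rfl; exact hv hu
    simp only [erase₂, hvy, hvu, or_self, if_false, hout v hv] at hne
    exact ⟨hne, hvy⟩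
  · rw [← card_supp_inter_comp α D _ (swap_mem_iff hx hu)]
    refine Finset.card_lt_card ((Finset.ssubset_iff_of_subset ?_).2 ⟨u, ?_, ?_⟩)
    · intro v hv
      simp only [Finset.mem_inter, mem_supp, erase₂] at hv ⊢
      refine ⟨fun h => hv.1 ?_, hv.2⟩
      rw [← hα₁] at h
      simp [h]
    · simp only [Finset.mem_inter, mem_supp]
      exact ⟨hun, hu⟩
    · simp [erase₂]
  · rw [card_supp_erase₂ huy.ne hun (by rwa [← huy']), hα₁, card_supp_comp]
  · intro U m hU hr
    have h2 := hr.kill huy.ne hun huy' (FreePath.of_adj huy) (fun h => absurd (hDG hu) h) hU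
    refine (h2.shuffle hD hDG hb hαb fun v hv => swap_apply_of_notMem hx hu hv).mono
      subset_rfl ?_ le_rfl
    intro v hv
    simp only [Finset.mem_union, Finset.mem_insert] at hv ⊢
    rcases hv with (rfl | rfl | hv) | hv
    · exact Or.inr (Or.inr hu)
    · exact Or.inl rfl
    · exact Or.inr (Or.inl hv)
    · exact Or.inr (Or.inr hv)

/-- Bring a token on `D` to its final position outside `G` and next to `D`. -/
theorem exists_transport (hD : Shufflable H D) (hDG : D ⊆ G) {α β : V → Option ι}
    (hp : Paired α β) {b x y u : V} (hb : b ∈ D) (hαb : α b = none) (hx : x ∈ D)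
    (hαx : α x ≠ none) (he : α x = β y) (hαy : α y = none) (hyG : y ∉ G)
    (hu : u ∈ D) (huy : H.Adj u y) :
    ∃ α' : V → Option ι, (∀ v ∉ D, α' v = α v) ∧
      (supp α' ∩ D).card < (supp α ∩ D).card ∧ (supp α').card + 1 = (supp α).card ∧
      Paired α' (Function.update β y none) ∧
      ∀ (U : Finset V) (m : ℕ), y ∉ U → Realizable H G U α' (Function.update β y none) m →
        Realizable H G (insert y (U ∪ D)) α β (m + 1 + (Fintype.card V).factorial) := by
  set α₁ := α ∘ Equiv.swap x u with hα₁
  have hxy : x ≠ y := by rintro rfl; exact hαx hαy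
  have h1u : α₁ u = α x := by simp [hα₁]
  have h1y : α₁ y = none := by
    simp [hα₁, Equiv.swap_apply_of_ne_of_ne hxy.symm huy.ne.symm, hαy]
  have hun : α₁ u ≠ none := by rwa [h1u]
  have hout : ∀ v ∉ D, α₁ v = α v := fun v hv => by
    simp [hα₁, swap_apply_of_notMem hx hu hv]
  refine ⟨Function.update α₁ u none, ?_, ?_, ?_, (hp.comp _).update hun (h1u.trans he), ?_⟩
  · intro v hv
    have hvu : v ≠ u := by rintro rfl; exact hv hu
    rw [Function.update_of_ne hvu, hout v hv]
  · rw [← card_supp_inter_comp α D _ (swap_mem_iff hx hu)]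
    refine Finset.card_lt_card ((Finset.ssubset_iff_of_subset ?_).2 ⟨u, ?_, ?_⟩)
    · intro v hv
      simp only [Finset.mem_inter, mem_supp] at hv ⊢
      have hvu : v ≠ u := by rintro rfl; simp at hv
      rw [Function.update_of_ne hvu] at hv
      exact hv
    · simp only [Finset.mem_inter, mem_supp]
      exact ⟨hun, hu⟩
    · simp
  · rw [card_supp_update hun, hα₁, card_supp_comp]
  · intro U m hU hr
    have h2 := hr.transport hun (h1u.trans he) h1y (FreePath.of_adj huy)
      (fun h => absurd (hDG hu) h) hyG hU
    refine (h2.shuffle hD hDG hb hαb fun v hv => swap_apply_of_notMem hx hu hv).mono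
      subset_rfl ?_ le_rfl
    intro v hv
    simp only [Finset.mem_union, Finset.mem_insert] at hv ⊢
    rcases hv with (rfl | rfl | hv) | hv
    · exact Or.inr (Or.inr hu)
    · exact Or.inl rfl
    · exact Or.inr (Or.inl hv)
    · exact Or.inr (Or.inr hv)

/-- Move a token next to `D` onto `D`. -/
theorem exists_enter (hD : Shufflable H D) (hDG : D ⊆ G) {α β : V → Option ι}
    (hp : Paired α β) {b x u : V} (hb : b ∈ D) (hαb : α b = none) (hx : x ∉ D)
    (hαx : α x ≠ none) (hu : u ∈ D) (hux : H.Adj u x) :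
    ∃ α' : V → Option ι, (∀ v ∉ D, v ≠ x → α' v = α v) ∧ α' x = none ∧ α' u = α x ∧
      (supp α' ∩ D).card = (supp α ∩ D).card + 1 ∧ (supp α').card = (supp α).card ∧
      Paired α' β ∧
      ∀ (U : Finset V) (m : ℕ), (x ∉ G → x ∉ U) → Realizable H G U α' β m →
        Realizable H G (insert x (U ∪ D)) α β (m + 1 + (Fintype.card V).factorial) := by
  set α₁ := α ∘ Equiv.swap b u with hα₁
  have h1u : α₁ u = none := by simp [hα₁, hαb]
  have hout : ∀ v ∉ D, α₁ v = α v := fun v hv => by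
    simp [hα₁, swap_apply_of_notMem hb hu hv]
  have h1x : α₁ x = α x := hout x hx
  have hxn : α₁ x ≠ none := by rwa [h1x]
  have hxu : x ≠ u := hux.ne.symm
  refine ⟨α₁ ∘ Equiv.swap x u, ?_, by simp [h1u], by simp [h1x], ?_, ?_, (hp.comp _).comp _, ?_⟩
  · intro v hv hvx
    have hvu : v ≠ u := by rintro rfl; exact hv hu
    rw [Function.comp_apply, Equiv.swap_apply_of_ne_of_ne hvx hvu, hout v hv]
  · rw [← card_supp_inter_comp α D _ (swap_mem_iff hb hu), ← hα₁]
    have e : supp (α₁ ∘ Equiv.swap x u) ∩ D = insert u (supp α₁ ∩ D) := by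
      ext v
      simp only [Finset.mem_inter, mem_supp, Finset.mem_insert]
      by_cases hvu : v = u
      · subst hvu; simpa [hu] using hxn
      · by_cases hvx : v = x
        · subst hvx; simp [hx, hvu]
        · simp [Equiv.swap_apply_of_ne_of_ne hvx hvu, hvu]
    rw [e, Finset.card_insert_of_notMem (by simp [h1u])]
  · rw [card_supp_comp, hα₁, card_supp_comp]
  · intro U m hU hr
    have h2 := hr.slide hxn h1u (FreePath.of_adj hux).symm hU
    refine (h2.shuffle hD hDG hb hαb fun v hv => swap_apply_of_notMem hb hu hv).mono
      subset_rfl ?_ le_rfl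
    intro v hv
    simp only [Finset.mem_union, Finset.mem_insert] at hv ⊢
    tauto

end Operations

/-! ### Resolving all pairs when every token is on `D` or next to it. -/

section Settled

variable {V : Type*} [DecidableEq V] [Fintype V] {ι : Type*} {H : SimpleGraph V} {D : Finset V}

/-- All tokens are on `D` or next to it, no vertex outside `D` is used by both configurations,
and `D` has enough unoccupied vertices. -/
structure Settled (H : SimpleGraph V) (D : Finset V) (α β : V → Option ι) (k s : ℕ) : Prop where
  adj : ∀ v ∉ D, α v ≠ none ∨ β v ≠ none → ∃ u ∈ D, H.Adj u v
  disj : ∀ v ∉ D, α v = none ∨ β v = none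
  left : (supp α ∩ D).card < D.card
  right : (supp β ∩ D).card < D.card
  -- The slack `s` pays for letting a token enter `D`. If no token is outside `D`, none ever has to
  -- enter, and no slack is required.
  room : (supp α ∩ D).card + (supp β ∩ D).card + s ≤ 2 * D.card ∨
    ∀ v ∉ D, α v = none ∧ β v = none
  paired : Paired α β
  card : (supp α).card + (supp β).card = 2 * k

theorem Settled.symm {α β : V → Option ι} {k s : ℕ} (h : Settled H D α β k s) :
    Settled H D β α k s where
  adj v hv h' := h.adj v hv h'.symm
  disj v hv := (h.disj v hv).symm
  left := h.right
  right := h.left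
  room := by
    rcases h.room with h | h
    · left; omega
    · right; exact fun v hv => (h v hv).symm
  paired := h.paired.symm
  card := by rw [← h.card, add_comm]

theorem Settled.mono {α β : V → Option ι} {k s s' : ℕ} (h : Settled H D α β k s) (hs : s' ≤ s) :
    Settled H D α β k s' :=
  { h with room := h.room.imp (fun h => by omega) id }

theorem exists_blank {α : V → Option ι} (h : (supp α ∩ D).card < D.card) :
    ∃ b ∈ D, α b = none := by
  by_contra hne
  push Not at hne
  have : supp α ∩ D = D := Finset.inter_eq_right.2 fun v hv => mem_supp.2 (hne v hv)
  rw [this] at h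
  exact lt_irrefl _ h

/-- The step count that suffices for `k` pairs. -/
def SettledRealizable (ι : Type*) (H : SimpleGraph V) (D : Finset V) (k : ℕ) : Prop :=
  ∀ α β : V → Option ι, Settled H D α β k 3 →
    Realizable H D (D ∪ supp α ∪ supp β) α β (k * (2 * (Fintype.card V).factorial + 2))

/-- Slack 2 suffices here although the induction asks for 3: at least one token disappears from `D`.
-/
theorem Settled.kill (hD : Shufflable H D) (hdeg : ∀ v ∈ D, ∃ u ∈ D, H.Adj u v)
    {α β : V → Option ι} {k : ℕ}
    (hk : SettledRealizable ι H D k) (h : Settled H D α β (k + 1) 2) {x y : V} (hx : x ∈ D)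
    (hxy : x ≠ y) (hαx : α x ≠ none) (he : α x = α y) :
    Realizable H D (D ∪ supp α ∪ supp β) α β
      (k * (2 * (Fintype.card V).factorial + 2) + 1 + (Fintype.card V).factorial) := by
  obtain ⟨b, hb, hαb⟩ := exists_blank h.left
  have hαy : α y ≠ none := he ▸ hαx
  obtain ⟨u, hu, huy⟩ : ∃ u ∈ D, H.Adj u y := by
    by_cases hy : y ∈ D
    · exact hdeg y hy
    · exact h.adj y hy (Or.inl hαy)
  obtain ⟨α', h1, h2, h3, h4, h5⟩ :=
    exists_kill hD subset_rfl h.paired hb hαb hx hxy hαx he hu huy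
  have hcard := h.card
  have hs : Settled H D α' β k 3 :=
    { adj := fun v hv h' => h.adj v hv (h'.imp_left fun g => (h1 v hv g).1)
      disj := fun v hv => by
        rcases h.disj v hv with g | g
        · left; by_contra g'; exact (h1 v hv g').1 g
        · exact Or.inr g
      left := h2.trans h.left
      right := h.right
      room := by
        rcases h.room with g | g
        · left; omega
        · right
          refine fun v hv => ⟨?_, (g v hv).2⟩
          by_contra g'; exact (h1 v hv g').1 (g v hv).1
      paired := h4
      card := by omega }
  refine (h5 _ _ ?_ (hk α' β hs)).mono subset_rfl ?_ le_rfl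
  · intro hyD
    have g1 : α' y = none := by by_contra g; exact (h1 y hyD g).2 rfl
    have g2 : β y = none := (h.disj y hyD).resolve_left hαy
    simp [hyD, g1, g2]
  · intro v hv
    simp only [Finset.mem_insert, Finset.mem_union, mem_supp] at hv ⊢
    by_cases hvD : v ∈ D
    · exact Or.inl (Or.inl hvD)
    rcases hv with rfl | ((hv | hv) | hv) | hv
    · exact Or.inl (Or.inr hαy)
    · exact absurd hv hvD
    · exact Or.inl (Or.inr (h1 v hvD hv).1)
    · exact Or.inr hv
    · exact absurd hv hvD

theorem Settled.transport (hD : Shufflable H D) {α β : V → Option ι} {k : ℕ}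
    (hk : SettledRealizable ι H D k) (h : Settled H D α β (k + 1) 2) {x y : V} (hx : x ∈ D)
    (hy : y ∉ D) (hαx : α x ≠ none) (he : α x = β y) :
    Realizable H D (D ∪ supp α ∪ supp β) α β
      (k * (2 * (Fintype.card V).factorial + 2) + 1 + (Fintype.card V).factorial) := by
  obtain ⟨b, hb, hαb⟩ := exists_blank h.left
  have hβy : β y ≠ none := he ▸ hαx
  have hαy : α y = none := (h.disj y hy).resolve_right hβy
  obtain ⟨u, hu, huy⟩ := h.adj y hy (Or.inr hβy)
  obtain ⟨α', h1, h2, h3, h4, h5⟩ :=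
    exists_transport hD subset_rfl h.paired hb hαb hx hαx he hαy hy hu huy
  have hcard := h.card
  set β' := Function.update β y none with hβ'
  have hβle : ∀ v, β' v ≠ none → β v ≠ none := by
    intro v hv
    by_cases hvy : v = y
    · subst hvy; simp [hβ'] at hv
    · rwa [hβ', Function.update_of_ne hvy] at hv
  have hβcard : (supp β' ∩ D).card ≤ (supp β ∩ D).card := by
    refine Finset.card_le_card (Finset.inter_subset_inter_right fun v hv => ?_)
    rw [mem_supp] at hv ⊢
    exact hβle v hv
  have h6 := card_supp_update hβy
  rw [← hβ'] at h6
  have hs : Settled H D α' β' k 3 :=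
    { adj := fun v hv h' => h.adj v hv (by rw [h1 v hv] at h'; exact h'.imp_right (hβle v))
      disj := fun v hv => by
        rw [h1 v hv]
        rcases h.disj v hv with g | g
        · exact Or.inl g
        · right; by_contra g'; exact hβle v g' g
      left := h2.trans h.left
      right := hβcard.trans_lt h.right
      room := by
        rcases h.room with g | g
        · left; omega
        · exact absurd (g y hy).2 hβy
      paired := h4
      card := by omega }
  refine (h5 _ _ ?_ (hk α' β' hs)).mono subset_rfl ?_ le_rfl
  · simp [hy, h1 y hy, hαy, hβ']
  · intro v hv
    simp only [Finset.mem_insert, Finset.mem_union, mem_supp] at hv ⊢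
    by_cases hvD : v ∈ D
    · exact Or.inl (Or.inl hvD)
    rcases hv with rfl | ((hv | hv) | hv) | hv
    · exact Or.inr hβy
    · exact absurd hv hvD
    · rw [h1 v hvD] at hv
      exact Or.inl (Or.inr hv)
    · exact Or.inr (hβle v hv)
    · exact absurd hv hvD

/-- If all tokens are on `D` and each has to move from `α` to `β`, the task is a permutation. -/
theorem exists_perm_of_cross {α β : V → Option ι} (hα : ∀ v ∉ D, α v = none)
    (hβ : ∀ v ∉ D, β v = none) (hαinj : ∀ v w, α v ≠ none → α v = α w → v = w)
    (hβinj : ∀ v w, β v ≠ none → β v = β w → v = w)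
    (hαβ : ∀ v, α v ≠ none → ∃ w, β w = α v) (hβα : ∀ v, β v ≠ none → ∃ w, α w = β v) :
    ∃ π : Equiv.Perm V, (∀ v ∉ D, π v = v) ∧ α ∘ π = β := by
  classical
  have hαD : ∀ v, α v ≠ none → v ∈ D := fun v hv => by_contra fun h => hv (hα v h)
  have hβD : ∀ v, β v ≠ none → v ∈ D := fun v hv => by_contra fun h => hv (hβ v h)
  have hex : ∀ x : {x : D // β x ≠ none}, ∃ y : {y : D // α y ≠ none}, α y.1 = β x.1 := by
    rintro ⟨⟨x, hxD⟩, hx⟩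
    obtain ⟨w, hw⟩ := hβα x hx
    have hwn : α w ≠ none := by rw [hw]; exact hx
    exact ⟨⟨⟨w, hαD w hwn⟩, hwn⟩, hw⟩
  choose f hf using hex
  have hbij : Function.Bijective f := by
    constructor
    · intro x y hxy
      have : β x.1 = β y.1 := by rw [← hf x, ← hf y, hxy]
      exact Subtype.ext (Subtype.ext (hβinj _ _ x.2 this))
    · rintro ⟨⟨y, hyD⟩, hy⟩
      obtain ⟨w, hw⟩ := hαβ y hy
      have hwn : β w ≠ none := by rw [hw]; exact hy
      refine ⟨⟨⟨w, hβD w hwn⟩, hwn⟩, ?_⟩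
      have h1 := hf ⟨⟨w, hβD w hwn⟩, hwn⟩
      exact Subtype.ext (Subtype.ext (hαinj _ _ (f _).2 (h1.trans hw)))
  -- Matching equal labels is a bijection between the occupied parts of `D`; being finite, it
  -- extends to a permutation of `D`.
  let e : {x : D // β x ≠ none} ≃ {y : D // α y ≠ none} := Equiv.ofBijective f hbij
  refine ⟨Equiv.Perm.ofSubtype e.extendSubtype, fun v hv =>
    Equiv.Perm.ofSubtype_apply_of_not_mem _ hv, ?_⟩
  funext v
  by_cases hv : v ∈ D
  · rw [Function.comp_apply, Equiv.Perm.ofSubtype_apply_of_mem _ hv]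
    by_cases hβv : β v = none
    · have := e.extendSubtype_not_mem ⟨v, hv⟩ (by simpa using hβv)
      rw [hβv]
      simpa using this
    · rw [e.extendSubtype_apply_of_mem ⟨v, hv⟩ hβv]
      exact hf ⟨⟨v, hv⟩, hβv⟩
  · rw [Function.comp_apply, Equiv.Perm.ofSubtype_apply_of_not_mem _ hv, hα v hv, hβ v hv]

/-- The label of a token of `α` occurs once more, in `α` or in `β`. -/
theorem Paired.exists_partner {α β : V → Option ι} (h : Paired α β) {v : V} (hv : α v ≠ none) :
    (∃ w, w ≠ v ∧ α v = α w) ∨ ∃ w, α v = β w := by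
  obtain ⟨q, h1, h2, -⟩ := h (Sum.inl v) hv
  rcases q with q | q
  · exact Or.inl ⟨q, by rintro rfl; exact h1 rfl, h2.symm⟩
  · exact Or.inr ⟨q, h2.symm⟩

/-- Sending each token to its partner is injective, since no token of `α` on `D` shares its label
with another token of `α`. -/
theorem card_inter_le_of_cross {α β : V → Option ι} 
    (h1 : ∀ x ∈ D, ∀ y, x ≠ y → α x ≠ none → α x ≠ α y)
    (h2 : ∀ x ∈ D, α x ≠ none → ∃ y ∈ D, α x = β y) :
    (supp α ∩ D).card ≤ (supp β ∩ D).card := by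
  classical
  have hex : ∀ x, ∃ y, x ∈ supp α ∩ D → y ∈ supp β ∩ D ∧ α x = β y := by
    intro x
    by_cases hx : x ∈ supp α ∩ D
    · simp only [Finset.mem_inter, mem_supp] at hx
      obtain ⟨y, hy, e⟩ := h2 x hx.2 hx.1
      exact ⟨y, fun _ => ⟨by simp [hy, ← e, hx.1], e⟩⟩
    · exact ⟨x, fun h => absurd h hx⟩
  choose f hf using hex
  refine Finset.card_le_card_of_injOn f (fun x hx => (hf x hx).1) ?_
  intro x hx y hy hxy
  by_contra hne
  have h3 : α x = α y := by rw [(hf x hx).2, (hf y hy).2, hxy]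
  have hx' : x ∈ supp α ∩ D := hx
  simp only [Finset.mem_inter, mem_supp] at hx'
  exact h1 x hx'.2 y hne hx'.1 h3

/-- One pair can be dealt with after moving a token next to `D` onto `D`. -/
theorem Settled.enter (hD : Shufflable H D) (hdeg : ∀ v ∈ D, ∃ u ∈ D, H.Adj u v)
    {α β : V → Option ι} {k : ℕ} (hk : SettledRealizable ι H D k)
    (h : Settled H D α β (k + 1) 3) {x : V} (hx : x ∉ D) (hαx : α x ≠ none)
    (hroom : (supp α ∩ D).card + 2 ≤ D.card)
    (hA : ∀ z ∈ D, α z ≠ none → α z ≠ α x) (hB : ∀ z ∈ D, β z ≠ none → β z ≠ α x) :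
    Realizable H D (D ∪ supp α ∪ supp β) α β
      ((k + 1) * (2 * (Fintype.card V).factorial + 2)) := by
  obtain ⟨b, hb, hαb⟩ := exists_blank h.left
  obtain ⟨u, hu, hux⟩ := h.adj x hx (Or.inl hαx)
  have hβx : β x = none := (h.disj x hx).resolve_left hαx
  obtain ⟨α', h1, h2, h3, h4, h5, h6, h7⟩ :=
    exists_enter hD subset_rfl h.paired hb hαb hx hαx hu hux
  have hcard := h.card
  have hle : ∀ v ∉ D, α' v ≠ none → α v ≠ none := by
    intro v hv hv'
    by_cases hvx : v = x
    · subst hvx; exact hαx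
    · rwa [h1 v hv hvx] at hv'
  have hs : Settled H D α' β (k + 1) 2 :=
    { adj := fun v hv h' => h.adj v hv (h'.imp_left (hle v hv))
      disj := fun v hv => by
        rcases h.disj v hv with g | g
        · left; by_contra g'; exact hle v hv g' g
        · exact Or.inr g
      left := by omega
      right := h.right
      room := by
        rcases h.room with g | g
        · left; omega
        · exact absurd (g x hx).1 hαx
      paired := h6
      card := by omega }
  have hu' : α' u ≠ none := by rwa [h3]
  -- The partner of the token that entered is not on `D`, hence it is next to `D`, and the pair can
  -- be resolved. Entering lowered the slack from 3 to 2, and this resolution restores it.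
  have hfin : Realizable H D (D ∪ supp α' ∪ supp β) α' β
      (k * (2 * (Fintype.card V).factorial + 2) + 1 + (Fintype.card V).factorial) := by
    rcases h.paired.exists_partner hαx with ⟨w, hwx, hw⟩ | ⟨w, hw⟩
    · have hwD : w ∉ D := fun hwD => hA w hwD (by rwa [← hw]) hw.symm
      refine hs.kill hD hdeg hk hu (y := w) ?_ hu' ?_
      · rintro rfl; exact hwD hu
      · rw [h3, hw, h1 w hwD hwx]
    · have hwD : w ∉ D := fun hwD => hB w hwD (by rwa [← hw]) hw.symm
      exact hs.transport hD hk hu hwD hu' (h3.trans hw)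
  refine (h7 _ _ ?_ hfin).mono subset_rfl ?_ ?_
  · intro _
    simp [hx, h2, hβx]
  · intro v hv
    simp only [Finset.mem_insert, Finset.mem_union, mem_supp] at hv ⊢
    by_cases hvD : v ∈ D
    · exact Or.inl (Or.inl hvD)
    rcases hv with rfl | ((hv | hv) | hv) | hv
    · exact Or.inl (Or.inr hαx)
    · exact absurd hv hvD
    · exact Or.inl (Or.inr (hle v hvD hv))
    · exact Or.inr hv
    · exact absurd hv hvD
  -- Entering and resolving cost one shuffle and one move each, which accounts for $2|V|!+2$ per
  -- pair.
  · ring_nf; omega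

/-- If a token on `D` has a partner in its own configuration, or outside `D` in the other one, that
pair is resolved directly. Otherwise all tokens on `D` are matched with tokens on `D` of the other
configuration. Then either nothing is outside `D` and a single permutation finishes, or there is
room for an outside token to enter. -/
theorem settledRealizable (hD : Shufflable H D) (hdeg : ∀ v ∈ D, ∃ u ∈ D, H.Adj u v)
    (M₀ : Move H) (k : ℕ) : SettledRealizable ι H D k := by
  induction k with
  | zero =>
    intro α β h
    have h0 := h.card
    have hα : ∀ v, α v = none := fun v => by
      by_contra hv
      have := Finset.card_pos.2 ⟨v, mem_supp.2 hv⟩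
      omega
    have hβ : ∀ v, β v = none := fun v => by
      by_contra hv
      have := Finset.card_pos.2 ⟨v, mem_supp.2 hv⟩
      omega
    obtain rfl : α = β := by funext v; rw [hα, hβ]
    exact ⟨0, by omega, RealizableIn.refl M₀ (fun v hv => absurd (hα v) hv)⟩
  | succ k hk =>
    intro α β h
    have hnum : k * (2 * (Fintype.card V).factorial + 2) + 1 + (Fintype.card V).factorial ≤
        (k + 1) * (2 * (Fintype.card V).factorial + 2) := by ring_nf; omega
    have hU : D ∪ supp β ∪ supp α ⊆ D ∪ supp α ∪ supp β := by grind
    by_cases hA : ∃ x ∈ D, ∃ y, x ≠ y ∧ α x ≠ none ∧ α x = α y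
    · obtain ⟨x, hx, y, hxy, h1, h2⟩ := hA
      exact ((h.mono (by omega)).kill hD hdeg hk hx hxy h1 h2).mono subset_rfl subset_rfl hnum
    by_cases hA' : ∃ x ∈ D, ∃ y, x ≠ y ∧ β x ≠ none ∧ β x = β y
    · obtain ⟨x, hx, y, hxy, h1, h2⟩ := hA'
      exact ((h.symm.mono (by omega)).kill hD hdeg hk hx hxy h1 h2).symm.mono subset_rfl hU hnum
    by_cases hB : ∃ x ∈ D, ∃ y, y ∉ D ∧ α x ≠ none ∧ α x = β y
    · obtain ⟨x, hx, y, hxy, h1, h2⟩ := hB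
      exact ((h.mono (by omega)).transport hD hk hx hxy h1 h2).mono subset_rfl subset_rfl hnum
    by_cases hB' : ∃ x ∈ D, ∃ y, y ∉ D ∧ β x ≠ none ∧ β x = α y
    · obtain ⟨x, hx, y, hxy, h1, h2⟩ := hB'
      exact ((h.symm.mono (by omega)).transport hD hk hx hxy h1 h2).symm.mono subset_rfl hU hnum
    push Not at hA hA' hB hB'
    have hcross : ∀ x ∈ D, α x ≠ none → ∃ y ∈ D, α x = β y := by
      intro x hx hx'
      rcases h.paired.exists_partner hx' with ⟨w, hw, e⟩ | ⟨w, e⟩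
      · exact absurd e (hA x hx w hw.symm hx')
      · exact ⟨w, by_contra fun hw => hB x hx w hw hx' e, e⟩
    have hcross' : ∀ x ∈ D, β x ≠ none → ∃ y ∈ D, β x = α y := by
      intro x hx hx'
      rcases h.paired.symm.exists_partner hx' with ⟨w, hw, e⟩ | ⟨w, e⟩
      · exact absurd e (hA' x hx w hw.symm hx')
      · exact ⟨w, by_contra fun hw => hB' x hx w hw hx' e, e⟩
    have hc1 := card_inter_le_of_cross hA hcross
    have hc2 := card_inter_le_of_cross hA' hcross'
    by_cases hin : ∀ v ∉ D, α v = none ∧ β v = none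
    · have hαD : ∀ v, α v ≠ none → v ∈ D := fun v hv => by_contra fun g => hv (hin v g).1
      have hβD : ∀ v, β v ≠ none → v ∈ D := fun v hv => by_contra fun g => hv (hin v g).2
      obtain ⟨π, hπ, hπe⟩ := exists_perm_of_cross (D := D) (α := α) (β := β)
        (fun v hv => (hin v hv).1) (fun v hv => (hin v hv).2)
        (fun v w hv e => by_contra fun hne => hA v (hαD v hv) w hne hv e)
        (fun v w hv e => by_contra fun hne => hA' v (hβD v hv) w hne hv e)
        (fun v hv => (hcross v (hαD v hv) hv).imp fun w hw => hw.2.symm)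
        (fun v hv => (hcross' v (hβD v hv) hv).imp fun w hw => hw.2.symm)
      obtain ⟨b, hb, hαb⟩ := exists_blank h.left
      have hr : Realizable H D (supp β) (α ∘ π) β 0 := by
        rw [hπe]
        exact ⟨0, le_rfl, RealizableIn.refl M₀ (by simp)⟩
      refine (hr.shuffle hD subset_rfl hb hαb hπ).mono subset_rfl (by grind) ?_
      ring_nf
      omega
    -- Both configurations have the same number $a$ of tokens on `D`, so $2a+3\le 2|D|$; by parity
    -- $a+2\le|D|$, which is what entering requires.
    · have hroom := h.room.resolve_right hin
      push Not at hin
      obtain ⟨x, hx, hx'⟩ := hin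
      by_cases hαx : α x = none
      · have hβx := hx' hαx
        refine (h.symm.enter hD hdeg hk hx hβx (by omega) ?_ ?_).symm.mono subset_rfl hU le_rfl
        · intro z hz hz'
          exact hA' z hz x (by rintro rfl; exact hx hz) hz'
        · exact fun z hz hz' => hB z hz x hx hz'
      · refine h.enter hD hdeg hk hx hαx (by omega) ?_ ?_
        · intro z hz hz'
          exact hA z hz x (by rintro rfl; exact hx hz) hz'
        · exact fun z hz hz' => hB' z hz x hx hz'

end Settled

/-! ### The main induction, when both configurations fit on `D` and its neighbours. -/

section Main

variable {V : Type*} [DecidableEq V] [Fintype V] {ι : Type*} {H : SimpleGraph V}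

theorem LinkedVia.extend {G W : Finset V} (h : LinkedVia H G G) (hGW : G ⊆ W)
    (hW : ∀ a ∈ W, a ∉ G → ∃ b ∈ G, H.Adj a b) : LinkedVia H G W := by
  have key : ∀ v ∈ W, ∃ v' ∈ G, ∃ p : H.Walk v v', ∀ u ∈ p.support, u = v ∨ u = v' := by
    intro v hv
    by_cases hvG : v ∈ G
    · exact ⟨v, hvG, SimpleGraph.Walk.nil, by simp⟩
    · obtain ⟨b, hb, hvb⟩ := hW v hv hvG
      exact ⟨b, hb, hvb.toWalk, by simp⟩
  intro v hv w hw
  obtain ⟨v', hv', p, hp⟩ := key v hv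
  obtain ⟨w', hw', q, hq⟩ := key w hw
  obtain ⟨r, hr⟩ := h v' hv' w' hw'
  refine ⟨(p.append r).append q.reverse, fun u hu => ?_⟩
  rw [SimpleGraph.Walk.mem_support_append_iff, SimpleGraph.Walk.mem_support_append_iff,
    SimpleGraph.Walk.support_reverse, List.mem_reverse] at hu
  have h1 : u = v ∨ u = w ∨ u ∈ G := by
    rcases hu with (hu | hu) | hu
    · rcases hp u hu with rfl | rfl
      · exact Or.inl rfl
      · exact Or.inr (Or.inr hv')
    · exact Or.inr (Or.inr (hr u hu).1)
    · rcases hq u hu with rfl | rfl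
      · exact Or.inr (Or.inl rfl)
      · exact Or.inr (Or.inr hw')
  rcases h1 with rfl | rfl | h1
  · exact ⟨hv, fun h => absurd rfl h⟩
  · exact ⟨hw, fun _ h => absurd rfl h⟩
  · exact ⟨hGW h1, fun _ _ => h1⟩

/-- A vertex outside `G` that is both occupied and a target keeps its token, since leaving it and
returning would violate singularity. Such vertices are removed from `W`; what remains is still
linked, because every other vertex hangs on `G` by an edge. -/
theorem exists_transit_to {G U : Finset V} (h : LinkedVia H G G) (hGU : G ⊆ U)
    (hU : ∀ a ∈ U, a ∉ G → ∃ b ∈ G, H.Adj a b) {α : V → Option ι} (hα : supp α ⊆ U)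
    {T : Finset V} (hT : T ⊆ U) (hcard : T.card = (supp α).card) :
    ∃ π : Equiv.Perm V, supp (α ∘ π) = T ∧ Transits H G α (α ∘ π) T.card := by
  classical
  set W : Finset V := U.filter fun v => v ∈ G ∨ v ∉ T ∨ α v = none with hW
  have hGW : G ⊆ W := fun v hv => by simp [hW, hGU hv, hv]
  have hlink : LinkedVia H G W :=
    h.extend hGW fun a ha haG => hU a (Finset.mem_filter.1 ha).1 haG
  have hsd : T \ W = supp α \ W := by
    ext v
    simp only [Finset.mem_sdiff, hW, Finset.mem_filter, mem_supp]
    constructor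
    · rintro ⟨h1, h2⟩
      exact ⟨fun h => h2 ⟨hT h1, by simp [h]⟩, h2⟩
    · rintro ⟨h1, h2⟩
      exact ⟨by_contra fun h => h2 ⟨hα (mem_supp.2 h1), by simp [h]⟩, h2⟩
  have hc : (T ∩ W).card = (supp α ∩ W).card := by
    have h1 := Finset.card_sdiff_add_card_inter T W
    have h2 := Finset.card_sdiff_add_card_inter (supp α) W
    rw [hsd] at h1
    omega
  obtain ⟨π, h1, h2, h3⟩ := exists_transit _ W rfl hlink α (T ∩ W) Finset.inter_subset_right
    (by rw [hc]) (fun v hv hvT hαv => by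
      have h1 := (Finset.mem_filter.1 hv).2
      have h2 := (Finset.mem_inter.1 hvT).1
      tauto)
  refine ⟨π, ?_, h3.mono (Finset.card_le_card Finset.inter_subset_left)⟩
  ext v
  rw [mem_supp, Function.comp_apply]
  by_cases hv : v ∈ W
  · rw [h2 v hv]; simp [hv]
  · rw [h1 v hv, ← mem_supp]
    have : v ∈ T \ W ↔ v ∈ supp α \ W := by rw [hsd]
    simpa [hv] using this.symm

/-- Move both configurations to prescribed vertex sets. -/
theorem exists_transit_both {G U : Finset V} (h : LinkedVia H G G) (hGU : G ⊆ U)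
    (hU : ∀ a ∈ U, a ∉ G → ∃ b ∈ G, H.Adj a b) {α β : V → Option ι} (hα : supp α ⊆ U)
    (hβ : supp β ⊆ U) (hp : Paired α β) {S T : Finset V} (hS : S ⊆ U) (hT : T ⊆ U)
    (hcS : S.card = (supp α).card) (hcT : T.card = (supp β).card)
    (hdisj : ∀ v ∉ G, α v ≠ none ∨ v ∈ S → β v = none ∧ v ∉ T) :
    ∃ α' β' : V → Option ι, supp α' = S ∧ supp β' = T ∧ Paired α' β' ∧
      ∀ (U' : Finset V) (m : ℕ), U' ⊆ U → (∀ v ∉ G, α v ≠ none → v ∉ S → v ∉ U') →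
        (∀ v ∉ G, β v ≠ none → v ∉ T → v ∉ U') → Realizable H G U' α' β' m →
          Realizable H G U α β (m + (S.card + T.card)) := by
  obtain ⟨π, h1, h2⟩ := exists_transit_to h hGU hU hα hS hcS
  obtain ⟨ρ, h3, h4⟩ := exists_transit_to h hGU hU hβ hT hcT
  refine ⟨α ∘ π, β ∘ ρ, h1, h3, (hp.comp π).symm.comp ρ |>.symm, ?_⟩
  intro U' m hUU hX hY hr
  have h5 := h2 U' (β ∘ ρ) m (fun v hv g1 g2 => hX v hv g1 (by rw [← h1]; simpa using g2)) hr
  -- The moves for `β` are run backwards at the end of the movement. By `hdisj`, a vertex outside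
  -- `G` used in moving `α` is not used in moving `β`, so its occupation times stay consecutive.
  have h6 := h4 _ α _ ?_ h5.symm
  · refine h6.symm.mono subset_rfl ?_ (by omega)
    intro v hv
    simp only [Finset.mem_union] at hv
    rcases hv with (((hv | hv) | hv) | hv) | hv
    · exact hUU hv
    · exact hα hv
    · exact hGU hv
    · exact hβ hv
    · exact hGU hv
  · intro v hv g1 g2
    have g3 : v ∉ T := by rw [← h3]; simpa using g2
    simp only [Finset.mem_union, mem_supp, not_or]
    exact ⟨⟨hY v hv g1 g3, fun g => g1 (hdisj v hv (Or.inl g)).1⟩, hv⟩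

/-- Vertices of `P` are useless for `B`, so `A` is taken inside `P` if possible and otherwise as a
superset of `P`; this obstructs `B` least. -/
theorem exists_disjoint_subsets {N P Q : Finset V} (hP : P ⊆ N) (hPQ : Disjoint P Q) {r s : ℕ}
    (hr : r ≤ (N \ Q).card) (hs : s ≤ (N \ P).card) (hrs : r + s ≤ N.card) :
    ∃ A B : Finset V, A ⊆ N \ Q ∧ B ⊆ N \ P ∧ Disjoint A B ∧ A.card = r ∧ B.card = s := by
  have hPN : P ⊆ N \ Q := fun v hv =>
    Finset.mem_sdiff.2 ⟨hP hv, Finset.disjoint_left.1 hPQ hv⟩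
  rcases le_total r P.card with h | h
  · obtain ⟨A, hA, hAr⟩ := Finset.exists_subset_card_eq h
    obtain ⟨B, hB, hBs⟩ := Finset.exists_subset_card_eq hs
    exact ⟨A, B, hA.trans hPN, hB,
      Finset.disjoint_left.2 fun v hv hv' => (Finset.mem_sdiff.1 (hB hv')).2 (hA hv), hAr, hBs⟩
  · obtain ⟨A, hPA, hA, hAr⟩ := Finset.exists_subsuperset_card_eq hPN h hr
    have hAN : A ⊆ N := hA.trans Finset.sdiff_subset
    obtain ⟨B, hB, hBs⟩ := Finset.exists_subset_card_eq
      (show s ≤ (N \ A).card by rw [Finset.card_sdiff_of_subset hAN]; omega)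
    exact ⟨A, B, hA, hB.trans (Finset.sdiff_subset_sdiff subset_rfl hPA),
      Finset.disjoint_left.2 fun v hv hv' => (Finset.mem_sdiff.1 (hB hv')).2 hv, hAr, hBs⟩

/-- Distribute `N` to two sets of `a` and `b` tokens of which most are to be put on a set of
`d` vertices. -/
theorem exists_split {N P Q : Finset V} (hP : P ⊆ N) (hQ : Q ⊆ N) (hPQ : Disjoint P Q)
    {a b d : ℕ} (hd : 2 ≤ d) (ha : a + 1 ≤ d + (N \ Q).card) (hb : b + 1 ≤ d + (N \ P).card)
    (hab : a + b + 3 ≤ 2 * d + N.card) :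
    ∃ A B : Finset V, A ⊆ N \ Q ∧ B ⊆ N \ P ∧ Disjoint A B ∧ A.card ≤ a ∧ B.card ≤ b ∧
      a + 1 ≤ A.card + d ∧ b + 1 ≤ B.card + d ∧
      (a - A.card + (b - B.card) + 3 ≤ 2 * d ∨ A = ∅ ∧ B = ∅) := by
  -- Both sides fit on the `d` vertices with one to spare, so `N` is not needed and the second
  -- alternative for the slack holds.
  by_cases h1 : a + 1 ≤ d ∧ b + 1 ≤ d
  · exact ⟨∅, ∅, by simp, by simp, by simp, by simp, by simp, by simpa using h1.1,
      by simpa using h1.2, Or.inr ⟨rfl, rfl⟩⟩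
  -- One side already leaves two vertices free; reducing the other to `d - 1` gives total slack 3.
  by_cases h2 : b + 2 ≤ d
  · obtain ⟨A, hA, hAc⟩ := Finset.exists_subset_card_eq
      (show a + 1 - d ≤ (N \ Q).card by omega)
    exact ⟨A, ∅, hA, by simp, by simp, by omega, by simp, by omega, by simp; omega,
      Or.inl (by simp; omega)⟩
  by_cases h3 : a + 2 ≤ d
  · obtain ⟨B, hB, hBc⟩ := Finset.exists_subset_card_eq
      (show b + 1 - d ≤ (N \ P).card by omega)
    exact ⟨∅, B, by simp, hB, by simp, by simp, by omega, by simp; omega, by omega,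
      Or.inl (by simp; omega)⟩
  -- Both sides now have at least `d - 1` tokens. One is reduced to `d - 2` and the other to `d -
  -- 1`; which one gets the extra place depends on whether `N \ Q` is large enough.
  have hPQc : P.card + Q.card ≤ N.card := by
    rw [← Finset.card_union_of_disjoint hPQ]
    exact Finset.card_le_card (Finset.union_subset hP hQ)
  have e1 := Finset.card_sdiff_add_card_eq_card hP
  have e2 := Finset.card_sdiff_add_card_eq_card hQ
  by_cases h4 : a + 2 - d ≤ (N \ Q).card
  · obtain ⟨A, B, hA, hB, hAB, hAc, hBc⟩ := exists_disjoint_subsets hP hPQ h4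
      (show b + 1 - d ≤ (N \ P).card by omega) (by omega)
    exact ⟨A, B, hA, hB, hAB, by omega, by omega, by omega, by omega, Or.inl (by omega)⟩
  · obtain ⟨A, B, hA, hB, hAB, hAc, hBc⟩ := exists_disjoint_subsets hP hPQ
      (show a + 1 - d ≤ (N \ Q).card by omega) (show b + 2 - d ≤ (N \ P).card by omega) (by omega)
    exact ⟨A, B, hA, hB, hAB, by omega, by omega, by omega, by omega, Or.inl (by omega)⟩

/-- The setting: `D` is a set of vertices of the connected set `G` on which tokens can be
permuted freely. -/
structure IsBase (H : SimpleGraph V) (G D : Finset V) : Prop where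
  linked : LinkedVia H G G
  sub : D ⊆ G
  shufflable : Shufflable H D
  three_le : 3 ≤ D.card
  deg : ∀ v ∈ D, ∃ u ∈ D, H.Adj u v

/-- The hypotheses of the main induction: `U` is the set of vertices that may be used, and `N`
consists of vertices of `U` next to `D`. -/
structure IsTask (H : SimpleGraph V) (G D U N : Finset V) (α β : V → Option ι) (k : ℕ) : Prop where
  sub : G ⊆ U
  nbr : ∀ a ∈ U, a ∉ G → ∃ b ∈ G, H.Adj a b
  left_sub : supp α ⊆ U
  right_sub : supp β ⊆ U
  paired : Paired α β
  card : (supp α).card + (supp β).card = 2 * k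
  disj : ∀ v ∉ G, α v = none ∨ β v = none
  left_blank : ∃ v ∈ G, α v = none
  right_blank : ∃ v ∈ G, β v = none
  N_sub : N ⊆ U
  N_adj : ∀ v ∈ N, v ∉ D ∧ ∃ u ∈ D, H.Adj u v
  room : 2 * k + 3 ≤ 2 * D.card + N.card

variable {G D U N : Finset V} {α β : V → Option ι} {k : ℕ}

theorem IsTask.symm (h : IsTask H G D U N α β k) : IsTask H G D U N β α k where
  sub := h.sub
  nbr := h.nbr
  left_sub := h.right_sub
  right_sub := h.left_sub
  paired := h.paired.symm
  card := by rw [← h.card, add_comm]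
  disj v hv := (h.disj v hv).symm
  left_blank := h.right_blank
  right_blank := h.left_blank
  N_sub := h.N_sub
  N_adj := h.N_adj
  room := h.room

/-- Both configurations are moved to disjoint parts of `N` and to `D`, at a cost of one move for
each of the `2 * k` tokens; then `settledRealizable` applies. -/
theorem IsTask.of_fits (hG : IsBase H G D) (M₀ : Move H) (h : IsTask H G D U N α β k)
    (ha : (supp α).card + 1 ≤ D.card + (N.filter fun v => v ∈ G ∨ β v = none).card)
    (hb : (supp β).card + 1 ≤ D.card + (N.filter fun v => v ∈ G ∨ α v = none).card) :
    Realizable H G U α β (k * (2 * (Fintype.card V).factorial + 2) + 2 * k) := by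
  have hcard := h.card
  have hroom := h.room
  -- `P` and `Q` are the vertices of `N` outside `G` occupied by `α` and by `β`. To keep them
  -- singular, each is forbidden to the other side.
  set P := N.filter fun v => ¬ (v ∈ G ∨ α v = none) with hP
  set Q := N.filter fun v => ¬ (v ∈ G ∨ β v = none) with hQ
  have eP : N \ P = N.filter fun v => v ∈ G ∨ α v = none := by
    ext v; simp [hP]; tauto
  have eQ : N \ Q = N.filter fun v => v ∈ G ∨ β v = none := by
    ext v; simp [hQ]; tauto
  obtain ⟨A, B, hA, hB, hAB, hAa, hBb, hAd, hBd, hr⟩ := exists_split (N := N) (P := P) (Q := Q)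
    (a := (supp α).card) (b := (supp β).card) (d := D.card)
    (Finset.filter_subset _ _) (Finset.filter_subset _ _) (Finset.disjoint_left.2 (by
      intro v hv hv'
      simp only [hP, hQ, Finset.mem_filter, not_or] at hv hv'
      rcases h.disj v hv.2.1 with g | g
      · exact hv.2.2 g
      · exact hv'.2.2 g)) (by have := hG.three_le; omega) (by rwa [eQ]) (by rwa [eP]) (by omega)
  rw [eQ] at hA
  rw [eP] at hB
  have hA' : ∀ v ∈ A, v ∈ N ∧ (v ∈ G ∨ β v = none) := fun v hv => Finset.mem_filter.1 (hA hv)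
  have hB' : ∀ v ∈ B, v ∈ N ∧ (v ∈ G ∨ α v = none) := fun v hv => Finset.mem_filter.1 (hB hv)
  obtain ⟨X, hXD, hXc⟩ := Finset.exists_subset_card_eq
    (show (supp α).card - A.card ≤ D.card by omega)
  obtain ⟨Y, hYD, hYc⟩ := Finset.exists_subset_card_eq
    (show (supp β).card - B.card ≤ D.card by omega)
  have hAD : ∀ v ∈ A, v ∉ D := fun v hv => (h.N_adj v (hA' v hv).1).1
  have hBD : ∀ v ∈ B, v ∉ D := fun v hv => (h.N_adj v (hB' v hv).1).1
  have hcX : (A ∪ X).card = (supp α).card := by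
    rw [Finset.card_union_of_disjoint
      (Finset.disjoint_left.2 fun v hv hv' => hAD v hv (hXD hv'))]
    omega
  have hcY : (B ∪ Y).card = (supp β).card := by
    rw [Finset.card_union_of_disjoint
      (Finset.disjoint_left.2 fun v hv hv' => hBD v hv (hYD hv'))]
    omega
  have hXo : ∀ v ∉ D, v ∈ A ∪ X → v ∈ A := fun v hv hv' =>
    (Finset.mem_union.1 hv').resolve_right fun g => hv (hXD g)
  have hYo : ∀ v ∉ D, v ∈ B ∪ Y → v ∈ B := fun v hv hv' =>
    (Finset.mem_union.1 hv').resolve_right fun g => hv (hYD g)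
  have hDG : ∀ v ∉ G, v ∉ D := fun v hv g => hv (hG.sub g)
  have hXU : A ∪ X ⊆ U := Finset.union_subset (fun v hv => h.N_sub (hA' v hv).1)
    ((hXD.trans hG.sub).trans h.sub)
  have hYU : B ∪ Y ⊆ U := Finset.union_subset (fun v hv => h.N_sub (hB' v hv).1)
    ((hYD.trans hG.sub).trans h.sub)
  obtain ⟨α', β', h1, h2, h3, h4⟩ := exists_transit_both hG.linked h.sub h.nbr h.left_sub
    h.right_sub h.paired hXU hYU hcX hcY (by
      rintro v hv (g | g)
      · refine ⟨(h.disj v hv).resolve_left g, fun g' => ?_⟩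
        exact ((hB' v (hYo v (hDG v hv) g')).2.resolve_left hv ▸ g) rfl
      · have g1 := hXo v (hDG v hv) g
        exact ⟨(hA' v g1).2.resolve_left hv, fun g' =>
          Finset.disjoint_left.1 hAB g1 (hYo v (hDG v hv) g')⟩)
  have hα' : ∀ v, α' v ≠ none ↔ v ∈ A ∪ X := fun v => by rw [← h1, mem_supp]
  have hβ' : ∀ v, β' v ≠ none ↔ v ∈ B ∪ Y := fun v => by rw [← h2, mem_supp]
  have eX : supp α' ∩ D = X := by
    rw [h1]; ext v
    simp only [Finset.mem_inter, Finset.mem_union]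
    exact ⟨fun g => g.1.resolve_left fun g' => hAD v g' g.2, fun g => ⟨Or.inr g, hXD g⟩⟩
  have eY : supp β' ∩ D = Y := by
    rw [h2]; ext v
    simp only [Finset.mem_inter, Finset.mem_union]
    exact ⟨fun g => g.1.resolve_left fun g' => hBD v g' g.2, fun g => ⟨Or.inr g, hYD g⟩⟩
  have hs : Settled H D α' β' k 3 :=
    { adj := by
        rintro v hv (g | g)
        · exact (h.N_adj v (hA' v (hXo v hv ((hα' v).1 g))).1).2
        · exact (h.N_adj v (hB' v (hYo v hv ((hβ' v).1 g))).1).2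
      disj := by
        intro v hv
        by_contra g
        push Not at g
        exact Finset.disjoint_left.1 hAB (hXo v hv ((hα' v).1 g.1)) (hYo v hv ((hβ' v).1 g.2))
      left := by rw [eX]; omega
      right := by rw [eY]; omega
      room := by
        rw [eX, eY]
        rcases hr with hr | ⟨rfl, rfl⟩
        · left; omega
        · right
          intro v hv
          constructor
          · by_contra g; simpa using hXo v hv ((hα' v).1 g)
          · by_contra g; simpa using hYo v hv ((hβ' v).1 g)
      paired := h3
      card := by rw [h1, h2]; omega }
  have hreal := settledRealizable hG.shufflable hG.deg M₀ k α' β' hs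
  have hU' : D ∪ supp α' ∪ supp β' ⊆ U := by
    rw [h1, h2]
    exact Finset.union_subset (Finset.union_subset (hG.sub.trans h.sub) hXU) hYU
  refine (h4 _ _ hU' ?_ ?_ (hreal.mono hG.sub subset_rfl le_rfl)).mono subset_rfl subset_rfl
    (by omega)
  · intro v hv g1 g2
    rw [h1, h2, Finset.mem_union, Finset.mem_union, not_or, not_or]
    refine ⟨⟨hDG v hv, g2⟩, fun g' => ?_⟩
    exact ((hB' v (hYo v (hDG v hv) g')).2.resolve_left hv ▸ g1) rfl
  · intro v hv g1 g2
    rw [h1, h2, Finset.mem_union, Finset.mem_union, not_or, not_or]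
    refine ⟨⟨hDG v hv, fun g' => ?_⟩, g2⟩
    exact ((hA' v (hXo v (hDG v hv) g')).2.resolve_left hv ▸ g1) rfl

end Main

/-! ### The overflowing case, and the end of the induction. -/

section Overflow

variable {V : Type*} [DecidableEq V] [Fintype V] {ι : Type*} {H : SimpleGraph V}
variable {G D U N : Finset V} {α β : V → Option ι} {k : ℕ}

/-- A set of tokens that fills all of `D` but one vertex, and all vertices of `N` that are not
needed by the other side. -/
theorem IsTask.exists_full (hG : IsBase H G D) (h : IsTask H G D U N α β k)
    (ha : D.card + (N.filter fun v => v ∈ G ∨ β v = none).card ≤ (supp α).card) {v₀ : V}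
    (hv₀ : v₀ ∈ D) :
    ∃ S : Finset V, D.erase v₀ ∪ (N.filter fun v => v ∈ G ∨ β v = none) ⊆ S ∧
      S ⊆ (U.filter fun v => v ∈ G ∨ β v = none).erase v₀ ∧ S.card = (supp α).card := by
  refine Finset.exists_subsuperset_card_eq ?_ ?_ ?_
  · intro v hv
    rw [Finset.mem_union, Finset.mem_erase, Finset.mem_filter] at hv
    rw [Finset.mem_erase, Finset.mem_filter]
    rcases hv with hv | hv
    · exact ⟨hv.1, h.sub (hG.sub hv.2), Or.inl (hG.sub hv.2)⟩
    · refine ⟨?_, h.N_sub hv.1, hv.2⟩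
      rintro rfl; exact (h.N_adj _ hv.1).1 hv₀
  · refine (Finset.card_union_le _ _).trans ?_
    rw [Finset.card_erase_of_mem hv₀]
    omega
  -- There is enough space even without `v₀`, because `α` itself leaves some vertex `v₁` of `G`
  -- free.
  · obtain ⟨v₁, hv₁, hv₁'⟩ := h.left_blank
    have hmem : ∀ v ∈ G, v ∈ U.filter fun v => v ∈ G ∨ β v = none := fun v hv =>
      Finset.mem_filter.2 ⟨h.sub hv, Or.inl hv⟩
    rw [Finset.card_erase_of_mem (hmem v₀ (hG.sub hv₀)), ← Finset.card_erase_of_mem (hmem v₁ hv₁)]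
    refine Finset.card_le_card fun v hv => ?_
    rw [mem_supp] at hv
    rw [Finset.mem_erase, Finset.mem_filter]
    refine ⟨by rintro rfl; exact hv hv₁', h.left_sub (mem_supp.2 hv), ?_⟩
    by_cases hvG : v ∈ G
    · exact Or.inl hvG
    · exact Or.inr ((h.disj v hvG).resolve_left hv)

/-- By counting, some token of the first configuration on `D` has its partner on `D` or next to
it. -/
theorem exists_near_pair {α β : V → Option ι} (hp : Paired α β) {S T M Q : Finset V} {d : ℕ}
    (hα : supp α = S) (hβ : supp β = T) (hM : M ⊆ S) (hQ : Q ⊆ T)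
    (hd : (M ∩ D).card = d) (ht : S.card + T.card < M.card + Q.card + d) :
    (∃ x ∈ D, ∃ y ∈ M, x ≠ y ∧ α x ≠ none ∧ α x = α y) ∨
      ∃ x ∈ D, ∃ y ∈ Q, α x ≠ none ∧ α x = β y := by
  classical
  by_contra hne
  push Not at hne
  obtain ⟨h1, h2⟩ := hne
  have hex : ∀ x, ∃ q : V ⊕ V, x ∈ M ∩ D → q ∈ (S \ M).disjSum (T \ Q) ∧
      Sum.elim α β q = α x := by
    intro x
    by_cases hx : x ∈ M ∩ D
    · rw [Finset.mem_inter] at hx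
      have hαx : α x ≠ none := by rw [← mem_supp, hα]; exact hM hx.1
      rcases hp.exists_partner hαx with ⟨w, hw, e⟩ | ⟨w, e⟩
      · refine ⟨Sum.inl w, fun _ => ⟨?_, e.symm⟩⟩
        rw [Finset.inl_mem_disjSum, Finset.mem_sdiff, ← hα, mem_supp, ← e]
        exact ⟨hαx, fun hwM => h1 x hx.2 w hwM hw.symm hαx e⟩
      · refine ⟨Sum.inr w, fun _ => ⟨?_, e.symm⟩⟩
        rw [Finset.inr_mem_disjSum, Finset.mem_sdiff, ← hβ, mem_supp, ← e]
        exact ⟨hαx, fun hwQ => h2 x hx.2 w hwQ hαx e⟩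
    · exact ⟨Sum.inl x, fun h => absurd h hx⟩
  choose f hf using hex
  -- Were there no such pair, taking partners would inject the tokens on `M ∩ D` into those of `S \
  -- M` and `T \ Q`, which are too few.
  have hle : (M ∩ D).card ≤ ((S \ M).disjSum (T \ Q)).card := by
    refine Finset.card_le_card_of_injOn f (fun x hx => (hf x hx).1) ?_
    intro x hx y hy hxy
    by_contra hxy'
    have hx' := Finset.mem_inter.1 hx
    have hy' := Finset.mem_inter.1 hy
    refine h1 x hx'.2 y hy'.1 hxy' (by rw [← mem_supp, hα]; exact hM hx'.1) ?_
    rw [← (hf x hx).2, ← (hf y hy).2, hxy]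
  have e1 := Finset.card_sdiff_add_card_eq_card hM
  have e2 := Finset.card_sdiff_add_card_eq_card hQ
  rw [Finset.card_disjSum] at hle
  omega

/-- `α` is moved so as to fill `D` except `v₀` and all vertices of `N` available to it. `β` keeps
its tokens on the remaining vertices `Q` of `N` and has its other tokens on `D`. Together they cover
`N`, so counting yields a pair that can be resolved at once. Vertices outside `G` abandoned on the
way are removed from `U` before induction. -/
theorem IsTask.of_overflow (hG : IsBase H G D) {F : ℕ}
    (ih : ∀ (U N : Finset V) (α β : V → Option ι), IsTask H G D U N α β k →
      Realizable H G U α β F)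
    (h : IsTask H G D U N α β (k + 1))
    (ha : D.card + (N.filter fun v => v ∈ G ∨ β v = none).card ≤ (supp α).card) :
    Realizable H G U α β (F + 1 + (Fintype.card V).factorial + 2 * (k + 1)) := by
  classical
  have hcard := h.card
  have hroom := h.room
  have h3 := hG.three_le
  obtain ⟨v₀, hv₀⟩ := Finset.card_pos.1 (by omega : 0 < D.card)
  obtain ⟨S, hS1, hS2, hcS⟩ := h.exists_full hG ha hv₀
  set NX := N.filter fun v => v ∈ G ∨ β v = none with hNX
  set Q := N.filter fun v => ¬ (v ∈ G ∨ β v = none) with hQ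
  have hNQ : NX.card + Q.card = N.card := Finset.card_filter_add_card_filter_not _
  have hQmem : ∀ v, v ∈ Q ↔ v ∈ N ∧ v ∉ G ∧ β v ≠ none := fun v => by
    simp [hQ]
  have hQβ : Q ⊆ supp β := fun v hv => mem_supp.2 ((hQmem v).1 hv).2.2
  have hDQ : Disjoint (D.erase v₀) Q := Finset.disjoint_left.2 fun v hv hv' =>
    (h.N_adj v ((hQmem v).1 hv').1).1 (Finset.mem_of_mem_erase hv)
  have hDX : Disjoint (D.erase v₀) NX := Finset.disjoint_left.2 fun v hv hv' =>
    (h.N_adj v (Finset.mem_filter.1 hv').1).1 (Finset.mem_of_mem_erase hv)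
  have hDe : (D.erase v₀).card + 1 = D.card := Finset.card_erase_add_one hv₀
  obtain ⟨T, hT1, hT2, hcT⟩ := Finset.exists_subsuperset_card_eq
    (show Q ⊆ D.erase v₀ ∪ Q from Finset.subset_union_right) (n := (supp β).card)
    (Finset.card_le_card hQβ) (by rw [Finset.card_union_of_disjoint hDQ]; omega)
  have hSU : S ⊆ U := fun v hv =>
    (Finset.mem_filter.1 (Finset.mem_of_mem_erase (hS2 hv))).1
  have hSβ : ∀ v ∈ S, v ∉ G → β v = none := fun v hv hvG =>
    (Finset.mem_filter.1 (Finset.mem_of_mem_erase (hS2 hv))).2.resolve_left hvG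
  have hv₀S : v₀ ∉ S := fun g => (Finset.notMem_erase v₀ _) (hS2 g)
  have hTD : ∀ v ∈ T, v ∉ D → v ∈ Q := fun v hv hvD =>
    (Finset.mem_union.1 (hT2 hv)).resolve_left fun g => hvD (Finset.mem_of_mem_erase g)
  have hTQ : ∀ v ∈ T, v ∉ G → v ∈ Q := fun v hv hvG => hTD v hv fun g => hvG (hG.sub g)
  have hTU : T ⊆ U := by
    intro v hv
    by_cases hvG : v ∈ G
    · exact h.sub hvG
    · exact h.N_sub ((hQmem v).1 (hTQ v hv hvG)).1
  have hv₀T : v₀ ∉ T := by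
    intro g
    rcases Finset.mem_union.1 (hT2 g) with g | g
    · exact Finset.notMem_erase _ _ g
    · exact (h.N_adj v₀ ((hQmem v₀).1 g).1).1 hv₀
  have hST : ∀ v ∉ G, v ∈ S → v ∉ T := fun v hv hvS hvT =>
    ((hQmem v).1 (hTQ v hvT hv)).2.2 (hSβ v hvS hv)
  obtain ⟨α', β', h1, h2, hp, hback⟩ := exists_transit_both hG.linked h.sub h.nbr h.left_sub
    h.right_sub h.paired hSU hTU hcS hcT (by
      rintro v hv (g | g)
      · have g1 := (h.disj v hv).resolve_left g
        exact ⟨g1, fun g' => ((hQmem v).1 (hTQ v g' hv)).2.2 g1⟩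
      · exact ⟨hSβ v g hv, hST v hv g⟩)
  have hα' : ∀ v, α' v ≠ none ↔ v ∈ S := fun v => by rw [← h1, mem_supp]
  have hβ' : ∀ v, β' v ≠ none ↔ v ∈ T := fun v => by rw [← h2, mem_supp]
  have hα'0 : α' v₀ = none := by by_contra g; exact hv₀S ((hα' v₀).1 g)
  have hβ'0 : β' v₀ = none := by by_contra g; exact hv₀T ((hβ' v₀).1 g)
  -- the vertices that may be used after one pair, with one end at `y`, has been dealt with
  let U' : V → Finset V := fun y =>
    U.filter fun v => v ∈ G ∨ (v ≠ y ∧ (α v ≠ none → v ∈ S) ∧ (β v ≠ none → v ∈ T))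
  have finish : ∀ (y : V) (α'' β'' : V → Option ι), y ∈ U →
      (y ∉ G → α y ≠ none → y ∈ S) → (y ∉ G → β y ≠ none → y ∈ T) →
      (∀ v ∉ D, α'' v ≠ none → v ∈ S) → (∀ v ∉ D, β'' v ≠ none → v ∈ T) →
      (y ∉ G → α'' y = none ∧ β'' y = none) → Paired α'' β'' →
      (supp α'').card + (supp β'').card = 2 * k → (supp α'' ∩ D).card < D.card →
      β'' v₀ = none →
      (∀ m, Realizable H G (U' y) α'' β'' m →
        Realizable H G (insert y (U' y ∪ D)) α' β' (m + 1 + (Fintype.card V).factorial)) →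
      Realizable H G U α β (F + 1 + (Fintype.card V).factorial + 2 * (k + 1)) := by
    intro y α'' β'' hyU hyS hyT hα'' hβ'' hy hp'' hcard'' hbl hbr hstep
    have hDG : ∀ v ∉ G, v ∉ D := fun v hv g => hv (hG.sub g)
    have hsubl : supp α'' ⊆ U' y := by
      intro v hv
      rw [mem_supp] at hv
      simp only [U', Finset.mem_filter]
      by_cases hvG : v ∈ G
      · exact ⟨h.sub hvG, Or.inl hvG⟩
      · have hvS := hα'' v (hDG v hvG) hv
        exact ⟨hSU hvS, Or.inr ⟨by rintro rfl; exact hv (hy hvG).1, fun _ => hvS,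
          fun g => absurd (hSβ v hvS hvG) g⟩⟩
    have hsubr : supp β'' ⊆ U' y := by
      intro v hv
      rw [mem_supp] at hv
      simp only [U', Finset.mem_filter]
      by_cases hvG : v ∈ G
      · exact ⟨h.sub hvG, Or.inl hvG⟩
      · have hvT := hβ'' v (hDG v hvG) hv
        exact ⟨hTU hvT, Or.inr ⟨by rintro rfl; exact hv (hy hvG).2,
          fun g => absurd ((h.disj v hvG).resolve_left g) ((hQmem v).1 (hTQ v hvT hvG)).2.2,
          fun _ => hvT⟩⟩
    have htask : IsTask H G D (U' y) (N.erase y) α'' β'' k :=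
      { sub := fun v hv => by simp [U', hv, h.sub hv]
        nbr := fun v hv hvG => h.nbr v (Finset.mem_filter.1 hv).1 hvG
        left_sub := hsubl
        right_sub := hsubr
        paired := hp''
        card := hcard''
        disj := fun v hv => by
          by_contra g
          push Not at g
          exact hST v hv (hα'' v (hDG v hv) g.1) (hβ'' v (hDG v hv) g.2)
        left_blank := (exists_blank hbl).imp fun v hv => ⟨hG.sub hv.1, hv.2⟩
        right_blank := ⟨v₀, hG.sub hv₀, hbr⟩
        N_sub := by
          intro v hv
          rw [Finset.mem_erase] at hv
          simp only [U', Finset.mem_filter]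
          refine ⟨h.N_sub hv.2, ?_⟩
          by_cases hvG : v ∈ G
          · exact Or.inl hvG
          · refine Or.inr ⟨hv.1, fun g => ?_, fun g => ?_⟩
            · refine hS1 (Finset.mem_union_right _ (Finset.mem_filter.2 ⟨hv.2, Or.inr ?_⟩))
              exact (h.disj v hvG).resolve_left g
            · exact hT1 ((hQmem v).2 ⟨hv.2, hvG, g⟩)
        N_adj := fun v hv => h.N_adj v (Finset.mem_of_mem_erase hv)
        -- One pair less lowers the left side by two, while `N` loses at most the vertex `y`.
        room := by
          have := Finset.pred_card_le_card_erase (a := y) (s := N)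
          omega }
    refine (hback _ _ ?_ ?_ ?_ (hstep _ (ih _ _ _ _ htask))).mono subset_rfl subset_rfl (by omega)
    · exact Finset.insert_subset hyU (Finset.union_subset (Finset.filter_subset _ _)
        (hG.sub.trans h.sub))
    · intro v hv g1 g2
      rw [Finset.mem_insert, Finset.mem_union, not_or, not_or]
      refine ⟨by rintro rfl; exact g2 (hyS hv g1), fun g => ?_, hDG v hv⟩
      exact g2 (((Finset.mem_filter.1 g).2.resolve_left hv).2.1 g1)
    · intro v hv g1 g2
      rw [Finset.mem_insert, Finset.mem_union, not_or, not_or]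
      refine ⟨by rintro rfl; exact g2 (hyT hv g1), fun g => ?_, hDG v hv⟩
      exact g2 (((Finset.mem_filter.1 g).2.resolve_left hv).2.2 g1)
  have hMD : (D.erase v₀ ∪ NX) ∩ D = D.erase v₀ := by
    ext v
    simp only [Finset.mem_inter, Finset.mem_union]
    constructor
    · rintro ⟨g | g, g'⟩
      · exact g
      · exact absurd g' (h.N_adj v (Finset.mem_filter.1 g).1).1
    · exact fun g => ⟨Or.inl g, Finset.mem_of_mem_erase g⟩
  -- The count is $(|D|-1+|NX|)+|Q|+(|D|-1)=2|D|+|N|-2$, which exceeds the number $2(k+1)$ of tokens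
  -- by the hypothesis on the room.
  rcases exists_near_pair (D := D) hp h1 h2 hS1 hT1 (by rw [hMD]) (by
    rw [Finset.card_union_of_disjoint hDX]; omega) with
    ⟨x, hx, y, hy, hxy, hαx, he⟩ | ⟨x, hx, y, hy, hαx, he⟩
  · have hyS : y ∈ S := hS1 hy
    obtain ⟨u, hu, huy⟩ : ∃ u ∈ D, H.Adj u y := by
      rcases Finset.mem_union.1 hy with hy | hy
      · exact hG.deg y (Finset.mem_of_mem_erase hy)
      · exact (h.N_adj y (Finset.mem_filter.1 hy).1).2
    obtain ⟨α'', g1, g2, g3, g4, g5⟩ :=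
      exists_kill hG.shufflable hG.sub hp hv₀ hα'0 hx hxy hαx he hu huy
    refine finish y α'' β' (hSU hyS) (fun _ _ => hyS) (fun hyG g => absurd (hSβ y hyS hyG) g)
      (fun v hv g => (hα' v).1 (g1 v hv g).1) (fun v _ g => (hβ' v).1 g) ?_ g4 ?_
      (g2.trans_le (Finset.card_le_card Finset.inter_subset_right)) hβ'0 ?_
    · intro hyG
      constructor
      · by_contra g
        exact (g1 y (fun g' => hyG (hG.sub g')) g).2 rfl
      · by_contra g
        exact hST y hyG hyS ((hβ' y).1 g)
    · rw [h1] at g3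
      rw [h2]
      omega
    · exact fun m hr => g5 _ _ (fun hyG => by simp [U', hyG]) hr
  · have hyT : y ∈ T := hT1 hy
    obtain ⟨hyN, hyG, hβy⟩ := (hQmem y).1 hy
    have hαy : α' y = none := by
      by_contra g
      exact hST y hyG ((hα' y).1 g) hyT
    obtain ⟨u, hu, huy⟩ := (h.N_adj y hyN).2
    obtain ⟨α'', g1, g2, g3, g4, g5⟩ :=
      exists_transport hG.shufflable hG.sub hp hv₀ hα'0 hx hαx he hαy hyG hu huy
    have hle : ∀ v, Function.update β' y none v ≠ none → β' v ≠ none := by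
      intro v hv
      by_cases hvy : v = y
      · subst hvy; simp at hv
      · rwa [Function.update_of_ne hvy] at hv
    refine finish y α'' (Function.update β' y none) (hTU hyT)
      (fun _ g => absurd ((h.disj y hyG).resolve_left g) hβy) (fun _ _ => hyT)
      (fun v hv g => (hα' v).1 (by rwa [g1 v hv] at g)) (fun v _ g => (hβ' v).1 (hle v g)) ?_ g4 ?_
      (g2.trans_le (Finset.card_le_card Finset.inter_subset_right)) ?_ ?_
    · intro _
      rw [g1 y (fun g' => hyG (hG.sub g'))]
      exact ⟨hαy, by simp⟩
    · have := card_supp_update (α := β') (x := y) ((hβ' y).2 hyT)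
      rw [h1] at g3
      rw [h2] at this
      omega
    · by_contra g
      exact hle v₀ g hβ'0
    · exact fun m hr => g5 _ _ (by simp [U', hyG]) hr

theorem settled_bound_le (n k : ℕ) :
    k * (2 * n.factorial + 2) + 2 * k ≤ lengthBound n k := by
  induction k with
  | zero => simp [lengthBound]
  | succ k ih =>
    rw [lengthBound]
    have : (k + 1) * (2 * n.factorial + 2) = k * (2 * n.factorial + 2) + 2 * n.factorial + 2 := by
      ring
    omega

/-- Either one of the two sides overflows, the second being reduced to the first by reversing time,
or both fit. The bound absorbs the `2 * (k + 1)` moves of the transit and one shuffle with its move.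
-/
theorem IsTask.realizable (hG : IsBase H G D) (M₀ : Move H) {n : ℕ} (hn : Fintype.card V ≤ n)
    (k : ℕ) : ∀ (U N : Finset V) (α β : V → Option ι), IsTask H G D U N α β k →
      Realizable H G U α β (lengthBound n k) := by
  have hfac : (Fintype.card V).factorial ≤ n.factorial := Nat.factorial_le hn
  have hfit : ∀ (k : ℕ) (U N : Finset V) (α β : V → Option ι), IsTask H G D U N α β k →
      (supp α).card + 1 ≤ D.card + (N.filter fun v => v ∈ G ∨ β v = none).card →
      (supp β).card + 1 ≤ D.card + (N.filter fun v => v ∈ G ∨ α v = none).card →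
      Realizable H G U α β (lengthBound n k) := by
    intro k U N α β h ha hb
    refine (h.of_fits hG M₀ ha hb).mono subset_rfl subset_rfl
      (le_trans ?_ (settled_bound_le n k))
    gcongr
  induction k with
  | zero =>
    intro U N α β h
    have hc := h.card
    have := hG.three_le
    exact hfit 0 U N α β h (by omega) (by omega)
  | succ k ih =>
    intro U N α β h
    have hle : lengthBound n k + 1 + (Fintype.card V).factorial + 2 * (k + 1) ≤
        lengthBound n (k + 1) := by
      rw [lengthBound]; omega
    by_cases ha : D.card + (N.filter fun v => v ∈ G ∨ β v = none).card ≤ (supp α).card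
    · exact (h.of_overflow hG ih ha).mono subset_rfl subset_rfl hle
    by_cases hb : D.card + (N.filter fun v => v ∈ G ∨ α v = none).card ≤ (supp β).card
    · exact (h.symm.of_overflow hG ih hb).symm.mono subset_rfl subset_rfl hle
    exact hfit _ U N α β h (by omega) (by omega)

end Overflow

/-! ### From blocks and pairings to tasks, and the theorem. -/

section Translation

variable {V : Type*} {H : SimpleGraph V}

theorem linkedVia_of_minus_connected [DecidableEq V] [Fintype V] {A : Finset V}
    (h : (minus H A).Connected) : LinkedVia H Aᶜ Aᶜ := by
  have hmem : ∀ v, v ∈ (minus H A).verts ↔ v ∈ Aᶜ := fun v => by simp [minus]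
  intro v hv w hw
  obtain ⟨p⟩ := h.coe.preconnected ⟨v, (hmem v).2 hv⟩ ⟨w, (hmem w).2 hw⟩
  refine ⟨p.map (minus H A).hom, fun u hu => ?_⟩
  have hu' : u ∈ Aᶜ := by
    have hu2 : u ∈ p.support.map (minus H A).hom := by
      rw [← SimpleGraph.Walk.support_map]; exact hu
    obtain ⟨u', -, rfl⟩ := List.mem_map.1 hu2
    exact (hmem _).1 u'.2
  exact ⟨hu', fun _ _ => hu'⟩

theorem isBase_of_isBlock [DecidableEq V] [Fintype V] {A D' : Finset V} {D : H.Subgraph}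
    (hA : (minus H A).Connected) (hD : IsBlock (minus H A) D) (hT : ContainsTriangle D)
    (hD' : ∀ v, v ∈ D' ↔ v ∈ D.verts) : IsBase H Aᶜ D' := by
  obtain ⟨hle, hcut⟩ := hD.prop
  obtain ⟨hs, h3⟩ := shufflable_of_connectedNoCutvertex hcut hT hD'
  refine ⟨linkedVia_of_minus_connected hA, fun v hv => ?_, hs, h3, fun v hv => ?_⟩
  · have := hle.1 ((hD' v).1 hv)
    simpa [minus] using this
  · obtain ⟨w, hw, hwv⟩ := Finset.exists_mem_ne (show 1 < D'.card by omega) v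
    obtain ⟨p⟩ := hcut.1.coe.preconnected ⟨v, (hD' v).1 hv⟩ ⟨w, (hD' w).1 hw⟩
    cases p with
    | nil => exact absurd rfl hwv
    | cons hadj _ =>
      rw [SimpleGraph.Subgraph.coe_adj] at hadj
      exact ⟨_, (hD' _).2 hadj.snd_mem, hadj.adj_sub.symm⟩

theorem ContainsTriangle.nonempty_move {D : H.Subgraph} (h : ContainsTriangle D) :
    Nonempty (Move H) := by
  obtain ⟨a, b, -, hab, -, -⟩ := h
  exact ⟨⟨a, b, hab.adj_sub.toWalk, by simp [hab.adj_sub.ne], hab.adj_sub.ne⟩⟩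

open Classical in
/-- The label of an occupied vertex is the edge of the pairing at that vertex. -/
noncomputable def pairLabel (Z : Finset V) (L : SimpleGraph (V ⊕ V)) (f : V → V ⊕ V) (v : V) :
    Option (Set (V ⊕ V)) :=
  if v ∈ Z then some {q | q = f v ∨ L.Adj (f v) q} else none

theorem pairLabel_ne_none {Z : Finset V} {L : SimpleGraph (V ⊕ V)} {f : V → V ⊕ V} {v : V} :
    pairLabel Z L f v ≠ none ↔ v ∈ Z := by
  simp [pairLabel]

section Pairing

variable {X Y : Finset V} {L : SimpleGraph (V ⊕ V)}

theorem elim_pairLabel {p : V ⊕ V} (hp : p ∈ X.disjSum Y) :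
    Sum.elim (pairLabel X L Sum.inl) (pairLabel Y L Sum.inr) p =
      some {q | q = p ∨ L.Adj p q} := by
  rcases p with p | p
  · simp [pairLabel, Finset.inl_mem_disjSum.1 hp]
  · simp [pairLabel, Finset.inr_mem_disjSum.1 hp]

theorem elim_pairLabel_ne_none {p : V ⊕ V} :
    Sum.elim (pairLabel X L Sum.inl) (pairLabel Y L Sum.inr) p ≠ none ↔ p ∈ X.disjSum Y := by
  rcases p with p | p <;> simp [pairLabel]

theorem IsPairing.unique (hL : IsPairing X Y L) {p q r : V ⊕ V} (hq : L.Adj p q)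
    (hr : L.Adj p r) : q = r :=
  (hL.2 p (hL.1 p q hq)).unique hq hr

/-- The label of an end is the set consisting of it and its partner, so two distinct ends have equal
labels exactly when they are partners. -/
theorem IsPairing.adj_iff (hL : IsPairing X Y L) (p q : V ⊕ V) :
    L.Adj p q ↔ p ≠ q ∧
      Sum.elim (pairLabel X L Sum.inl) (pairLabel Y L Sum.inr) p ≠ none ∧
      Sum.elim (pairLabel X L Sum.inl) (pairLabel Y L Sum.inr) p =
        Sum.elim (pairLabel X L Sum.inl) (pairLabel Y L Sum.inr) q := by
  constructor
  · intro h
    have hp := hL.1 p q h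
    have hq := hL.1 q p h.symm
    refine ⟨h.ne, elim_pairLabel_ne_none.2 hp, ?_⟩
    rw [elim_pairLabel hp, elim_pairLabel hq]
    congr 1
    ext r
    constructor
    · rintro (rfl | hr)
      · exact Or.inr h.symm
      · exact Or.inl (hL.unique hr h)
    · rintro (rfl | hr)
      · exact Or.inr h
      · exact Or.inl (hL.unique hr h.symm)
  · rintro ⟨hne, hp, he⟩
    have hq := elim_pairLabel_ne_none.1 (he ▸ hp)
    rw [elim_pairLabel (elim_pairLabel_ne_none.1 hp), elim_pairLabel hq] at he
    have : q ∈ {r | r = p ∨ L.Adj p r} := by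
      rw [Option.some.inj he]; exact Or.inl rfl
    exact this.resolve_left hne.symm

theorem IsPairing.paired (hL : IsPairing X Y L) :
    Paired (pairLabel X L Sum.inl) (pairLabel Y L Sum.inr) := by
  intro p hp
  obtain ⟨q, hq, -⟩ := hL.2 p (elim_pairLabel_ne_none.1 hp)
  refine ⟨q, hq.ne.symm, ((hL.adj_iff p q).1 hq).2.2.symm, fun r hr => ?_⟩
  by_cases hrp : r = p
  · exact Or.inl hrp
  · exact Or.inr (hL.unique ((hL.adj_iff p r).2 ⟨fun g => hrp g.symm, hp, hr.symm⟩) hq)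

end Pairing

variable [DecidableEq V] [Fintype V] {ι : Type*}

/-- A movement can be taken of positive length, by moving some token back and forth. -/
theorem Realizable.exists_pos {G : Finset V} {α β : V → Option ι} {m : ℕ}
    (h : Realizable H G Finset.univ α β m) (hG : LinkedVia H G G) (M₀ : Move H) (hm : 2 ≤ m)
    (hne : ∃ v, α v ≠ none ∨ β v ≠ none) (hdisj : ∀ v ∉ G, α v = none ∨ β v = none)
    (hbl : ∃ v ∈ G, α v = none) :
    ∃ l, 0 < l ∧ l ≤ m ∧ RealizableIn H G Finset.univ α β l := by
  obtain ⟨l, hl, h⟩ := h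
  rcases Nat.eq_zero_or_pos l with rfl | hpos
  -- Length zero means `α = β`, and then disjointness outside `G` puts all tokens into `G`. Moving a
  -- token to a free vertex of `G` and back thus leaves all vertices outside `G` alone.
  · obtain ⟨c, M, h0, h1, -⟩ := h
    obtain rfl : α = β := h0.symm.trans h1
    have hocc : ∀ v, α v ≠ none → v ∈ G := fun v hv => by
      by_contra hvG
      exact hv ((or_self_iff).1 (hdisj v hvG))
    obtain ⟨x, hx⟩ := hne
    rw [or_self_iff] at hx
    obtain ⟨y, hyG, hy, p, hp, hin⟩ := hG.exists_nearest (fun v => α v = none) (hocc x hx) hbl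
    obtain ⟨z, hzG, hz, q, hq, hin'⟩ :=
      hG.exists_nearest (fun v => α v ≠ none) hyG ⟨x, hocc x hx, hx⟩
    have hzy : z ≠ y := by rintro rfl; exact hz hy
    have hfree : FreePath H G α z y := FreePath.symm ⟨q, hq, fun v hv g1 g2 =>
      ⟨(hin' v hv g1 g2).2.1, by simpa using (hin' v hv g1 g2).2.2⟩⟩
    have hfree' : FreePath H G (α ∘ Equiv.swap z y) y z := by
      obtain ⟨r, hr, hr'⟩ := hfree.symm
      refine ⟨r, hr, fun v hv g1 g2 => ⟨(hr' v hv g1 g2).1, ?_⟩⟩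
      simpa [Equiv.swap_apply_of_ne_of_ne g2 g1] using (hr' v hv g1 g2).2
    have hback : (α ∘ Equiv.swap z y) ∘ Equiv.swap y z = α := by
      funext v
      simp [Equiv.swap_comm y z]
    have e0 : RealizableIn H G Finset.univ α α 0 := RealizableIn.refl M₀ (by simp)
    have e1 : RealizableIn H G (insert y Finset.univ) (α ∘ Equiv.swap z y) α 1 :=
      RealizableIn.slide (by rwa [hback]) (by simpa using hz) (by simpa using hy) hfree'
        (fun g => absurd hyG g)
    have e2 := RealizableIn.slide e1 hz hy hfree (fun g => absurd hzG g)
    exact ⟨2, by omega, hm, e2.mono subset_rfl (Finset.subset_univ _)⟩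
  · exact ⟨l, hpos, hl, h⟩

end Translation

end TokenGame

theorem mainTheorem5 {V : Type*} [Fintype V] [DecidableEq V]
    (n k : ℕ) (hk : 0 < k)
    (H : SimpleGraph V) (hconn : H.Connected) (hcard : Fintype.card V ≤ n)
    (A : Finset V) (hA : TokenGame.IsMarginal H A)
    (X Y : Finset V) (hXY : X.card + Y.card = 2 * k)
    (hXYA : X ∩ Y ∩ A = ∅)
    (hX : ∃ v, v ∉ A ∧ v ∉ X) (hY : ∃ v, v ∉ A ∧ v ∉ Y)
    (hD : ∃ D : H.Subgraph,
      TokenGame.IsBlock (TokenGame.minus H A) D ∧ TokenGame.ContainsTriangle D ∧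
      2 * k + 3 ≤ 2 * D.verts.ncard + (TokenGame.nbhd D).ncard)
    (L : SimpleGraph (V ⊕ V)) (hL : TokenGame.IsPairing X Y L) :
    ∃ 𝓜 : TokenGame.Movement H,
      𝓜.config 0 = X ∧ 𝓜.config 𝓜.length = Y ∧ 𝓜.inducedPairing = L ∧
      𝓜.length ≤ TokenGame.lengthBound n k ∧ ∀ a ∈ A, 𝓜.IsSingular a := by
  classical
  obtain ⟨D, hblock, hT, hroom⟩ := hD
  obtain ⟨M₀⟩ := hT.nonempty_move
  have hbase : TokenGame.IsBase H Aᶜ D.verts.toFinset :=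
    TokenGame.isBase_of_isBlock hA.1 hblock hT (fun v => Set.mem_toFinset)
  have hsX : TokenGame.supp (TokenGame.pairLabel X L Sum.inl) = X := by
    ext v; rw [TokenGame.mem_supp, TokenGame.pairLabel_ne_none]
  have hsY : TokenGame.supp (TokenGame.pairLabel Y L Sum.inr) = Y := by
    ext v; rw [TokenGame.mem_supp, TokenGame.pairLabel_ne_none]
  -- At the start nothing is forbidden: `U` is the whole vertex set, `G` is the complement of `A`,
  -- and `N` is the full neighbourhood of the block.
  have htask : TokenGame.IsTask H Aᶜ D.verts.toFinset Finset.univ (TokenGame.nbhd D).toFinset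
      (TokenGame.pairLabel X L Sum.inl) (TokenGame.pairLabel Y L Sum.inr) k :=
    { sub := Finset.subset_univ _
      nbr := fun a _ ha => by
        obtain ⟨b, hb, hab⟩ := hA.2 a (by simpa using ha)
        exact ⟨b, by simpa using hb, hab⟩
      left_sub := Finset.subset_univ _
      right_sub := Finset.subset_univ _
      paired := hL.paired
      card := by rw [hsX, hsY, hXY]
      disj := fun v hv => by
        by_contra hne
        rw [not_or, ← ne_eq, ← ne_eq, TokenGame.pairLabel_ne_none,
          TokenGame.pairLabel_ne_none] at hne
        have : v ∈ X ∩ Y ∩ A :=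
          Finset.mem_inter.2 ⟨Finset.mem_inter.2 hne, by simpa using hv⟩
        simp [hXYA] at this
      left_blank := hX.imp fun v hv => ⟨Finset.mem_compl.2 hv.1, by simp [TokenGame.pairLabel, hv.2]⟩
      right_blank := hY.imp fun v hv => ⟨Finset.mem_compl.2 hv.1, by simp [TokenGame.pairLabel, hv.2]⟩
      N_sub := Finset.subset_univ _
      N_adj := fun v hv => by
        obtain ⟨h1, u, hu, h2⟩ := Set.mem_toFinset.1 hv
        exact ⟨by simpa using h1, u, by simpa using hu, h2⟩
      room := by rwa [Set.ncard_eq_toFinset_card', Set.ncard_eq_toFinset_card'] at hroom }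
  have hne : ∃ v, TokenGame.pairLabel X L Sum.inl v ≠ none ∨
      TokenGame.pairLabel Y L Sum.inr v ≠ none := by
    simp only [TokenGame.pairLabel_ne_none]
    by_contra! hne
    have h1 : X = ∅ := Finset.eq_empty_of_forall_notMem fun v => (hne v).1
    have h2 : Y = ∅ := Finset.eq_empty_of_forall_notMem fun v => (hne v).2
    simp only [h1, h2, Finset.card_empty] at hXY
    omega
  have hbound : 2 ≤ TokenGame.lengthBound n k := by
    obtain ⟨j, rfl⟩ := Nat.exists_eq_add_of_lt hk
    rw [Nat.zero_add, TokenGame.lengthBound]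
    omega
  obtain ⟨l, hl, hle, hr⟩ := (htask.realizable hbase M₀ hcard k).exists_pos hbase.linked M₀ hbound
    hne htask.disj htask.left_blank
  obtain ⟨𝓜, h1, h2, h3, rfl, h5⟩ := hr.exists_movement hl
    (fun v => TokenGame.pairLabel_ne_none.symm) (fun v => TokenGame.pairLabel_ne_none.symm)
    hL.adj_iff (fun p q r => hL.unique)
  exact ⟨𝓜, h1, h2, h3, hle, fun a ha => h5 a (by simpa using ha)⟩
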